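/- Consider the class of equations $$f(x)u_t=(g(x)u_x)_x+h(x)e^{mu},\qquad (*)$$ where the arbitrary elements are smooth real functions $f,g,h$ without zeros on an open interval $I$ and a constant $m\neq0$; write $\theta=(f,g,h,m)$. A (generalized extended) transformation from $I$ to an open interval $\tilde I$, on a box $J\times I\times K$ of open intervals for $(t,x,u)$, consists of a bijection $\theta\mapsto\tilde\theta$ from the arbitrary elements on $I$ to those on $\tilde I$ and, for each $\theta$, a nondegenerate smooth point transformation $(t,x,u)\mapsto(\tilde t,\tilde x,\tilde u)$ of the box whose $\tilde x$-component has range $\tilde I$. Both may depend on $\theta$ nonlocally, but smoothly: smooth one-parameter families of arbitrary elements are mapped to smooth families by $\theta\mapsto\tilde\theta$ and by its inverse, and the point transformations along such a family are jointly smooth in the parameter and $(t,x,u)$. It is an equivalence transformation of $(*)$ if for every $\theta$ the point transformation, prolonged to second-order jets, maps equation $(*)$ with arbitrary elements $\theta$ to equation $(*)$ with arbitrary elements $\tilde\theta$. It is usual if $\tilde t,\tilde x,\tilde u$ do not depend on $\theta$ and it is a point transformation in $(t,x,u,f,g,h,m)$. **Theorem 1.** (a) A transformation is an equivalence transformation of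 $(*)$ if and only if for every $\theta$ it has the form $$\tilde t=\delta_1t+\delta_2,\quad \tilde x=\varphi(x),\quad \tilde u=\delta_3u+\psi(x),$$ $$\tilde f=\frac{\delta_0\delta_1}{\varphi_x}f,\quad \tilde g=\delta_0\varphi_x g,\quad \tilde h=\frac{\delta_0\delta_3}{\varphi_x}e^{-m\psi(x)/\delta_3}h,\quad \tilde m=\frac m{\delta_3},$$ where $\psi(x)=\delta_4\int\frac{dx}{g(x)}+\delta_5$, the $\delta_j$ are constants with $\delta_0\delta_1\delta_3\neq0$, and $\varphi$ is a smooth map of $I$ onto $\tilde I$ with $\varphi_x\neq0$ (the $\delta_j$ and $\varphi$ may depend on $\theta$). (b) All such parameters occur: for all fixed constants $\delta_0,\dots,\delta_5$ with $\delta_0\delta_1\delta_3\ne0$, every smooth $\varphi$ of $I$ onto $\tilde I$ with $\varphi_x\neq0$, and the antiderivative $\int_{x_0}^x dy/g(y)$ for any fixed $x_0\in I$, these formulas define an equivalence transformation. (c) The usual equivalence transformations are exactly those of the above form with $\delta_4=0$ for which $\delta_1,\delta_2,\delta_3,\delta_5$ and $\varphi$ are independent of $\theta$ and the factor $\delta_0$,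 by which the equation is multiplied, depends at most on $m$ and on the signs of $f,g,h$. (d) For $J=K=\mathbb R$, compositions and inverses of equivalence transformations are equivalence transformations (so for $\tilde I=I$ they form a group), and the same holds for the usual ones. -/

import Mathlib

open scoped ContDiff Topology

namespace ReactionDiffusion

/-- Points `(t, x, u)` of the space of independent and dependent variables. -/
abbrev Pt : Type := ℝ × ℝ × ℝ

/-- A nonempty open interval of the real line (bounded or not). -/
def IsOpenInterval (I : Set ℝ) : Prop :=
  IsOpen I ∧ I.OrdConnected ∧ I.Nonempty

/-- The box `J × I × K` of all `(t, x, u)` with `t ∈ J`, `x ∈ I`, `u ∈ K`. -/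
def box (J I K : Set ℝ) : Set Pt := J ×ˢ (I ×ˢ K)

/-- The arbitrary elements of the class `f(x) u_t = (g(x) u_x)_x + h(x) e^{m u}` on the
interval `I`: smooth functions `f, g, h` on `I` without zeros and a constant `m ≠ 0`. The functions
are extended by `0` outside `I`, so that equality of `Coeff I` is equality of `m` and of the
functions on `I`. -/
@[ext]
structure Coeff (I : Set ℝ) where
  f : ℝ → ℝ
  g : ℝ → ℝ
  h : ℝ → ℝ
  m : ℝ
  f_smooth : ContDiffOn ℝ ∞ f I
  g_smooth : ContDiffOn ℝ ∞ g I
  h_smooth : ContDiffOn ℝ ∞ h I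
  f_ne_zero : ∀ x ∈ I, f x ≠ 0
  g_ne_zero : ∀ x ∈ I, g x ≠ 0
  h_ne_zero : ∀ x ∈ I, h x ≠ 0
  m_ne_zero : m ≠ 0
  f_off : ∀ x, x ∉ I → f x = 0
  g_off : ∀ x, x ∉ I → g x = 0
  h_off : ∀ x, x ∉ I → h x = 0

/-- The values `(f(x), g(x), h(x), m)` of the arbitrary elements at `x`. -/
def Coeff.val {I : Set ℝ} (θ : Coeff I) (x : ℝ) : ℝ × ℝ × ℝ × ℝ :=
  (θ.f x, θ.g x, θ.h x, θ.m)

/-- The function `u = u(t, x)` satisfies the equation with arbitrary elements `θ` at the point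
`p = (t, x)`. -/
def Coeff.SatisfiedAt {I : Set ℝ} (θ : Coeff I) (u : ℝ × ℝ → ℝ) (p : ℝ × ℝ) : Prop :=
  θ.f p.2 * deriv (fun t => u (t, p.2)) p.1 =
    deriv (fun x => θ.g x * deriv (fun y => u (p.1, y)) x) p.2
      + θ.h p.2 * Real.exp (θ.m * u p)

/-- The point of the graph of `u` over `p`. -/
def graphPt (u : ℝ × ℝ → ℝ) (p : ℝ × ℝ) : Pt := (p.1, p.2, u p)

/-- The new independent variables `(t', x')` as functions of `p = (t, x)` along the graph of `u`. -/
def newBase (Φ : Pt → Pt) (u : ℝ × ℝ → ℝ) (p : ℝ × ℝ) : ℝ × ℝ :=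
  ((Φ (graphPt u p)).1, (Φ (graphPt u p)).2.1)

/-- The new dependent variable `u'` as a function of `p = (t, x)` along the graph of `u`. -/
def newValue (Φ : Pt → Pt) (u : ℝ × ℝ → ℝ) (p : ℝ × ℝ) : ℝ := (Φ (graphPt u p)).2.2

/-- The point transformation `Φ`, defined on `B`, maps the equation with arbitrary elements `θ`,
as a submanifold of the second-order jet space, to the equation with arbitrary elements `θ'`.
A jet is represented by a smooth function `u` near a point `p`; it is a jet to which the prolongation
of `Φ` applies if `(t, x) ↦ (t', x')` is nondegenerate at `p` along the graph of `u`, and then `Φ`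
maps the graph of `u` near `p` to the graph of a smooth function `v`. The functions `u` need not be
solutions: the equation is imposed on their jets at the one point `p`. -/
def MapsEquation {I I' : Set ℝ} (B : Set Pt) (θ : Coeff I) (θ' : Coeff I') (Φ : Pt → Pt) : Prop :=
  ∀ (u v : ℝ × ℝ → ℝ) (p : ℝ × ℝ),
    graphPt u p ∈ B →
    ContDiffAt ℝ ∞ u p →
    (fderiv ℝ (newBase Φ u) p).IsInvertible →
    ContDiffAt ℝ ∞ v (newBase Φ u p) →
    (∀ᶠ q in 𝓝 p, v (newBase Φ u q) = newValue Φ u q) →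
    (θ.SatisfiedAt u p ↔ θ'.SatisfiedAt v (newBase Φ u p))

/-- A smooth one-parameter family of arbitrary elements. -/
def SmoothCurve {I : Set ℝ} (c : ℝ → Coeff I) : Prop :=
  ContDiffOn ℝ ∞ (fun p : ℝ × ℝ => (c p.1).f p.2) (Set.univ ×ˢ I) ∧
  ContDiffOn ℝ ∞ (fun p : ℝ × ℝ => (c p.1).g p.2) (Set.univ ×ˢ I) ∧
  ContDiffOn ℝ ∞ (fun p : ℝ × ℝ => (c p.1).h p.2) (Set.univ ×ˢ I) ∧
  ContDiff ℝ ∞ (fun s => (c s).m)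

/-- A nondegenerate transformation of the variables `(t, x, u) ∈ J × I × K` and of the arbitrary
elements on `I` (generalized and extended sense). The arbitrary elements are transformed by an
arbitrary, possibly nonlocal, bijection `coeff` onto the arbitrary elements on the interval `I'`.
The variables are transformed by a point transformation `point θ` which may depend on the arbitrary
elements `θ` in an arbitrary, possibly nonlocal, way. The dependence on the arbitrary elements is
smooth: smooth families go to smooth families. -/
structure Transformation (J I K I' : Set ℝ) where
  coeff : Coeff I ≃ Coeff I'
  point : Coeff I → Pt → Pt
  coeff_smooth : ∀ c : ℝ → Coeff I, SmoothCurve c → SmoothCurve (fun s => coeff (c s))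
  coeff_symm_smooth : ∀ c : ℝ → Coeff I', SmoothCurve c → SmoothCurve (fun s => coeff.symm (c s))
  point_smooth : ∀ c : ℝ → Coeff I, SmoothCurve c →
    ContDiffOn ℝ ∞ (fun q : ℝ × Pt => point (c q.1) q.2) (Set.univ ×ˢ box J I K)
  nondegenerate : ∀ θ, ∀ z ∈ box J I K, (fderiv ℝ (point θ) z).IsInvertible
  range_x : ∀ θ, (fun z => (point θ z).2.1) '' box J I K = I'

namespace Transformation

variable {J I K I' : Set ℝ}

/-- `T` is an equivalence transformation of the class (in the generalized extended sense): it maps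
the equation with any arbitrary elements `θ` to the equation with the new arbitrary elements. -/
def IsEquivalence (T : Transformation J I K I') : Prop :=
  ∀ θ, MapsEquation (box J I K) θ (T.coeff θ) (T.point θ)

/-- `T` is a point transformation of the variables `(t, x, u, f, g, h, m)` whose components for
`(t, x, u)` do not depend on the arbitrary elements. -/
def IsUsual (T : Transformation J I K I') : Prop :=
  ∃ (P : Pt → Pt) (Q : Pt → ℝ × ℝ × ℝ × ℝ → ℝ × ℝ × ℝ × ℝ),
    ContDiffOn ℝ ∞ (fun q : Pt × (ℝ × ℝ × ℝ × ℝ) => Q q.1 q.2)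
      (box J I K ×ˢ {w | w.1 ≠ 0 ∧ w.2.1 ≠ 0 ∧ w.2.2.1 ≠ 0 ∧ w.2.2.2 ≠ 0}) ∧
    ∀ θ, ∀ z ∈ box J I K,
      T.point θ z = P z ∧ (T.coeff θ).val (P z).2.1 = Q z (θ.val z.2.1)

/-- On the arbitrary elements `θ`, the transformation `T` is given by
`t' = δ₁ t + δ₂`, `x' = φ(x)`, `u' = δ₃ u + ψ(x)`, `f' = δ₀ δ₁ f / φ_x`, `g' = δ₀ φ_x g`,
`h' = (δ₀ δ₃ / φ_x) e^{-m ψ / δ₃} h`, `m' = m / δ₃`, where `ψ = δ₄ G + δ₅` and `G` is an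
antiderivative of `1 / g`. -/
def HasForm (T : Transformation J I K I') (θ : Coeff I)
    (δ₀ δ₁ δ₂ δ₃ δ₄ δ₅ : ℝ) (φ G : ℝ → ℝ) : Prop :=
  (∀ x ∈ I, HasDerivAt G (1 / θ.g x) x) ∧
  (∀ t ∈ J, ∀ x ∈ I, ∀ u ∈ K,
    T.point θ (t, x, u) = (δ₁ * t + δ₂, φ x, δ₃ * u + (δ₄ * G x + δ₅))) ∧
  (∀ x ∈ I,
    (T.coeff θ).f (φ x) = δ₀ * δ₁ / deriv φ x * θ.f x ∧
    (T.coeff θ).g (φ x) = δ₀ * deriv φ x * θ.g x ∧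
    (T.coeff θ).h (φ x) =
      δ₀ * δ₃ / deriv φ x * Real.exp (-(θ.m * (δ₄ * G x + δ₅)) / δ₃) * θ.h x) ∧
  (T.coeff θ).m = θ.m / δ₃

end Transformation

/-- `φ` is a smooth change of the variable `x` from `I` onto `I'`, with `φ_x ≠ 0`. -/
def IsChangeOfVariable (I I' : Set ℝ) (φ : ℝ → ℝ) : Prop :=
  ContDiffOn ℝ ∞ φ I ∧ (∀ x ∈ I, deriv φ x ≠ 0) ∧ φ '' I = I'

/-- The antiderivative `∫ dx / g` that vanishes at `x₀`. -/
noncomputable def Coeff.intInvG {I : Set ℝ} (θ : Coeff I) (x₀ x : ℝ) : ℝ :=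
  ∫ y in x₀..x, 1 / θ.g y

end ReactionDiffusion

open ReactionDiffusion

/-! Write the point transformation as t' = T, x' = X, u' = U and the new arbitrary elements as f',
g', h', m'. The equation fixes one combination of the 2-jet of u, and every other jet coordinate can
be varied freely. The coefficient of u_tt in the transformed equation gives D_x T = 0, hence T =
T(t) (`IsAdmissible.fderiv_time`). Moving u_t and u_xx together gives X = X(t, x) and f'(X) g X_x² =
T_t g'(X) f (`IsAdmissible.fderiv_space`). The powers of u_x give U_uu = 0 and a first-order
equation for g' (`IsAdmissible.fderiv_value`). Exponentials of u are independent of affine functions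
of u, so U = (m / m') u + U₀(t, x) (`IsAdmissible.exists_normalForm`).

It remains to exclude X_t ≠ 0, and this is impossible for each θ separately: the shift x' = x - c t
takes u_t = u_xx + e^{mu} to the equation with f' = g' = h' = e^{c x'}. But X_t ≠ 0 is exceptional.
In the coordinate y with y_x = r, r² proportional to f / g, it forces (α y + β) (log |f g|)_x / 2 =
(quadratic polynomial in y) r with α y + β not identically zero (`IsNormalForm.exists_quadratic`).
Multiplying f and g by exp(s y⁵) keeps y and r but destroys such a relation for every s ≠ 0
(`quadratic_perturbation`). So X does not depend on t for the perturbed elements, and the limit s →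
0 gives the same for θ, because T is smooth along families of arbitrary elements
(`IsEquivalence.space_eq`).

With X = φ(x) the determining equations are ordinary differential equations: T_t, g'(φ) / (φ_x g)
and g ψ_x are constants, which are δ₁, δ₀ and δ₄ (`exists_hasForm`). Conversely, for a
transformation of the stated form the new equation is δ₀ δ₃ / φ_x times the old one
(`HasForm.mapsEquation`). For the existence part the only delicate point is the smooth dependence of
∫ dx / g on the arbitrary elements.

In the usual case the point transformation is the same for all g, so ψ_x = δ₄ / g must vanish. Also
δ₀ is determined by the values (f, g, h, m) at any single point; joining values of equal signs by
exponential functions on I shows that only the signs and m matter. Closure under composition and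
inversion follows from the explicit form. -/

namespace ReactionDiffusion

/-! ### Smooth dependence of integrals and inverse maps on parameters. -/

section ParametricIntegral

variable {E : Type} [NormedAddCommGroup E] [NormedSpace ℝ E] [ProperSpace E]

/-- Differentiation under the integral sign: on a closed ball times [0, 1], which is compact, the
partial derivative is bounded, so a constant dominates it. -/
theorem hasFDerivAt_integral_unit {G : Type} [NormedAddCommGroup G] [NormedSpace ℝ G]
    {W : Set (E × ℝ)} (hW : IsOpen W) {U : Set E} (hU : IsOpen U)
    (hUW : ∀ w ∈ U, ∀ r ∈ Set.Icc (0 : ℝ) 1, (w, r) ∈ W) {F : E × ℝ → G}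
    (hF : ContDiffOn ℝ ∞ F W) {w₀ : E} (hw₀ : w₀ ∈ U) :
    HasFDerivAt (fun w => ∫ r in (0 : ℝ)..1, F (w, r))
      (∫ r in (0 : ℝ)..1, (fderiv ℝ F (w₀, r)).comp (ContinuousLinearMap.inl ℝ E ℝ)) w₀ := by
  obtain ⟨ε, hε, hball⟩ := Metric.nhds_basis_closedBall.mem_iff.1 (hU.mem_nhds hw₀)
  have huIoc : Set.uIoc (0 : ℝ) 1 ⊆ Set.Icc 0 1 := by
    rw [Set.uIoc_of_le zero_le_one]; exact Set.Ioc_subset_Icc_self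
  set F' : E → ℝ → E →L[ℝ] G :=
    fun w r => (fderiv ℝ F (w, r)).comp (ContinuousLinearMap.inl ℝ E ℝ) with hF'
  have hF'c : ContinuousOn (fun q : E × ℝ => F' q.1 q.2) W := by
    have h1 : ContinuousOn (fderiv ℝ F) W := hF.continuousOn_fderiv_of_isOpen hW (by simp)
    exact h1.clm_comp continuousOn_const
  have hslice : ∀ w ∈ U, ContinuousOn (fun r => F (w, r)) (Set.Icc 0 1) := fun w hw =>
    hF.continuousOn.comp (by fun_prop) (fun r hr => hUW w hw r hr)
  have hslice' : ContinuousOn (fun r => F' w₀ r) (Set.Icc 0 1) :=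
    hF'c.comp (f := fun r : ℝ => (w₀, r)) (by fun_prop) (fun r hr => hUW w₀ hw₀ r hr)
  obtain ⟨C, hC⟩ := ((isCompact_closedBall w₀ ε).prod (isCompact_Icc (a := (0 : ℝ)) (b := 1))
    ).exists_bound_of_continuousOn (hF'c.mono fun q hq => hUW q.1 (hball hq.1) q.2 hq.2)
  refine intervalIntegral.hasFDerivAt_integral_of_dominated_of_fderiv_le (F := fun w r => F (w, r))
    (F' := F') (bound := fun _ => C) (Metric.closedBall_mem_nhds w₀ hε) ?_ ?_ ?_ ?_ ?_ ?_
  · filter_upwards [hU.mem_nhds hw₀] with w hw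
    exact ((hslice w hw).mono huIoc).aestronglyMeasurable measurableSet_uIoc
  · refine ContinuousOn.intervalIntegrable ?_
    rw [Set.uIcc_of_le zero_le_one]; exact hslice w₀ hw₀
  · exact (hslice'.mono huIoc).aestronglyMeasurable measurableSet_uIoc
  · exact Filter.Eventually.of_forall fun r hr w hw => hC (w, r) ⟨hw, huIoc hr⟩
  · exact intervalIntegrable_const
  · refine Filter.Eventually.of_forall fun r hr w hw => ?_
    have h1 : HasFDerivAt F (fderiv ℝ F (w, r)) (w, r) :=
      ((hF.contDiffAt (hW.mem_nhds (hUW w (hball hw) r (huIoc hr)))).differentiableAt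
        (by simp)).hasFDerivAt
    exact h1.comp w (hasFDerivAt_prodMk_left w r)

/-- The derivative is again such an integral, with values in a space of linear maps; hence the
induction on `n` is over all target spaces `G` at once. -/
theorem contDiffOn_integral_unit_nat {W : Set (E × ℝ)} (hW : IsOpen W) {U : Set E} (hU : IsOpen U)
    (hUW : ∀ w ∈ U, ∀ r ∈ Set.Icc (0 : ℝ) 1, (w, r) ∈ W) (n : ℕ) :
    ∀ {G : Type} [NormedAddCommGroup G] [NormedSpace ℝ G] {F : E × ℝ → G},
      ContDiffOn ℝ ∞ F W → ContDiffOn ℝ n (fun w => ∫ r in (0 : ℝ)..1, F (w, r)) U := by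
  induction n with
  | zero =>
    intro G _ _ F hF
    exact contDiffOn_zero.2 fun w hw =>
      (hasFDerivAt_integral_unit hW hU hUW hF hw).continuousAt.continuousWithinAt
  | succ n ih =>
    intro G _ _ F hF
    have h1 : ContDiffOn ℝ ∞
        (fun q => (fderiv ℝ F q).comp (ContinuousLinearMap.inl ℝ E ℝ)) W :=
      (hF.fderiv_of_isOpen hW (by simp)).clm_comp contDiffOn_const
    push_cast
    rw [contDiffOn_succ_iff_fderiv_of_isOpen hU]
    refine ⟨fun w hw => (hasFDerivAt_integral_unit hW hU hUW hF
      hw).differentiableAt.differentiableWithinAt, by simp, ?_⟩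
    exact (ih h1).congr fun w hw => (hasFDerivAt_integral_unit hW hU hUW hF hw).fderiv

theorem contDiffOn_integral_unit {W : Set (E × ℝ)} (hW : IsOpen W) {U : Set E} (hU : IsOpen U)
    (hUW : ∀ w ∈ U, ∀ r ∈ Set.Icc (0 : ℝ) 1, (w, r) ∈ W)
    {G : Type} [NormedAddCommGroup G] [NormedSpace ℝ G] {F : E × ℝ → G}
    (hF : ContDiffOn ℝ ∞ F W) : ContDiffOn ℝ ∞ (fun w => ∫ r in (0 : ℝ)..1, F (w, r)) U :=
  contDiffOn_infty.2 fun n => contDiffOn_integral_unit_nat hW hU hUW n hF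

end ParametricIntegral

/-- The primitive of a smooth family of functions on an interval is a smooth family. -/
theorem contDiffOn_primitive {I : Set ℝ} (hI : IsOpenInterval I) {k : ℝ × ℝ → ℝ}
    (hk : ContDiffOn ℝ ∞ k (Set.univ ×ˢ I)) {x₀ : ℝ} (hx₀ : x₀ ∈ I) :
    ContDiffOn ℝ ∞ (fun p : ℝ × ℝ => ∫ y in x₀..p.2, k (p.1, y)) (Set.univ ×ˢ I) := by
  -- The substitution y = x₀ + r (x - x₀) moves the variable endpoint into the integrand. The set
  -- `W` is where the substituted point lies in `I`; it contains all r ∈ [0, 1] because `I` is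
  -- convex.
  have hmap : Continuous fun q : (ℝ × ℝ) × ℝ => (q.1.1, x₀ + q.2 * (q.1.2 - x₀)) := by fun_prop
  have hmap' : ContDiff ℝ ∞ fun q : (ℝ × ℝ) × ℝ => (q.1.1, x₀ + q.2 * (q.1.2 - x₀)) := by fun_prop
  set W : Set ((ℝ × ℝ) × ℝ) :=
    (fun q : (ℝ × ℝ) × ℝ => (q.1.1, x₀ + q.2 * (q.1.2 - x₀))) ⁻¹' (Set.univ ×ˢ I)
  have hopen : IsOpen (Set.univ ×ˢ I : Set (ℝ × ℝ)) := isOpen_univ.prod hI.1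
  have hW : IsOpen W := hopen.preimage hmap
  have hUW : ∀ w ∈ (Set.univ ×ˢ I : Set (ℝ × ℝ)), ∀ r ∈ Set.Icc (0 : ℝ) 1, (w, r) ∈ W := by
    intro w hw r hr
    refine ⟨trivial, ?_⟩
    have := hI.2.1.convex.add_smul_sub_mem hx₀ hw.2 hr
    simpa using this
  have h1 : ContDiffOn ℝ ∞ (fun q : (ℝ × ℝ) × ℝ => k (q.1.1, x₀ + q.2 * (q.1.2 - x₀))) W :=
    hk.comp hmap'.contDiffOn (fun q hq => hq)
  have h2 := contDiffOn_integral_unit hW hopen hUW h1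
  have h3 : ContDiffOn ℝ ∞ (fun p : ℝ × ℝ => p.2 - x₀) (Set.univ ×ˢ I) := by fun_prop
  refine (h3.mul h2).congr fun p hp => ?_
  have h4 := intervalIntegral.smul_integral_comp_add_mul (a := 0) (b := 1)
    (fun y => k (p.1, y)) (p.2 - x₀) x₀
  simp only [mul_zero, add_zero, mul_one, smul_eq_mul] at h4
  rw [show x₀ + (p.2 - x₀) = p.2 by ring] at h4
  rw [← h4]
  simp only [mul_comm]

/-- An injective smooth map with invertible derivatives has a smooth inverse. -/
theorem contDiffOn_invFunOn {E F : Type*} [NormedAddCommGroup E] [NormedSpace ℝ E]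
    [CompleteSpace E] [NormedAddCommGroup F] [NormedSpace ℝ F] [Nonempty E] {f : E → F} {s : Set E}
    (hs : IsOpen s) (hf : ContDiffOn ℝ ∞ f s) (hinj : Set.InjOn f s)
    (hinv : ∀ x ∈ s, (fderiv ℝ f x).IsInvertible) :
    ContDiffOn ℝ ∞ (Function.invFunOn f s) (f '' s) := by
  rintro _ ⟨x, hx, rfl⟩
  obtain ⟨e, he⟩ := hinv x hx
  have hfx : ContDiffAt ℝ ∞ f x := hf.contDiffAt (hs.mem_nhds hx)
  have hd : HasFDerivAt f (e : E →L[ℝ] F) x := by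
    rw [he]; exact (hfx.differentiableAt (by simp)).hasFDerivAt
  have hn : (∞ : WithTop ℕ∞) ≠ 0 := by simp
  refine ContDiffAt.contDiffWithinAt ((hfx.to_localInverse hd hn).congr_of_eventuallyEq ?_)
  have hst := hfx.hasStrictFDerivAt' hd hn
  -- Near f x the local inverse is a right inverse with values in `s`, so injectivity on `s`
  -- identifies it with `invFunOn`.
  have h1 : ∀ᶠ y in 𝓝 (f x), f (hfx.localInverse hd hn y) = y := hst.eventually_right_inverse
  have h2 : ∀ᶠ y in 𝓝 (f x), hfx.localInverse hd hn y ∈ s := by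
    have := (hfx.to_localInverse hd hn).continuousAt
    refine this.eventually ?_
    rw [hfx.localInverse_apply_image]
    exact hs.mem_nhds hx
  filter_upwards [h1, h2] with y hy1 hy2
  have hy : y ∈ f '' s := ⟨_, hy2, hy1⟩
  exact hinj (Function.invFunOn_mem hy) hy2 ((Function.invFunOn_eq hy).trans hy1.symm)


/-! ### Elementary linear algebra -/

theorem clm_two_apply (L : ℝ × ℝ →L[ℝ] ℝ) (w : ℝ × ℝ) :
    L w = w.1 * L (1, 0) + w.2 * L (0, 1) := by
  have : w = w.1 • ((1, 0) : ℝ × ℝ) + w.2 • ((0, 1) : ℝ × ℝ) := by ext <;> simp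
  conv_lhs => rw [this]
  rw [map_add, map_smul, map_smul, smul_eq_mul, smul_eq_mul]

theorem clm_three_apply (L : Pt →L[ℝ] ℝ) (w : Pt) :
    L w = w.1 * L (1, 0, 0) + w.2.1 * L (0, 1, 0) + w.2.2 * L (0, 0, 1) := by
  have : w = w.1 • ((1, 0, 0) : Pt) + w.2.1 • ((0, 1, 0) : Pt) + w.2.2 • ((0, 0, 1) : Pt) := by
    ext <;> simp
  conv_lhs => rw [this]
  rw [map_add, map_add, map_smul, map_smul, map_smul, smul_eq_mul, smul_eq_mul, smul_eq_mul]

theorem clm_two_cramer (L : ℝ × ℝ →L[ℝ] ℝ) {t₁ x₁ t₂ x₂ r₁ r₂ : ℝ} (h₁ : L (t₁, x₁) = r₁)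
    (h₂ : L (t₂, x₂) = r₂) (hΔ : t₁ * x₂ - t₂ * x₁ ≠ 0) :
    L (1, 0) = (r₁ * x₂ - r₂ * x₁) / (t₁ * x₂ - t₂ * x₁) ∧
      L (0, 1) = (t₁ * r₂ - t₂ * r₁) / (t₁ * x₂ - t₂ * x₁) := by
  rw [clm_two_apply] at h₁ h₂
  rw [eq_div_iff hΔ, eq_div_iff hΔ, ← h₁, ← h₂]
  constructor <;> ring

theorem isInvertible_of_injective {E : Type*} [NormedAddCommGroup E] [NormedSpace ℝ E]
    [FiniteDimensional ℝ E] {L : E →L[ℝ] E} (h : Function.Injective L) : L.IsInvertible :=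
  ⟨(LinearEquiv.ofInjectiveEndo (L : E →ₗ[ℝ] E) h).toContinuousLinearEquiv, by ext x; rfl⟩

theorem isInvertible_two {L : ℝ × ℝ →L[ℝ] ℝ × ℝ}
    (h : (L (1, 0)).1 * (L (0, 1)).2 - (L (0, 1)).1 * (L (1, 0)).2 ≠ 0) : L.IsInvertible := by
  apply isInvertible_of_injective
  rw [injective_iff_map_eq_zero]
  intro w hw
  have h1 := clm_two_apply ((ContinuousLinearMap.fst ℝ ℝ ℝ).comp L) w
  have h2 := clm_two_apply ((ContinuousLinearMap.snd ℝ ℝ ℝ).comp L) w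
  simp only [ContinuousLinearMap.comp_apply, ContinuousLinearMap.coe_fst',
    ContinuousLinearMap.coe_snd', hw, Prod.fst_zero, Prod.snd_zero] at h1 h2
  ext
  · refine mul_right_cancel₀ h ?_
    simp only [Prod.fst_zero]
    linear_combination (-(L (0, 1)).2) * h1 + (L (0, 1)).1 * h2
  · refine mul_right_cancel₀ h ?_
    simp only [Prod.snd_zero]
    linear_combination (L (1, 0)).2 * h1 - (L (1, 0)).1 * h2

/-- The Jacobian determinant of an invertible linear map of `ℝ³` does not vanish. -/
theorem det_ne_zero_of_isInvertible {L : Pt →L[ℝ] Pt} (h : L.IsInvertible) :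
    (L (1, 0, 0)).1 * ((L (0, 1, 0)).2.1 * (L (0, 0, 1)).2.2
        - (L (0, 0, 1)).2.1 * (L (0, 1, 0)).2.2)
      - (L (0, 1, 0)).1 * ((L (1, 0, 0)).2.1 * (L (0, 0, 1)).2.2
        - (L (0, 0, 1)).2.1 * (L (1, 0, 0)).2.2)
      + (L (0, 0, 1)).1 * ((L (1, 0, 0)).2.1 * (L (0, 1, 0)).2.2
        - (L (0, 1, 0)).2.1 * (L (1, 0, 0)).2.2) ≠ 0 := by
  obtain ⟨e, rfl⟩ := h
  set N : Pt →L[ℝ] Pt := (e.symm : Pt →L[ℝ] Pt)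
  set L : Pt →L[ℝ] Pt := (e : Pt →L[ℝ] Pt)
  have key : ∀ w, L (N w) = w := fun w => e.apply_symm_apply w
  have h1 : ∀ w : Pt, (L w).1
      = w.1 * (L (1, 0, 0)).1 + w.2.1 * (L (0, 1, 0)).1 + w.2.2 * (L (0, 0, 1)).1 := fun w =>
    clm_three_apply ((ContinuousLinearMap.fst ℝ ℝ (ℝ × ℝ)).comp L) w
  have h2 : ∀ w : Pt, (L w).2.1
      = w.1 * (L (1, 0, 0)).2.1 + w.2.1 * (L (0, 1, 0)).2.1 + w.2.2 * (L (0, 0, 1)).2.1 := fun w =>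
    clm_three_apply ((ContinuousLinearMap.fst ℝ ℝ ℝ).comp
      ((ContinuousLinearMap.snd ℝ ℝ (ℝ × ℝ)).comp L)) w
  have h3 : ∀ w : Pt, (L w).2.2
      = w.1 * (L (1, 0, 0)).2.2 + w.2.1 * (L (0, 1, 0)).2.2 + w.2.2 * (L (0, 0, 1)).2.2 := fun w =>
    clm_three_apply ((ContinuousLinearMap.snd ℝ ℝ ℝ).comp
      ((ContinuousLinearMap.snd ℝ ℝ (ℝ × ℝ)).comp L)) w
  set A : Matrix (Fin 3) (Fin 3) ℝ :=
    !![(L (1, 0, 0)).1, (L (0, 1, 0)).1, (L (0, 0, 1)).1;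
      (L (1, 0, 0)).2.1, (L (0, 1, 0)).2.1, (L (0, 0, 1)).2.1;
      (L (1, 0, 0)).2.2, (L (0, 1, 0)).2.2, (L (0, 0, 1)).2.2] with hA
  set B : Matrix (Fin 3) (Fin 3) ℝ :=
    !![(N (1, 0, 0)).1, (N (0, 1, 0)).1, (N (0, 0, 1)).1;
      (N (1, 0, 0)).2.1, (N (0, 1, 0)).2.1, (N (0, 0, 1)).2.1;
      (N (1, 0, 0)).2.2, (N (0, 1, 0)).2.2, (N (0, 0, 1)).2.2] with hB
  have hAB : A * B = 1 := by
    have e1 := key (1, 0, 0)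
    have e2 := key (0, 1, 0)
    have e3 := key (0, 0, 1)
    rw [Prod.ext_iff, Prod.ext_iff, h1, h2, h3] at e1 e2 e3
    obtain ⟨a1, a2, a3⟩ := e1
    obtain ⟨b1, b2, b3⟩ := e2
    obtain ⟨c1, c2, c3⟩ := e3
    ext i j
    fin_cases i <;> fin_cases j <;>
      simp [hA, hB, Matrix.mul_apply, Fin.sum_univ_three] <;> linarith
  have hdet : A.det ≠ 0 := by
    intro h0
    have := congrArg Matrix.det hAB
    rw [Matrix.det_mul, h0, zero_mul, Matrix.det_one] at this
    exact zero_ne_one this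
  intro h0
  apply hdet
  rw [Matrix.det_fin_three]
  simp only [hA, Matrix.of_apply, Matrix.cons_val', Matrix.cons_val_zero, Matrix.cons_val_one,
    Matrix.cons_val]
  linarith

/-! ### The equation in terms of Fréchet derivatives -/

theorem hasDerivAt_slice_fst {u : ℝ × ℝ → ℝ} {p : ℝ × ℝ} (hu : DifferentiableAt ℝ u p) :
    HasDerivAt (fun t => u (t, p.2)) (fderiv ℝ u p (1, 0)) p.1 := by
  have h1 : HasDerivAt (fun t : ℝ => (t, p.2)) (1, 0) p.1 :=
    (hasDerivAt_id p.1).prodMk (hasDerivAt_const _ _)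
  exact HasFDerivAt.comp_hasDerivAt p.1 (f := fun t : ℝ => (t, p.2)) hu.hasFDerivAt h1

theorem hasDerivAt_slice_snd {u : ℝ × ℝ → ℝ} {p : ℝ × ℝ} (hu : DifferentiableAt ℝ u p) :
    HasDerivAt (fun x => u (p.1, x)) (fderiv ℝ u p (0, 1)) p.2 := by
  have h1 : HasDerivAt (fun x : ℝ => (p.1, x)) (0, 1) p.2 :=
    (hasDerivAt_const _ _).prodMk (hasDerivAt_id p.2)
  exact HasFDerivAt.comp_hasDerivAt p.2 (f := fun x : ℝ => (p.1, x)) hu.hasFDerivAt h1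

/-- The product rule opens the divergence form. The inner `deriv` has to be identified with the
Fréchet derivative on a whole neighbourhood before the outer one is taken. -/
theorem Coeff.satisfiedAt_iff {I : Set ℝ} (hI : IsOpen I) (θ : Coeff I) {u : ℝ × ℝ → ℝ}
    {p : ℝ × ℝ} (hp : p.2 ∈ I) (hu : ContDiffAt ℝ ∞ u p) :
    θ.SatisfiedAt u p ↔
      θ.f p.2 * fderiv ℝ u p (1, 0) =
        θ.g p.2 * fderiv ℝ (fun q => fderiv ℝ u q (0, 1)) p (0, 1)
          + deriv θ.g p.2 * fderiv ℝ u p (0, 1) + θ.h p.2 * Real.exp (θ.m * u p) := by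
  have hev : ∀ᶠ q in 𝓝 p, DifferentiableAt ℝ u q := by
    filter_upwards [(hu.of_le (m := 1) (by norm_cast)).eventually (by simp)]
      with q hq using hq.differentiableAt (by simp)
  have hd := hev.self_of_nhds
  have hslice : ∀ᶠ x in 𝓝 p.2, deriv (fun y => u (p.1, y)) x = fderiv ℝ u (p.1, x) (0, 1) := by
    have : Filter.Tendsto (fun x : ℝ => (p.1, x)) (𝓝 p.2) (𝓝 p) :=
      Continuous.tendsto (by fun_prop) _
    filter_upwards [this.eventually hev] with x hx using (hasDerivAt_slice_snd hx).deriv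
  have hux : DifferentiableAt ℝ (fun q => fderiv ℝ u q (0, 1)) p :=
    ((hu.fderiv_right (m := ∞) (by simp)).clm_apply contDiffAt_const).differentiableAt (by simp)
  have hg : HasDerivAt θ.g (deriv θ.g p.2) p.2 :=
    ((θ.g_smooth.contDiffAt (hI.mem_nhds hp)).differentiableAt (by simp)).hasDerivAt
  have hsec := hg.mul (hasDerivAt_slice_snd hux)
  have h2 : deriv (fun x => θ.g x * deriv (fun y => u (p.1, y)) x) p.2
      = deriv θ.g p.2 * fderiv ℝ u p (0, 1)
        + θ.g p.2 * fderiv ℝ (fun q => fderiv ℝ u q (0, 1)) p (0, 1) := by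
    rw [← hsec.deriv]
    apply Filter.EventuallyEq.deriv_eq
    filter_upwards [hslice] with x hx
    rw [hx]; rfl
  rw [Coeff.SatisfiedAt, (hasDerivAt_slice_fst hd).deriv, h2]
  constructor <;> intro h <;> linarith

/-! ### Prolongation of point transformations -/

/-- The determinant `D_t T D_x X - D_x T D_t X` at a point and values `a, b` of `u_t, u_x`. -/
noncomputable def baseDet (Φ : Pt → Pt) (j : Pt × ℝ × ℝ) : ℝ :=
  (fderiv ℝ Φ j.1 (1, 0, j.2.1)).1 * (fderiv ℝ Φ j.1 (0, 1, j.2.2)).2.1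
    - (fderiv ℝ Φ j.1 (0, 1, j.2.2)).1 * (fderiv ℝ Φ j.1 (1, 0, j.2.1)).2.1

/-- The transformed first derivative in the space variable, as a function of the 1-jet. -/
noncomputable def slopeX (Φ : Pt → Pt) (j : Pt × ℝ × ℝ) : ℝ :=
  ((fderiv ℝ Φ j.1 (1, 0, j.2.1)).1 * (fderiv ℝ Φ j.1 (0, 1, j.2.2)).2.2
    - (fderiv ℝ Φ j.1 (0, 1, j.2.2)).1 * (fderiv ℝ Φ j.1 (1, 0, j.2.1)).2.2) / baseDet Φ j

/-- The transformed time derivative, as a function of the 1-jet. -/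
noncomputable def slopeT (Φ : Pt → Pt) (j : Pt × ℝ × ℝ) : ℝ :=
  ((fderiv ℝ Φ j.1 (1, 0, j.2.1)).2.2 * (fderiv ℝ Φ j.1 (0, 1, j.2.2)).2.1
    - (fderiv ℝ Φ j.1 (0, 1, j.2.2)).2.2 * (fderiv ℝ Φ j.1 (1, 0, j.2.1)).2.1) / baseDet Φ j

theorem contDiffAt_slopeX {Φ : Pt → Pt} {j : Pt × ℝ × ℝ} (hΦ : ContDiffAt ℝ ∞ Φ j.1)
    (hj : baseDet Φ j ≠ 0) : ContDiffAt ℝ ∞ (slopeX Φ) j := by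
  have h0 : ContDiffAt ℝ ∞ (fun j : Pt × ℝ × ℝ => fderiv ℝ Φ j.1) j :=
    (hΦ.fderiv_right (m := ∞) (by simp)).comp j contDiffAt_fst
  have h1 : ContDiffAt ℝ ∞ (fun j : Pt × ℝ × ℝ => fderiv ℝ Φ j.1 (1, 0, j.2.1)) j :=
    h0.clm_apply (by fun_prop)
  have h2 : ContDiffAt ℝ ∞ (fun j : Pt × ℝ × ℝ => fderiv ℝ Φ j.1 (0, 1, j.2.2)) j :=
    h0.clm_apply (by fun_prop)
  unfold slopeX baseDet
  exact ((h1.fst.mul h2.snd.snd).sub (h2.fst.mul h1.snd.snd)).div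
    ((h1.fst.mul h2.snd.fst).sub (h2.fst.mul h1.snd.fst)) hj

theorem hasFDerivAt_graphPt {u : ℝ × ℝ → ℝ} {p : ℝ × ℝ} (hu : DifferentiableAt ℝ u p) :
    HasFDerivAt (graphPt u) ((ContinuousLinearMap.fst ℝ ℝ ℝ).prod
      ((ContinuousLinearMap.snd ℝ ℝ ℝ).prod (fderiv ℝ u p))) p :=
  hasFDerivAt_fst.prodMk (hasFDerivAt_snd.prodMk hu.hasFDerivAt)

theorem fderiv_comp_graphPt {Φ : Pt → Pt} {u : ℝ × ℝ → ℝ} {p : ℝ × ℝ}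
    (hΦ : DifferentiableAt ℝ Φ (graphPt u p)) (hu : DifferentiableAt ℝ u p) (w : ℝ × ℝ) :
    fderiv ℝ (fun q => Φ (graphPt u q)) p w
      = fderiv ℝ Φ (graphPt u p) (w.1, w.2, fderiv ℝ u p w) := by
  have h : HasFDerivAt (fun q => Φ (graphPt u q)) _ p :=
    hΦ.hasFDerivAt.comp p (hasFDerivAt_graphPt hu)
  rw [h.fderiv]
  rfl

theorem hasFDerivAt_newBase {Φ : Pt → Pt} {u : ℝ × ℝ → ℝ} {p : ℝ × ℝ}
    (hd : DifferentiableAt ℝ (fun q => Φ (graphPt u q)) p) :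
    HasFDerivAt (newBase Φ u) (((ContinuousLinearMap.fst ℝ ℝ (ℝ × ℝ)).prod
      ((ContinuousLinearMap.fst ℝ ℝ ℝ).comp (ContinuousLinearMap.snd ℝ ℝ (ℝ × ℝ)))).comp
        (fderiv ℝ (fun q => Φ (graphPt u q)) p)) p :=
  (hd.hasFDerivAt.fst).prodMk (hd.hasFDerivAt.snd.fst)

theorem hasFDerivAt_newValue {Φ : Pt → Pt} {u : ℝ × ℝ → ℝ} {p : ℝ × ℝ}
    (hd : DifferentiableAt ℝ (fun q => Φ (graphPt u q)) p) :
    HasFDerivAt (newValue Φ u) (((ContinuousLinearMap.snd ℝ ℝ ℝ).comp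
      (ContinuousLinearMap.snd ℝ ℝ (ℝ × ℝ))).comp
        (fderiv ℝ (fun q => Φ (graphPt u q)) p)) p :=
  hd.hasFDerivAt.snd.snd

/-- A smooth function transforms near a point where the new independent variables are
nondegenerate. -/
theorem exists_transformed {Φ : Pt → Pt} {u : ℝ × ℝ → ℝ} {p : ℝ × ℝ}
    (hΦ : ContDiffAt ℝ ∞ Φ (graphPt u p)) (hu : ContDiffAt ℝ ∞ u p)
    (hinv : (fderiv ℝ (newBase Φ u) p).IsInvertible) :
    ∃ v : ℝ × ℝ → ℝ, ContDiffAt ℝ ∞ v (newBase Φ u p) ∧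
      ∀ᶠ q in 𝓝 p, v (newBase Φ u q) = newValue Φ u q := by
  have hg : ContDiffAt ℝ ∞ (graphPt u) p := contDiffAt_fst.prodMk (contDiffAt_snd.prodMk hu)
  have hc : ContDiffAt ℝ ∞ (fun q => Φ (graphPt u q)) p := hΦ.comp p hg
  have hb : ContDiffAt ℝ ∞ (newBase Φ u) p := hc.fst.prodMk hc.snd.fst
  have hv : ContDiffAt ℝ ∞ (newValue Φ u) p := hc.snd.snd
  obtain ⟨e, he⟩ := hinv
  have hd : HasFDerivAt (newBase Φ u) (e : ℝ × ℝ →L[ℝ] ℝ × ℝ) p := by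
    rw [he]; exact (hb.differentiableAt (by simp)).hasFDerivAt
  have hn : (∞ : WithTop ℕ∞) ≠ 0 := by simp
  refine ⟨fun y => newValue Φ u (hb.localInverse hd hn y), ?_, ?_⟩
  · refine ContDiffAt.comp (g := newValue Φ u) (newBase Φ u p) ?_ (hb.to_localInverse hd hn)
    rwa [hb.localInverse_apply_image]
  · have := (hb.hasStrictFDerivAt' hd hn).eventually_left_inverse
    filter_upwards [this] with q hq
    exact congrArg (newValue Φ u) hq

/-- The equation for 2-jets and the transformed equation for 2-jets are equivalent. -/
theorem MapsEquation.jet_iff {I I' : Set ℝ} (hI : IsOpen I) (hI' : IsOpen I') {B : Set Pt}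
    (hB : IsOpen B) {θ : Coeff I} {θ' : Coeff I'} {Φ : Pt → Pt} (hM : MapsEquation B θ θ' Φ)
    (hΦ : ContDiffOn ℝ ∞ Φ B) {t x y : ℝ} (hz : (t, x, y) ∈ B) (hx : x ∈ I)
    (hX : (Φ (t, x, y)).2.1 ∈ I') {a b : ℝ} (c d e : ℝ) (hΔ : baseDet Φ ((t, x, y), a, b) ≠ 0) :
    (θ.f x * a = θ.g x * e + deriv θ.g x * b + θ.h x * Real.exp (θ.m * y)) ↔
    (θ'.f (Φ (t, x, y)).2.1 * slopeT Φ ((t, x, y), a, b) =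
      θ'.g (Φ (t, x, y)).2.1 *
        (((fderiv ℝ Φ (t, x, y) (1, 0, a)).1 *
            fderiv ℝ (slopeX Φ) ((t, x, y), a, b) ((0, 1, b), d, e)
          - (fderiv ℝ Φ (t, x, y) (0, 1, b)).1 *
            fderiv ℝ (slopeX Φ) ((t, x, y), a, b) ((1, 0, a), c, d)) /
          baseDet Φ ((t, x, y), a, b))
        + deriv θ'.g (Φ (t, x, y)).2.1 * slopeX Φ ((t, x, y), a, b)
        + θ'.h (Φ (t, x, y)).2.1 * Real.exp (θ'.m * (Φ (t, x, y)).2.2)) := by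
  -- The quadratic Taylor polynomial realises an arbitrary 2-jet: value y, first derivatives a, b
  -- and second derivatives c = u_tt, d = u_tx, e = u_xx at (t, x).
  set u : ℝ × ℝ → ℝ := fun q => y + a * (q.1 - t) + b * (q.2 - x) + c / 2 * (q.1 - t) ^ 2
    + d * ((q.1 - t) * (q.2 - x)) + e / 2 * (q.2 - x) ^ 2 with hu_def
  have hu : ContDiff ℝ ∞ u := by fun_prop
  have hud : Differentiable ℝ u := hu.differentiable (by simp)
  have hut : ∀ q, fderiv ℝ u q (1, 0) = a + c * (q.1 - t) + d * (q.2 - x) := by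
    intro q
    have h1 : HasDerivAt (fun s => u (s, q.2)) (a + c * (q.1 - t) + d * (q.2 - x)) q.1 := by
      have h2 : HasDerivAt (fun s : ℝ => s - t) 1 q.1 := (hasDerivAt_id _).sub_const t
      convert! ((((h2.const_mul a).const_add y).add_const (b * (q.2 - x))).add
        ((h2.pow 2).const_mul (c / 2))).add ((h2.mul_const (q.2 - x)).const_mul d) |>.add_const
          (e / 2 * (q.2 - x) ^ 2) using 1
      simp; ring
    exact (hasDerivAt_slice_fst (hud q)).unique h1
  have hux : ∀ q, fderiv ℝ u q (0, 1) = b + d * (q.1 - t) + e * (q.2 - x) := by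
    intro q
    have h1 : HasDerivAt (fun s => u (q.1, s)) (b + d * (q.1 - t) + e * (q.2 - x)) q.2 := by
      have h2 : HasDerivAt (fun s : ℝ => s - x) 1 q.2 := (hasDerivAt_id _).sub_const x
      convert! ((((h2.const_mul b).const_add (y + a * (q.1 - t))).add_const
        (c / 2 * (q.1 - t) ^ 2)).add ((h2.const_mul (q.1 - t)).const_mul d)).add
          ((h2.pow 2).const_mul (e / 2)) using 1
      simp; ring
    exact (hasDerivAt_slice_snd (hud q)).unique h1
  have hu0 : u (t, x) = y := by simp [hu_def]
  have hgr : graphPt u (t, x) = (t, x, y) := by simp [graphPt, hu0]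
  have huxx : fderiv ℝ (fun q => fderiv ℝ u q (0, 1)) (t, x) (0, 1) = e := by
    simp_rw [hux]
    have h1 : HasDerivAt (fun s => b + d * ((t, x) : ℝ × ℝ).1 - d * t + e * (s - x)) e x := by
      simpa using (((hasDerivAt_id x).sub_const x).const_mul e).const_add
        (b + d * ((t, x) : ℝ × ℝ).1 - d * t)
    refine (hasDerivAt_slice_snd (p := (t, x)) (u := fun q : ℝ × ℝ => b + d * (q.1 - t)
      + e * (q.2 - x)) (by fun_prop)).unique ?_
    convert! h1 using 2
    simp
  have hΦz : ContDiffAt ℝ ∞ Φ (graphPt u (t, x)) := by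
    rw [hgr]; exact hΦ.contDiffAt (hB.mem_nhds hz)
  have hgc : Continuous (graphPt u) := by
    unfold graphPt; exact continuous_fst.prodMk (continuous_snd.prodMk hu.continuous)
  have hBev : ∀ᶠ q in 𝓝 (t, x), graphPt u q ∈ B := by
    refine hgc.continuousAt.eventually (hB.mem_nhds ?_)
    rwa [hgr]
  have hΦd : ∀ᶠ q in 𝓝 (t, x), DifferentiableAt ℝ Φ (graphPt u q) := by
    filter_upwards [hBev] with q hq
      using (hΦ.contDiffAt (hB.mem_nhds hq)).differentiableAt (by simp)
  have hbase : ∀ᶠ q in 𝓝 (t, x), HasFDerivAt (newBase Φ u) (fderiv ℝ (newBase Φ u) q) q ∧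
      HasFDerivAt (newValue Φ u) (fderiv ℝ (newValue Φ u) q) q ∧
      (∀ w, fderiv ℝ (newBase Φ u) q w =
        ((fderiv ℝ Φ (graphPt u q) (w.1, w.2, fderiv ℝ u q w)).1,
          (fderiv ℝ Φ (graphPt u q) (w.1, w.2, fderiv ℝ u q w)).2.1)) ∧
      ∀ w, fderiv ℝ (newValue Φ u) q w =
        (fderiv ℝ Φ (graphPt u q) (w.1, w.2, fderiv ℝ u q w)).2.2 := by
    filter_upwards [hΦd] with q hq
    have hd : DifferentiableAt ℝ (fun q => Φ (graphPt u q)) q :=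
      DifferentiableAt.comp q hq (hasFDerivAt_graphPt (hud q)).differentiableAt
    refine ⟨(hasFDerivAt_newBase hd).differentiableAt.hasFDerivAt,
      (hasFDerivAt_newValue hd).differentiableAt.hasFDerivAt, fun w => ?_, fun w => ?_⟩
    · rw [(hasFDerivAt_newBase hd).fderiv, ← fderiv_comp_graphPt hq (hud q)]; rfl
    · rw [(hasFDerivAt_newValue hd).fderiv, ← fderiv_comp_graphPt hq (hud q)]; rfl
  set jet : ℝ × ℝ → Pt × ℝ × ℝ :=
    fun q => (graphPt u q, fderiv ℝ u q (1, 0), fderiv ℝ u q (0, 1)) with hjet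
  have hjet0 : jet (t, x) = ((t, x, y), a, b) := by
    simp only [hjet, hgr, hut, hux]; simp
  have hjetd : ∃ J : ℝ × ℝ →L[ℝ] Pt × ℝ × ℝ, HasFDerivAt jet J (t, x) ∧
      J (1, 0) = ((1, 0, a), c, d) ∧ J (0, 1) = ((0, 1, b), d, e) := by
    refine ⟨_, (hasFDerivAt_graphPt (hud (t, x))).prodMk (HasFDerivAt.prodMk
      (f₁ := fun q => fderiv ℝ u q (1, 0)) (f₂ := fun q => fderiv ℝ u q (0, 1))
      (f₁' := c • ContinuousLinearMap.fst ℝ ℝ ℝ + d • ContinuousLinearMap.snd ℝ ℝ ℝ)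
      (f₂' := d • ContinuousLinearMap.fst ℝ ℝ ℝ + e • ContinuousLinearMap.snd ℝ ℝ ℝ)
      ?_ ?_), ?_, ?_⟩
    · simp_rw [hut]
      exact (((hasFDerivAt_fst.sub_const t).const_mul c).const_add a).add
        ((hasFDerivAt_snd.sub_const x).const_mul d)
    · simp_rw [hux]
      exact (((hasFDerivAt_fst.sub_const t).const_mul d).const_add b).add
        ((hasFDerivAt_snd.sub_const x).const_mul e)
    · simp [hut]
    · simp [hux]
  obtain ⟨J, hJ, hJ1, hJ2⟩ := hjetd
  have hinv : (fderiv ℝ (newBase Φ u) (t, x)).IsInvertible := by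
    apply isInvertible_two
    rw [hbase.self_of_nhds.2.2.1, hbase.self_of_nhds.2.2.1, hgr, hut, hux]
    simpa [baseDet] using hΔ
  obtain ⟨v, hv, hve⟩ := exists_transformed hΦz hu.contDiffAt hinv
  have hiff := hM u v (t, x) (by rwa [hgr]) hu.contDiffAt hinv hv hve
  have hval : newValue Φ u (t, x) = (Φ (t, x, y)).2.2 := by rw [newValue, hgr]
  have hbx : (newBase Φ u (t, x)).2 = (Φ (t, x, y)).2.1 := by rw [newBase, hgr]
  have hvd : ∀ᶠ p in 𝓝 (newBase Φ u (t, x)), DifferentiableAt ℝ v p := by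
    filter_upwards [(hv.of_le (m := 1) (by norm_cast)).eventually (by simp)]
      with q hq using hq.differentiableAt (by simp)
  have hbc : ContinuousAt (newBase Φ u) (t, x) := hbase.self_of_nhds.1.continuousAt
  -- The chain rule is kept on a neighbourhood, since the formula for v_{x'} derived from it is
  -- differentiated once more.
  have hchain : ∀ᶠ q in 𝓝 (t, x), ∀ w, fderiv ℝ v (newBase Φ u q) (fderiv ℝ (newBase Φ u) q w)
      = fderiv ℝ (newValue Φ u) q w := by
    filter_upwards [hve.eventually_nhds, hbase, hbc.eventually hvd] with q hq hbq hvq w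
    have h1 := hvq.hasFDerivAt.comp q hbq.1
    have h2 := hbq.2.1.congr_of_eventuallyEq hq
    rw [← h1.unique h2]; rfl
  have hΔev : ∀ᶠ q in 𝓝 (t, x), baseDet Φ (jet q) ≠ 0 := by
    have hjc : ContinuousAt jet (t, x) := hJ.continuousAt
    have h0 : ContinuousAt (fun q => fderiv ℝ Φ (graphPt u q)) (t, x) :=
      ContinuousAt.comp (f := graphPt u) (g := fderiv ℝ Φ)
        (hΦz.fderiv_right (m := ∞) (by simp)).continuousAt hgc.continuousAt
    have h1 : ContinuousAt (fun q => fderiv ℝ Φ (graphPt u q) (1, 0, fderiv ℝ u q (1, 0)))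
        (t, x) := h0.clm_apply (by simp_rw [hut]; fun_prop)
    have h2 : ContinuousAt (fun q => fderiv ℝ Φ (graphPt u q) (0, 1, fderiv ℝ u q (0, 1)))
        (t, x) := h0.clm_apply (by simp_rw [hux]; fun_prop)
    have h3 : ContinuousAt (fun q => baseDet Φ (jet q)) (t, x) :=
      (h1.fst.mul h2.snd.fst).sub (h2.fst.mul h1.snd.fst)
    exact h3.eventually_ne (by rw [hjet0]; exact hΔ)
  have hslopes : ∀ᶠ q in 𝓝 (t, x), fderiv ℝ v (newBase Φ u q) (1, 0) = slopeT Φ (jet q) ∧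
      fderiv ℝ v (newBase Φ u q) (0, 1) = slopeX Φ (jet q) := by
    filter_upwards [hchain, hbase, hΔev] with q hq hbq hΔq
    have h1 := hq (1, 0)
    have h2 := hq (0, 1)
    rw [hbq.2.2.1, hbq.2.2.2] at h1 h2
    have h3 := clm_two_cramer _ h1 h2 hΔq
    exact h3
  have hvx : DifferentiableAt ℝ (fun p => fderiv ℝ v p (0, 1)) (newBase Φ u (t, x)) :=
    ((hv.fderiv_right (m := ∞) (by simp)).clm_apply contDiffAt_const).differentiableAt (by simp)
  have hsx : DifferentiableAt ℝ (slopeX Φ) (jet (t, x)) := by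
    rw [hjet0]
    exact (contDiffAt_slopeX (hΦ.contDiffAt (hB.mem_nhds hz)) hΔ).differentiableAt (by simp)
  -- The same chain rule for v_{x'}, whose pullback along the graph is `slopeX` evaluated on the
  -- 1-jet of u.
  have hchain2 : ∀ w, fderiv ℝ (fun p => fderiv ℝ v p (0, 1)) (newBase Φ u (t, x))
      (fderiv ℝ (newBase Φ u) (t, x) w) = fderiv ℝ (slopeX Φ) ((t, x, y), a, b) (J w) := by
    intro w
    have h1 := hvx.hasFDerivAt.comp (t, x) hbase.self_of_nhds.1
    have h2 := (hsx.hasFDerivAt.comp (t, x) hJ).congr_of_eventuallyEq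
      (f₁ := (fun p => fderiv ℝ v p (0, 1)) ∘ newBase Φ u) (hslopes.mono fun q hq => hq.2)
    have h3 := congrArg (fun L => L w) (h1.unique h2)
    rw [hjet0] at h3
    exact h3
  have hvxx : fderiv ℝ (fun p => fderiv ℝ v p (0, 1)) (newBase Φ u (t, x)) (0, 1) =
      ((fderiv ℝ Φ (t, x, y) (1, 0, a)).1 *
            fderiv ℝ (slopeX Φ) ((t, x, y), a, b) ((0, 1, b), d, e)
          - (fderiv ℝ Φ (t, x, y) (0, 1, b)).1 *
            fderiv ℝ (slopeX Φ) ((t, x, y), a, b) ((1, 0, a), c, d)) /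
          baseDet Φ ((t, x, y), a, b) := by
    have h1 := hchain2 (1, 0)
    have h2 := hchain2 (0, 1)
    rw [hbase.self_of_nhds.2.2.1, hgr, hut, hJ1] at h1
    rw [hbase.self_of_nhds.2.2.1, hgr, hux, hJ2] at h2
    simp only [sub_self, mul_zero, add_zero] at h1 h2
    exact (clm_two_cramer _ h1 h2 hΔ).2
  rw [θ.satisfiedAt_iff hI hx hu.contDiffAt, θ'.satisfiedAt_iff hI' (by rwa [hbx]) hv, hbx, hvxx,
    hve.self_of_nhds, hval, hslopes.self_of_nhds.1, hslopes.self_of_nhds.2, hjet0, huxx, hu0, hut,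
    hux] at hiff
  simpa using hiff


/-! ### Determining equations: splitting with respect to the jet variables. -/

theorem isOpen_box {J I K : Set ℝ} (hJ : IsOpen J) (hI : IsOpen I) (hK : IsOpen K) :
    IsOpen (box J I K) := hJ.prod (hI.prod hK)

theorem clm_apply_fst (L : Pt →L[ℝ] Pt) (p q r : ℝ) : (L (p, q, r)).1
    = p * (L (1, 0, 0)).1 + q * (L (0, 1, 0)).1 + r * (L (0, 0, 1)).1 :=
  clm_three_apply ((ContinuousLinearMap.fst ℝ ℝ (ℝ × ℝ)).comp L) (p, q, r)

theorem clm_apply_snd_fst (L : Pt →L[ℝ] Pt) (p q r : ℝ) : (L (p, q, r)).2.1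
    = p * (L (1, 0, 0)).2.1 + q * (L (0, 1, 0)).2.1 + r * (L (0, 0, 1)).2.1 :=
  clm_three_apply ((ContinuousLinearMap.fst ℝ ℝ ℝ).comp
    ((ContinuousLinearMap.snd ℝ ℝ (ℝ × ℝ)).comp L)) (p, q, r)

theorem clm_apply_snd_snd (L : Pt →L[ℝ] Pt) (p q r : ℝ) : (L (p, q, r)).2.2
    = p * (L (1, 0, 0)).2.2 + q * (L (0, 1, 0)).2.2 + r * (L (0, 0, 1)).2.2 :=
  clm_three_apply ((ContinuousLinearMap.snd ℝ ℝ ℝ).comp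
    ((ContinuousLinearMap.snd ℝ ℝ (ℝ × ℝ)).comp L)) (p, q, r)

theorem fderiv_fderiv_comm {E F : Type*} [NormedAddCommGroup E] [NormedSpace ℝ E]
    [NormedAddCommGroup F] [NormedSpace ℝ F] {f : E → F} {x : E} (hf : ContDiffAt ℝ ∞ f x)
    (v w : E) :
    fderiv ℝ (fun y => fderiv ℝ f y v) x w = fderiv ℝ (fun y => fderiv ℝ f y w) x v := by
  have h1 : IsSymmSndFDerivAt ℝ f x := hf.isSymmSndFDerivAt (by
    rw [minSmoothness_of_isRCLikeNormedField]; exact WithTop.coe_le_coe.2 (le_top : (2 : ℕ∞) ≤ ⊤))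
  have hd : DifferentiableAt ℝ (fderiv ℝ f) x :=
    (hf.fderiv_right (m := ∞) (by simp)).differentiableAt (by simp)
  have h2 : ∀ v w, fderiv ℝ (fun y => fderiv ℝ f y v) x w = fderiv ℝ (fderiv ℝ f) x w v := by
    intro v w
    have := (hd.hasFDerivAt.clm_apply (hasFDerivAt_const v x)).fderiv
    rw [this]; simp
  rw [h2, h2, h1]

/-- A nondegenerate point transformation on a box that maps one equation of the class to
another one. -/
structure IsAdmissible (J I K I' : Set ℝ) (θ : Coeff I) (θ' : Coeff I') (Φ : Pt → Pt) : Prop where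
  time : IsOpenInterval J
  space : IsOpenInterval I
  value : IsOpenInterval K
  space' : IsOpenInterval I'
  smooth : ContDiffOn ℝ ∞ Φ (box J I K)
  nondegenerate : ∀ z ∈ box J I K, (fderiv ℝ Φ z).IsInvertible
  mapsTo : ∀ z ∈ box J I K, (Φ z).2.1 ∈ I'
  mapsEquation : MapsEquation (box J I K) θ θ' Φ

/-- The transformed space derivative, when `t'` depends on `t` only, as a function of the point and
the value of `u_x`. -/
noncomputable def slope (Φ : Pt → Pt) (k : Pt × ℝ) : ℝ :=
  (fderiv ℝ Φ k.1 (0, 1, k.2)).2.2 / (fderiv ℝ Φ k.1 (0, 1, k.2)).2.1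

namespace IsAdmissible

variable {J I K I' : Set ℝ} {θ : Coeff I} {θ' : Coeff I'} {Φ : Pt → Pt}

theorem isOpen_box (h : IsAdmissible J I K I' θ θ' Φ) : IsOpen (box J I K) :=
  ReactionDiffusion.isOpen_box h.time.1 h.space.1 h.value.1

theorem contDiffAt (h : IsAdmissible J I K I' θ θ' Φ) {z : Pt} (hz : z ∈ box J I K) :
    ContDiffAt ℝ ∞ Φ z := h.smooth.contDiffAt (h.isOpen_box.mem_nhds hz)

theorem contDiffAt_fderiv (h : IsAdmissible J I K I' θ θ' Φ) {z : Pt} (hz : z ∈ box J I K)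
    (w : Pt) : ContDiffAt ℝ ∞ (fun z => fderiv ℝ Φ z w) z :=
  ((h.contDiffAt hz).fderiv_right (m := ∞) (by simp)).clm_apply contDiffAt_const

/-- The source equation does not contain u_tt, whereas in the target its coefficient is, up to
nonzero factors, D_x T · ∂`slopeX`/∂u_t. By the quotient rule this partial derivative is -D_x T
times the Jacobian determinant over Δ², with Δ = `baseDet`. Hence (D_x T)² = 0 where Δ ≠ 0, and the
factor Δ makes the identity valid for all a, b. -/
theorem fderiv_time_mul (h : IsAdmissible J I K I' θ θ' Φ) {z : Pt} (hz : z ∈ box J I K)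
    (a b : ℝ) : baseDet Φ (z, a, b) * (fderiv ℝ Φ z (0, 1, b)).1 = 0 := by
  by_cases hΔ : baseDet Φ (z, a, b) = 0
  · rw [hΔ, zero_mul]
  refine mul_eq_zero_of_right _ ?_
  obtain ⟨t, x, y⟩ := z
  have hx : x ∈ I := hz.2.1
  have hX := h.mapsTo _ hz
  have hg := θ.g_ne_zero x hx
  have hg' := θ'.g_ne_zero _ hX
  -- Since g ≠ 0, the source equation is solved for u_xx; a, b, c and d stay free.
  set e := (θ.f x * a - deriv θ.g x * b - θ.h x * Real.exp (θ.m * y)) / θ.g x with he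
  have hsrc : θ.f x * a = θ.g x * e + deriv θ.g x * b + θ.h x * Real.exp (θ.m * y) := by
    rw [he]; field_simp; ring
  have hjet := fun c => (h.mapsEquation.jet_iff h.space.1 h.space'.1 h.isOpen_box h.smooth hz hx hX
    c 0 e hΔ).1 hsrc
  have h0 := hjet 0
  have h1 := hjet 1
  set D := fderiv ℝ (slopeX Φ) ((t, x, y), a, b)
  have hlin : D ((1, 0, a), 1, 0) = D ((1, 0, a), 0, 0) + D (0, 1, 0) := by
    rw [← map_add]; simp
  rw [hlin] at h1
  set L := fderiv ℝ Φ (t, x, y) with hL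
  have hprod : (L (0, 1, b)).1 * D (0, 1, 0) = 0 := by
    have h2 : θ'.g (Φ (t, x, y)).2.1 * ((L (0, 1, b)).1 * D (0, 1, 0)
        / baseDet Φ ((t, x, y), a, b)) = 0 := by
      linear_combination h1 - h0
    simpa [hg', hΔ] using h2
  have hD : D (0, 1, 0) * baseDet Φ ((t, x, y), a, b) ^ 2 =
      (L (0, 1, b)).1 * -((L (1, 0, 0)).1 * ((L (0, 1, 0)).2.1 * (L (0, 0, 1)).2.2
        - (L (0, 0, 1)).2.1 * (L (0, 1, 0)).2.2)
      - (L (0, 1, 0)).1 * ((L (1, 0, 0)).2.1 * (L (0, 0, 1)).2.2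
        - (L (0, 0, 1)).2.1 * (L (1, 0, 0)).2.2)
      + (L (0, 0, 1)).1 * ((L (1, 0, 0)).2.1 * (L (0, 1, 0)).2.2
        - (L (0, 1, 0)).2.1 * (L (1, 0, 0)).2.2)) := by
    have hs : DifferentiableAt ℝ (slopeX Φ) ((t, x, y), a, b) :=
      (contDiffAt_slopeX (h.contDiffAt hz) hΔ).differentiableAt (by simp)
    have hline : HasDerivAt (fun r : ℝ => slopeX Φ (((t, x, y), a, b) + r • (0, 1, 0)))
      (D (0, 1, 0)) 0 := hs.hasFDerivAt.hasLineDerivAt (0, 1, 0)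
    have hform : ∀ r : ℝ, slopeX Φ (((t, x, y), a, b) + r • (0, 1, 0)) =
        (((L (1, 0, a)).1 + r * (L (0, 0, 1)).1) * (L (0, 1, b)).2.2
          - (L (0, 1, b)).1 * ((L (1, 0, a)).2.2 + r * (L (0, 0, 1)).2.2)) /
        (((L (1, 0, a)).1 + r * (L (0, 0, 1)).1) * (L (0, 1, b)).2.1
          - (L (0, 1, b)).1 * ((L (1, 0, a)).2.1 + r * (L (0, 0, 1)).2.1)) := by
      intro r
      have hpt : (((t, x, y), a, b) : Pt × ℝ × ℝ) + r • (0, 1, 0) = ((t, x, y), a + r, b) := by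
        simp
      have hadd : L (1, 0, a + r) = L (1, 0, a) + r • L (0, 0, 1) := by
        rw [← map_smul, ← map_add]; simp
      rw [hpt]
      simp only [slopeX, baseDet, ← hL, hadd, Prod.fst_add, Prod.snd_add, Prod.smul_fst,
        Prod.smul_snd, smul_eq_mul]
    simp_rw [hform] at hline
    have hid := hasDerivAt_id (0 : ℝ)
    have hnum := (((hid.mul_const (L (0, 0, 1)).1).const_add (L (1, 0, a)).1).mul_const
      (L (0, 1, b)).2.2).sub (((hid.mul_const (L (0, 0, 1)).2.2).const_add
        (L (1, 0, a)).2.2).const_mul (L (0, 1, b)).1)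
    have hden := (((hid.mul_const (L (0, 0, 1)).1).const_add (L (1, 0, a)).1).mul_const
      (L (0, 1, b)).2.1).sub (((hid.mul_const (L (0, 0, 1)).2.1).const_add
        (L (1, 0, a)).2.1).const_mul (L (0, 1, b)).1)
    have hΔ' := hΔ
    simp only [baseDet, ← hL] at hΔ'
    have hq := hnum.div hden (by simpa using hΔ')
    rw [hline.unique hq]
    simp only [baseDet, ← hL, Pi.sub_apply, id, zero_mul, add_zero, one_mul]
    rw [div_mul_cancel₀ _ (pow_ne_zero 2 hΔ')]
    simp only [clm_apply_fst L 1 0 a, clm_apply_fst L 0 1 b, clm_apply_snd_fst L 1 0 a,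
      clm_apply_snd_fst L 0 1 b, clm_apply_snd_snd L 1 0 a, clm_apply_snd_snd L 0 1 b]
    ring
  have hdet := det_ne_zero_of_isInvertible (h.nondegenerate _ hz)
  rw [← hL] at hdet
  have hsq : (L (0, 1, b)).1 * (L (0, 1, b)).1 = 0 := by
    refine mul_right_cancel₀ (neg_ne_zero.2 hdet) ?_
    rw [mul_assoc, ← hD]
    linear_combination baseDet Φ ((t, x, y), a, b) ^ 2 * hprod
  exact mul_self_eq_zero.1 hsq

/-- The new time variable depends on `t` only. -/
theorem fderiv_time (h : IsAdmissible J I K I' θ θ' Φ) {z : Pt} (hz : z ∈ box J I K) :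
    (fderiv ℝ Φ z (0, 1, 0)).1 = 0 ∧ (fderiv ℝ Φ z (0, 0, 1)).1 = 0 := by
  have hdet := det_ne_zero_of_isInvertible (h.nondegenerate _ hz)
  have key := h.fderiv_time_mul hz
  set L := fderiv ℝ Φ z with hL
  replace key : ∀ a b, (((L (1, 0, 0)).1 + a * (L (0, 0, 1)).1)
        * ((L (0, 1, 0)).2.1 + b * (L (0, 0, 1)).2.1)
      - ((L (0, 1, 0)).1 + b * (L (0, 0, 1)).1)
        * ((L (1, 0, 0)).2.1 + a * (L (0, 0, 1)).2.1))
      * ((L (0, 1, 0)).1 + b * (L (0, 0, 1)).1) = 0 := by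
    intro a b
    have hk := key a b
    simp only [baseDet] at hk
    rw [← hL, clm_apply_fst L 1 0 a, clm_apply_fst L 0 1 b, clm_apply_snd_fst L 1 0 a,
      clm_apply_snd_fst L 0 1 b] at hk
    linear_combination hk
  -- The identity is polynomial in a and b; these five points isolate the coefficients needed.
  have k00 := key 0 0
  have k10 := key 1 0
  have k01 := key 0 1
  have k0m := key 0 (-1)
  have k11 := key 1 1
  generalize (L (1, 0, 0)).1 = T₁ at *
  generalize (L (0, 1, 0)).1 = T₂ at *
  generalize (L (0, 0, 1)).1 = T₃ at *
  generalize (L (1, 0, 0)).2.1 = X₁ at *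
  generalize (L (0, 1, 0)).2.1 = X₂ at *
  generalize (L (0, 0, 1)).2.1 = X₃ at *
  generalize (L (1, 0, 0)).2.2 = U₁ at *
  generalize (L (0, 1, 0)).2.2 = U₂ at *
  generalize (L (0, 0, 1)).2.2 = U₃ at *
  have e1 : (T₁ * X₂ - T₂ * X₁) * T₂ = 0 := by linear_combination k00
  have e2 : (T₃ * X₂ - T₂ * X₃) * T₂ = 0 := by linear_combination k10 - k00
  have e3 : (T₁ * X₃ - T₃ * X₁) * T₃ = 0 := by linear_combination (k01 + k0m) / 2 - k00
  have e4 : (T₁ * X₂ - T₂ * X₁) * T₃ + (T₁ * X₃ - T₃ * X₁) * T₂ = 0 := by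
    linear_combination (k01 - k0m) / 2
  have e5 : (T₃ * X₂ - T₂ * X₃) * T₃ = 0 := by linear_combination k11 - k10 - k01 + k00
  -- If T_x and T_u are not both zero, the identities force all 2 × 2 minors of the gradients of T
  -- and X to vanish, and with them the Jacobian determinant.
  by_contra hne
  apply hdet
  have d1 : T₃ * X₂ - T₂ * X₃ = 0 := by
    by_contra h1
    exact hne ⟨by simpa [h1] using e2, by simpa [h1] using e5⟩
  have d2 : T₁ * X₃ - T₃ * X₁ = 0 := by
    by_contra h1
    have h3 : T₃ = 0 := by simpa [h1] using e3
    have h2 : (T₁ * X₃ - T₃ * X₁) * T₂ = 0 := by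
      linear_combination e4 - (T₁ * X₂ - T₂ * X₁) * h3
    exact hne ⟨(mul_eq_zero.1 h2).resolve_left h1, h3⟩
  have d3 : T₁ * X₂ - T₂ * X₁ = 0 := by
    by_contra h1
    refine hne ⟨by simpa [h1] using e1, ?_⟩
    rw [d2] at e4
    simpa [h1] using e4
  linear_combination (-U₁) * d1 - U₂ * d2 + U₃ * d3

/-- With T_x = T_u = 0 the new space derivative is D_x U / D_x X. It does not involve u_t, so u_tt
and u_tx drop out of the transformed equation. -/
theorem jet_iff_slope (h : IsAdmissible J I K I' θ θ' Φ) {t x y : ℝ} (hz : (t, x, y) ∈ box J I K)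
    {b : ℝ} (hD : (fderiv ℝ Φ (t, x, y) (0, 1, b)).2.1 ≠ 0) (a e : ℝ) :
    ((θ.f x * a = θ.g x * e + deriv θ.g x * b + θ.h x * Real.exp (θ.m * y)) ↔
    (θ'.f (Φ (t, x, y)).2.1 * (((fderiv ℝ Φ (t, x, y) (1, 0, a)).2.2
        - slope Φ ((t, x, y), b) * (fderiv ℝ Φ (t, x, y) (1, 0, a)).2.1)
          / (fderiv ℝ Φ (t, x, y) (1, 0, 0)).1) =
      θ'.g (Φ (t, x, y)).2.1 *
        (fderiv ℝ (slope Φ) ((t, x, y), b) ((0, 1, b), e)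
          / (fderiv ℝ Φ (t, x, y) (0, 1, b)).2.1)
        + deriv θ'.g (Φ (t, x, y)).2.1 * slope Φ ((t, x, y), b)
        + θ'.h (Φ (t, x, y)).2.1 * Real.exp (θ'.m * (Φ (t, x, y)).2.2))) ∧
    DifferentiableAt ℝ (slope Φ) ((t, x, y), b) ∧ (fderiv ℝ Φ (t, x, y) (1, 0, 0)).1 ≠ 0 := by
  have hdet := det_ne_zero_of_isInvertible (h.nondegenerate _ hz)
  have hTz := h.fderiv_time hz
  have hT : (fderiv ℝ Φ (t, x, y) (1, 0, 0)).1 ≠ 0 := by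
    intro h0
    apply hdet
    rw [h0, hTz.1, hTz.2]; ring
  have hdet' : ∀ z ∈ box J I K, ∀ a b, baseDet Φ (z, a, b)
      = (fderiv ℝ Φ z (1, 0, 0)).1 * (fderiv ℝ Φ z (0, 1, b)).2.1 := by
    intro z hz a b
    have hTz := h.fderiv_time hz
    simp only [baseDet]
    rw [clm_apply_fst _ 1 0 a, clm_apply_fst _ 0 1 b, hTz.1, hTz.2]
    ring
  have hs' : ∀ z ∈ box J I K, (fderiv ℝ Φ z (1, 0, 0)).1 ≠ 0 → ∀ a b,
      slopeX Φ (z, a, b) = slope Φ (z, b) := by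
    intro z hz hne a b
    have hTz := h.fderiv_time hz
    rw [slopeX, hdet' z hz]
    simp only [slope]
    rw [clm_apply_fst _ 1 0 a, clm_apply_fst _ 0 1 b, hTz.1, hTz.2]
    simp only [mul_zero, add_zero, zero_mul, sub_zero, one_mul]
    rw [mul_div_mul_left _ _ hne]
  have hΔ : baseDet Φ ((t, x, y), a, b) ≠ 0 := by
    rw [hdet' _ hz]; exact mul_ne_zero hT hD
  -- The two expressions agree on a neighbourhood, so their derivatives agree as well.
  have hev : slopeX Φ =ᶠ[𝓝 ((t, x, y), a, b)] fun j => slope Φ (j.1, j.2.2) := by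
    have h1 : ∀ᶠ z in 𝓝 ((t, x, y) : Pt), z ∈ box J I K := h.isOpen_box.mem_nhds hz
    have h2 : ∀ᶠ z in 𝓝 ((t, x, y) : Pt), (fderiv ℝ Φ z (1, 0, 0)).1 ≠ 0 :=
      (h.contDiffAt_fderiv hz (1, 0, 0)).continuousAt.fst.eventually_ne hT
    have h3 : Filter.Tendsto (fun j : Pt × ℝ × ℝ => j.1) (𝓝 ((t, x, y), a, b)) (𝓝 (t, x, y)) :=
      continuous_fst.tendsto _
    filter_upwards [h3.eventually h1, h3.eventually h2] with j hj1 hj2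
      using hs' j.1 hj1 hj2 j.2.1 j.2.2
  have hsd : DifferentiableAt ℝ (slope Φ) ((t, x, y), b) := by
    have h1 : DifferentiableAt ℝ (slopeX Φ) ((t, x, y), a, b) :=
      (contDiffAt_slopeX (h.contDiffAt hz) hΔ).differentiableAt (by simp)
    have h2 := h1.congr_of_eventuallyEq hev.symm
    exact DifferentiableAt.comp (f := fun k : Pt × ℝ => (k.1, a, k.2)) ((t, x, y), b) h2
      (by fun_prop)
  refine ⟨?_, hsd, hT⟩
  have hfd : ∀ w α β, fderiv ℝ (slopeX Φ) ((t, x, y), a, b) (w, α, β)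
      = fderiv ℝ (slope Φ) ((t, x, y), b) (w, β) := by
    intro w α β
    rw [hev.fderiv_eq]
    have h1 : HasFDerivAt (fun j : Pt × ℝ × ℝ => (j.1, j.2.2))
        ((ContinuousLinearMap.fst ℝ Pt (ℝ × ℝ)).prod ((ContinuousLinearMap.snd ℝ ℝ ℝ).comp
          (ContinuousLinearMap.snd ℝ Pt (ℝ × ℝ)))) ((t, x, y), a, b) :=
      hasFDerivAt_fst.prodMk hasFDerivAt_snd.snd
    have h2 : HasFDerivAt (fun j : Pt × ℝ × ℝ => slope Φ (j.1, j.2.2)) _ ((t, x, y), a, b) :=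
      HasFDerivAt.comp (g := slope Φ) ((t, x, y), a, b) hsd.hasFDerivAt h1
    rw [h2.fderiv]
    rfl
  -- The mixed derivative and u_tt have become irrelevant and are set to 0.
  rw [h.mapsEquation.jet_iff h.space.1 h.space'.1 h.isOpen_box h.smooth hz hz.2.1 (h.mapsTo _ hz)
    0 0 e hΔ, hs' _ hz hT, hfd, hfd]
  have hT0 : (fderiv ℝ Φ (t, x, y) (0, 1, b)).1 = 0 := by
    rw [clm_apply_fst, hTz.1, hTz.2]; ring
  have hT1 : (fderiv ℝ Φ (t, x, y) (1, 0, a)).1 = (fderiv ℝ Φ (t, x, y) (1, 0, 0)).1 := by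
    rw [clm_apply_fst, hTz.1, hTz.2]; ring
  have e1 : slopeT Φ ((t, x, y), a, b) = ((fderiv ℝ Φ (t, x, y) (1, 0, a)).2.2
        - slope Φ ((t, x, y), b) * (fderiv ℝ Φ (t, x, y) (1, 0, a)).2.1)
          / (fderiv ℝ Φ (t, x, y) (1, 0, 0)).1 := by
    rw [slopeT, hdet' _ hz, slope]
    field_simp
  rw [e1, hT0, hT1, hdet' _ hz, zero_mul, sub_zero, mul_div_mul_left _ _ hT]

/-- The new space variable does not depend on `u`. -/
theorem fderiv_space (h : IsAdmissible J I K I' θ θ' Φ) {z : Pt} (hz : z ∈ box J I K) :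
    (fderiv ℝ Φ z (0, 0, 1)).2.1 = 0 ∧
      (fderiv ℝ Φ z (1, 0, 0)).1 ≠ 0 ∧ (fderiv ℝ Φ z (0, 1, 0)).2.1 ≠ 0 ∧
      (fderiv ℝ Φ z (0, 0, 1)).2.2 ≠ 0 ∧
      θ'.f (Φ z).2.1 * θ.g z.2.1 * (fderiv ℝ Φ z (0, 1, 0)).2.1 ^ 2
        = (fderiv ℝ Φ z (1, 0, 0)).1 * θ'.g (Φ z).2.1 * θ.f z.2.1 := by
  obtain ⟨t, x, y⟩ := z
  have hdet := det_ne_zero_of_isInvertible (h.nondegenerate _ hz)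
  have hTz := h.fderiv_time hz
  have hx : x ∈ I := hz.2.1
  have hg := θ.g_ne_zero x hx
  have hX := h.mapsTo _ hz
  set L := fderiv ℝ Φ (t, x, y) with hL
  rw [hTz.1, hTz.2] at hdet
  simp only [zero_mul, sub_zero, add_zero] at hdet
  have hT := left_ne_zero_of_mul hdet
  have hj := right_ne_zero_of_mul hdet
  have key : ∀ b, (L (0, 1, 0)).2.1 + b * (L (0, 0, 1)).2.1 ≠ 0 →
      θ'.f (Φ (t, x, y)).2.1 * θ.g x * ((L (0, 1, 0)).2.1 + b * (L (0, 0, 1)).2.1) ^ 2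
        = (L (1, 0, 0)).1 * θ'.g (Φ (t, x, y)).2.1 * θ.f x := by
    intro b hb
    have hD : (L (0, 1, b)).2.1 = (L (0, 1, 0)).2.1 + b * (L (0, 0, 1)).2.1 := by
      rw [clm_apply_snd_fst]; ring
    have hN : (L (0, 1, b)).2.2 = (L (0, 1, 0)).2.2 + b * (L (0, 0, 1)).2.2 := by
      rw [clm_apply_snd_snd]; ring
    set e := (- deriv θ.g x * b - θ.h x * Real.exp (θ.m * y)) / θ.g x with he
    have hsrc0 : θ.f x * 0 = θ.g x * e + deriv θ.g x * b + θ.h x * Real.exp (θ.m * y) := by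
      rw [he]; field_simp; ring
    -- Adding (g, f) to (u_t, u_xx) preserves the source equation, because f · g = g · f. The
    -- difference of the two target equations contains only f', g' and the first derivatives of the
    -- transformation.
    have hsrc1 : θ.f x * θ.g x = θ.g x * (e + θ.f x) + deriv θ.g x * b
        + θ.h x * Real.exp (θ.m * y) := by
      linear_combination hsrc0
    have hDne : (L (0, 1, b)).2.1 ≠ 0 := by rwa [hD]
    have h0 := (h.jet_iff_slope hz hDne _ _).1.1 hsrc0
    have h1 := (h.jet_iff_slope hz hDne _ _).1.1 hsrc1
    have hsd := (h.jet_iff_slope hz hDne 0 0).2.1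
    set D := fderiv ℝ (slope Φ) ((t, x, y), b)
    have hlin : D ((0, 1, b), e + θ.f x) = D ((0, 1, b), e) + θ.f x * D (0, 1) := by
      rw [← smul_eq_mul, ← map_smul, ← map_add]; simp
    have hline : HasDerivAt (fun r : ℝ => slope Φ (((t, x, y), b) + r • (0, 1)))
      (D (0, 1)) 0 := hsd.hasFDerivAt.hasLineDerivAt (0, 1)
    have hform : ∀ r : ℝ, slope Φ (((t, x, y), b) + r • (0, 1)) =
        ((L (0, 1, b)).2.2 + r * (L (0, 0, 1)).2.2) /
          ((L (0, 1, b)).2.1 + r * (L (0, 0, 1)).2.1) := by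
      intro r
      have hpt : (((t, x, y), b) : Pt × ℝ) + r • (0, 1) = ((t, x, y), b + r) := by simp
      have hadd : L (0, 1, b + r) = L (0, 1, b) + r • L (0, 0, 1) := by
        rw [← map_smul, ← map_add]; simp
      rw [hpt]
      simp only [slope, ← hL, hadd, Prod.fst_add, Prod.snd_add, Prod.smul_fst,
        Prod.smul_snd, smul_eq_mul]
    simp_rw [hform] at hline
    have hid := hasDerivAt_id (0 : ℝ)
    have hq := ((hid.mul_const (L (0, 0, 1)).2.2).const_add (L (0, 1, b)).2.2).div
      ((hid.mul_const (L (0, 0, 1)).2.1).const_add (L (0, 1, b)).2.1) (by simpa using hDne)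
    have hDv := hline.unique hq
    simp only [id, zero_mul, add_zero, one_mul] at hDv
    rw [hlin, hDv] at h1
    rw [clm_apply_snd_snd _ 1 0 (θ.g x), clm_apply_snd_fst _ 1 0 (θ.g x), slope] at h1
    rw [slope] at h0
    simp only [← hL] at h0 h1
    rw [← hD]
    have hdiff : θ'.f (Φ (t, x, y)).2.1 * ((θ.g x * (L (0, 0, 1)).2.2
        - (L (0, 1, b)).2.2 / (L (0, 1, b)).2.1 * (θ.g x * (L (0, 0, 1)).2.1)) / (L (1, 0, 0)).1)
        = θ'.g (Φ (t, x, y)).2.1 * (θ.f x * (((L (0, 0, 1)).2.2 * (L (0, 1, b)).2.1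
          - (L (0, 1, b)).2.2 * (L (0, 0, 1)).2.1) / (L (0, 1, b)).2.1 ^ 2)
            / (L (0, 1, b)).2.1) := by
      linear_combination h1 - h0
    field_simp at hdiff
    have hj' : (L (0, 0, 1)).2.2 * (L (0, 1, b)).2.1 - (L (0, 1, b)).2.2 * (L (0, 0, 1)).2.1 ≠ 0 := by
      rw [hD, hN]
      intro h0; apply hj; linear_combination h0
    refine mul_right_cancel₀ hj' ?_
    linear_combination hdiff
  have hf' := θ'.f_ne_zero _ hX
  -- By `key` the square of D_x X = X_x + b X_u takes the same value for all admissible b. If X_u ≠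
  -- 0, then b can be chosen to make D_x X equal to 1 and to 2, a contradiction.
  have hXu : (L (0, 0, 1)).2.1 = 0 := by
    by_contra hne
    have hd : ∀ D : ℝ, (L (0, 1, 0)).2.1 + (D - (L (0, 1, 0)).2.1) / (L (0, 0, 1)).2.1
        * (L (0, 0, 1)).2.1 = D := fun D => by field_simp; ring
    have k1 := key ((1 - (L (0, 1, 0)).2.1) / (L (0, 0, 1)).2.1) (by rw [hd]; norm_num)
    have k2 := key ((2 - (L (0, 1, 0)).2.1) / (L (0, 0, 1)).2.1) (by rw [hd]; norm_num)
    rw [hd] at k1 k2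
    have : θ'.f (Φ (t, x, y)).2.1 * θ.g x = 0 := by linear_combination (k2 - k1) / 3
    exact mul_ne_zero hf' hg this
  rw [hXu, zero_mul, sub_zero] at hj
  have hXx := left_ne_zero_of_mul hj
  refine ⟨hXu, hT, hXx, right_ne_zero_of_mul hj, ?_⟩
  simpa using key 0 (by simpa using hXx)

end IsAdmissible

/-! ### Independence of exponentials, and splitting by powers of u_x. -/

theorem IsOpenInterval.eq_of_deriv_eq_zero {K : Set ℝ} (hK : IsOpenInterval K) {k : ℝ → ℝ}
    (hk : ∀ y ∈ K, HasDerivAt k 0 y) {y y' : ℝ} (hy : y ∈ K) (hy' : y' ∈ K) : k y = k y' :=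
  hK.1.is_const_of_deriv_eq_zero hK.2.1.isPreconnected
    (fun y hy => (hk y hy).differentiableAt.differentiableWithinAt)
    (fun y hy => (hk y hy).deriv) hy hy'

/-- Along an open set, a function which vanishes has vanishing derivative. -/
theorem hasDerivAt_eq_zero_of_isOpen {K : Set ℝ} (hK : IsOpen K) {k : ℝ → ℝ} {c : ℝ}
    (hk : ∀ y ∈ K, k y = c) {y k' : ℝ} (hy : y ∈ K) (hd : HasDerivAt k k' y) : k' = 0 := by
  have h1 : k =ᶠ[𝓝 y] fun _ => c := by
    filter_upwards [hK.mem_nhds hy] with r hr using hk r hr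
  exact hd.unique ((hasDerivAt_const y c).congr_of_eventuallyEq h1)

/-- On an interval, exponentials with nonzero exponents are independent of each other and of
affine functions. -/
theorem exp_sub_exp_eq_affine {K : Set ℝ} (hK : IsOpenInterval K) {A C α m p q : ℝ} (hA : A ≠ 0)
    (hC : C ≠ 0) (hα : α ≠ 0) (hm : m ≠ 0)
    (h : ∀ y ∈ K, A * Real.exp (α * y) - C * Real.exp (m * y) = p * y + q) :
    α = m ∧ A = C ∧ p = 0 ∧ q = 0 := by
  have hexp : ∀ c y : ℝ, HasDerivAt (fun y => Real.exp (c * y)) (c * Real.exp (c * y)) y := by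
    intro c y
    have := ((hasDerivAt_id y).const_mul c).exp
    simpa [mul_comm] using this
  have hid : ∀ y : ℝ, HasDerivAt (fun y : ℝ => p * y + q) p y := fun y => by
    simpa using ((hasDerivAt_id y).const_mul p).add_const q
  -- Two derivatives remove the affine part. In the third minus m times the second only A α² (α - m)
  -- e^{αy} survives, which gives α = m.
  have h1 : ∀ y ∈ K, A * (α * Real.exp (α * y)) - C * (m * Real.exp (m * y)) - p = 0 :=
    fun y hy => hasDerivAt_eq_zero_of_isOpen hK.1 (c := 0)
      (fun y hy => sub_eq_zero.2 (h y hy)) hy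
        ((((hexp α y).const_mul A).sub ((hexp m y).const_mul C)).sub (hid y))
  have h2 : ∀ y ∈ K, A * (α * (α * Real.exp (α * y))) - C * (m * (m * Real.exp (m * y))) = 0 :=
    fun y hy => hasDerivAt_eq_zero_of_isOpen hK.1 (c := 0) h1 hy
      (((((hexp α y).const_mul α).const_mul A).sub (((hexp m y).const_mul m).const_mul C)).sub_const
        p)
  have h3 : ∀ y ∈ K, A * (α * (α * (α * Real.exp (α * y))))
      - C * (m * (m * (m * Real.exp (m * y)))) = 0 :=
    fun y hy => hasDerivAt_eq_zero_of_isOpen hK.1 (c := 0) h2 hy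
      (((((hexp α y).const_mul α).const_mul α).const_mul A).sub
        ((((hexp m y).const_mul m).const_mul m).const_mul C))
  obtain ⟨y, hy⟩ := hK.2.2
  have hαm : α = m := by
    have h4 : A * α * α * Real.exp (α * y) * (α - m) = 0 := by
      linear_combination h3 y hy - m * h2 y hy
    have h5 : A * α * α * Real.exp (α * y) ≠ 0 :=
      mul_ne_zero (mul_ne_zero (mul_ne_zero hA hα) hα) (Real.exp_ne_zero _)
    exact sub_eq_zero.1 ((mul_eq_zero.1 h4).resolve_left h5)
  subst hαm
  have hAC : A = C := by
    have h4 : (A - C) * (α * α * Real.exp (α * y)) = 0 := by linear_combination h2 y hy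
    have h5 : α * α * Real.exp (α * y) ≠ 0 :=
      mul_ne_zero (mul_ne_zero hα hα) (Real.exp_ne_zero _)
    exact sub_eq_zero.1 ((mul_eq_zero.1 h4).resolve_right h5)
  subst hAC
  have hp : p = 0 := by linarith [h1 y hy]
  refine ⟨rfl, rfl, hp, ?_⟩
  have := h y hy
  rw [hp] at this
  linarith

theorem hasDerivAt_slice_three {F : Type*} [NormedAddCommGroup F] [NormedSpace ℝ F] {f : Pt → F}
    {t x y : ℝ} (hf : DifferentiableAt ℝ f (t, x, y)) :
    HasDerivAt (fun s => f (s, x, y)) (fderiv ℝ f (t, x, y) (1, 0, 0)) t ∧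
      HasDerivAt (fun s => f (t, s, y)) (fderiv ℝ f (t, x, y) (0, 1, 0)) x ∧
      HasDerivAt (fun s => f (t, x, s)) (fderiv ℝ f (t, x, y) (0, 0, 1)) y := by
  refine ⟨?_, ?_, ?_⟩
  · exact HasFDerivAt.comp_hasDerivAt t (f := fun s : ℝ => ((s, x, y) : Pt)) hf.hasFDerivAt
      ((hasDerivAt_id t).prodMk ((hasDerivAt_const _ _).prodMk (hasDerivAt_const _ _)))
  · exact HasFDerivAt.comp_hasDerivAt x (f := fun s : ℝ => ((t, s, y) : Pt)) hf.hasFDerivAt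
      ((hasDerivAt_const _ _).prodMk ((hasDerivAt_id x).prodMk (hasDerivAt_const _ _)))
  · exact HasFDerivAt.comp_hasDerivAt y (f := fun s : ℝ => ((t, x, s) : Pt)) hf.hasFDerivAt
      ((hasDerivAt_const _ _).prodMk ((hasDerivAt_const _ _).prodMk (hasDerivAt_id y)))

namespace IsAdmissible

variable {J I K I' : Set ℝ} {θ : Coeff I} {θ' : Coeff I'} {Φ : Pt → Pt}

/-- Quotient rule for D_x U / D_x X along (1, u_x, u_xx). X_xu vanishes because X_u = 0 nearby, and
the symmetry U_xu = U_ux produces the factor 2. The result is a quadratic polynomial in b = u_x. -/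
theorem fderiv_slope (h : IsAdmissible J I K I' θ θ' Φ) {t x y : ℝ} (hz : (t, x, y) ∈ box J I K)
    (b e : ℝ) (hsd : DifferentiableAt ℝ (slope Φ) ((t, x, y), b)) :
    fderiv ℝ (slope Φ) ((t, x, y), b) ((0, 1, b), e) =
      ((fderiv ℝ (fun z => (fderiv ℝ Φ z (0, 1, 0)).2.2) (t, x, y) (0, 1, 0)
          + b * (2 * fderiv ℝ (fun z => (fderiv ℝ Φ z (0, 0, 1)).2.2) (t, x, y) (0, 1, 0))
          + b ^ 2 * fderiv ℝ (fun z => (fderiv ℝ Φ z (0, 0, 1)).2.2) (t, x, y) (0, 0, 1)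
          + (fderiv ℝ Φ (t, x, y) (0, 0, 1)).2.2 * e) * (fderiv ℝ Φ (t, x, y) (0, 1, 0)).2.1
        - ((fderiv ℝ Φ (t, x, y) (0, 1, 0)).2.2 + b * (fderiv ℝ Φ (t, x, y) (0, 0, 1)).2.2)
          * fderiv ℝ (fun z => (fderiv ℝ Φ z (0, 1, 0)).2.1) (t, x, y) (0, 1, 0))
        / (fderiv ℝ Φ (t, x, y) (0, 1, 0)).2.1 ^ 2 := by
  set Ux := fun z => (fderiv ℝ Φ z (0, 1, 0)).2.2 with hUx
  set Uu := fun z => (fderiv ℝ Φ z (0, 0, 1)).2.2 with hUu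
  set Xx := fun z => (fderiv ℝ Φ z (0, 1, 0)).2.1 with hXx
  have dUx : DifferentiableAt ℝ Ux (t, x, y) :=
    ((h.contDiffAt_fderiv hz (0, 1, 0)).snd.snd).differentiableAt (by simp)
  have dUu : DifferentiableAt ℝ Uu (t, x, y) :=
    ((h.contDiffAt_fderiv hz (0, 0, 1)).snd.snd).differentiableAt (by simp)
  have dXx : DifferentiableAt ℝ Xx (t, x, y) :=
    ((h.contDiffAt_fderiv hz (0, 1, 0)).snd.fst).differentiableAt (by simp)
  have hΦev : ∀ᶠ z in 𝓝 ((t, x, y) : Pt), z ∈ box J I K := h.isOpen_box.mem_nhds hz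
  have hcomp : ∀ᶠ z in 𝓝 ((t, x, y) : Pt), ∀ w,
      (fderiv ℝ Φ z w).2.2 = fderiv ℝ (fun z => (Φ z).2.2) z w ∧
      (fderiv ℝ Φ z w).2.1 = fderiv ℝ (fun z => (Φ z).2.1) z w := by
    filter_upwards [hΦev] with z hz w
    have hd := ((h.contDiffAt hz).differentiableAt (by simp)).hasFDerivAt
    rw [hd.snd.snd.fderiv, hd.snd.fst.fderiv]
    exact ⟨rfl, rfl⟩
  have hXu : fderiv ℝ Xx (t, x, y) (0, 0, 1) = 0 := by
    have e1 : Xx =ᶠ[𝓝 (t, x, y)] fun z => fderiv ℝ (fun z => (Φ z).2.1) z (0, 1, 0) :=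
      hcomp.mono fun z hz => (hz _).2
    have e2 : (fun z => fderiv ℝ (fun z => (Φ z).2.1) z (0, 0, 1)) =ᶠ[𝓝 (t, x, y)] fun _ => 0 := by
      filter_upwards [hcomp, hΦev] with z hz hz'
      rw [← (hz _).2, (h.fderiv_space hz').1]
    rw [e1.fderiv_eq, fderiv_fderiv_comm (h.contDiffAt hz).snd.fst, e2.fderiv_eq]
    simp
  have hUxu : fderiv ℝ Ux (t, x, y) (0, 0, 1) = fderiv ℝ Uu (t, x, y) (0, 1, 0) := by
    have e1 : Ux =ᶠ[𝓝 (t, x, y)] fun z => fderiv ℝ (fun z => (Φ z).2.2) z (0, 1, 0) :=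
      hcomp.mono fun z hz => (hz _).1
    have e2 : Uu =ᶠ[𝓝 (t, x, y)] fun z => fderiv ℝ (fun z => (Φ z).2.2) z (0, 0, 1) :=
      hcomp.mono fun z hz => (hz _).1
    rw [e1.fderiv_eq, e2.fderiv_eq, fderiv_fderiv_comm (h.contDiffAt hz).snd.snd]
  have hXx0 := (h.fderiv_space hz).2.2.1
  have hline : HasDerivAt (fun r : ℝ => slope Φ (((t, x, y), b) + r • ((0, 1, b), e)))
    _ 0 := hsd.hasFDerivAt.hasLineDerivAt ((0, 1, b), e)
  have hlin : ∀ {f : Pt → ℝ}, DifferentiableAt ℝ f (t, x, y) →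
      HasDerivAt (fun r : ℝ => f ((t, x, y) + r • (0, 1, b))) (fderiv ℝ f (t, x, y) (0, 1, 0)
        + b * fderiv ℝ f (t, x, y) (0, 0, 1)) 0 := by
    intro f hf
    have h1 : fderiv ℝ f (t, x, y) (0, 1, b) = fderiv ℝ f (t, x, y) (0, 1, 0)
        + b * fderiv ℝ f (t, x, y) (0, 0, 1) := by
      rw [clm_three_apply]; simp
    rw [← h1]
    exact hf.hasFDerivAt.hasLineDerivAt (0, 1, b)
  have htend : Filter.Tendsto (fun r : ℝ => ((t, x, y) : Pt) + r • ((0, 1, b) : Pt)) (𝓝 0)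
      (𝓝 (t, x, y)) := by
    have : Continuous (fun r : ℝ => ((t, x, y) : Pt) + r • ((0, 1, b) : Pt)) := by fun_prop
    simpa using this.tendsto 0
  have hform : (fun r : ℝ => slope Φ (((t, x, y), b) + r • ((0, 1, b), e))) =ᶠ[𝓝 0]
      fun r => (Ux ((t, x, y) + r • (0, 1, b)) + (b + r * e) * Uu ((t, x, y) + r • (0, 1, b)))
        / Xx ((t, x, y) + r • (0, 1, b)) := by
    filter_upwards [htend.eventually hΦev] with r hr
    have h1 := (h.fderiv_space hr).1
    have hpt : (((t, x, y), b) : Pt × ℝ) + r • ((0, 1, b), e)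
      = ((t, x, y) + r • (0, 1, b), b + r * e) := by simp
    rw [hpt]
    simp only [slope]
    rw [clm_apply_snd_snd _ 0 1, clm_apply_snd_fst _ 0 1, h1]
    simp only [hUx, hUu, hXx]
    ring
  have hbe : HasDerivAt (fun r : ℝ => b + r * e) e 0 := by
    simpa using ((hasDerivAt_id (0 : ℝ)).mul_const e).const_add b
  have hq := ((hlin dUx).add (hbe.mul (hlin dUu))).div (hlin dXx) (by simpa [hXx] using hXx0)
  rw [hline.unique (hq.congr_of_eventuallyEq hform), hXu, hUxu]
  simp only [Pi.add_apply, Pi.mul_apply, zero_smul, add_zero, zero_mul]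
  congr 1
  ring

/-- The forward half of the jet equivalence with every dependence on u_x explicit, ready for
comparing coefficients. -/
theorem jet_iff_quadratic (h : IsAdmissible J I K I' θ θ' Φ) {t x y : ℝ}
    (hz : (t, x, y) ∈ box J I K) (a b e : ℝ)
    (hsrc : θ.f x * a = θ.g x * e + deriv θ.g x * b + θ.h x * Real.exp (θ.m * y)) :
    θ'.f (Φ (t, x, y)).2.1 * (((fderiv ℝ Φ (t, x, y) (1, 0, 0)).2.2
          + a * (fderiv ℝ Φ (t, x, y) (0, 0, 1)).2.2
        - ((fderiv ℝ Φ (t, x, y) (0, 1, 0)).2.2 + b * (fderiv ℝ Φ (t, x, y) (0, 0, 1)).2.2)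
          / (fderiv ℝ Φ (t, x, y) (0, 1, 0)).2.1 * (fderiv ℝ Φ (t, x, y) (1, 0, 0)).2.1)
          / (fderiv ℝ Φ (t, x, y) (1, 0, 0)).1) =
      θ'.g (Φ (t, x, y)).2.1 *
        (((fderiv ℝ (fun z => (fderiv ℝ Φ z (0, 1, 0)).2.2) (t, x, y) (0, 1, 0)
          + b * (2 * fderiv ℝ (fun z => (fderiv ℝ Φ z (0, 0, 1)).2.2) (t, x, y) (0, 1, 0))
          + b ^ 2 * fderiv ℝ (fun z => (fderiv ℝ Φ z (0, 0, 1)).2.2) (t, x, y) (0, 0, 1)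
          + (fderiv ℝ Φ (t, x, y) (0, 0, 1)).2.2 * e) * (fderiv ℝ Φ (t, x, y) (0, 1, 0)).2.1
        - ((fderiv ℝ Φ (t, x, y) (0, 1, 0)).2.2 + b * (fderiv ℝ Φ (t, x, y) (0, 0, 1)).2.2)
          * fderiv ℝ (fun z => (fderiv ℝ Φ z (0, 1, 0)).2.1) (t, x, y) (0, 1, 0))
        / (fderiv ℝ Φ (t, x, y) (0, 1, 0)).2.1 ^ 3)
        + deriv θ'.g (Φ (t, x, y)).2.1 * (((fderiv ℝ Φ (t, x, y) (0, 1, 0)).2.2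
          + b * (fderiv ℝ Φ (t, x, y) (0, 0, 1)).2.2) / (fderiv ℝ Φ (t, x, y) (0, 1, 0)).2.1)
        + θ'.h (Φ (t, x, y)).2.1 * Real.exp (θ'.m * (Φ (t, x, y)).2.2) := by
  have hs := h.fderiv_space hz
  have hD : (fderiv ℝ Φ (t, x, y) (0, 1, b)).2.1 = (fderiv ℝ Φ (t, x, y) (0, 1, 0)).2.1 := by
    rw [clm_apply_snd_fst, hs.1]; ring
  have hN : (fderiv ℝ Φ (t, x, y) (0, 1, b)).2.2 = (fderiv ℝ Φ (t, x, y) (0, 1, 0)).2.2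
      + b * (fderiv ℝ Φ (t, x, y) (0, 0, 1)).2.2 := by
    rw [clm_apply_snd_snd]; ring
  obtain ⟨h1, h2, -⟩ := h.jet_iff_slope hz (b := b) (by rw [hD]; exact hs.2.2.1) a e
  have h3 := h1.1 hsrc
  rw [h.fderiv_slope hz b e h2] at h3
  have hXa : (fderiv ℝ Φ (t, x, y) (1, 0, a)).2.1 = (fderiv ℝ Φ (t, x, y) (1, 0, 0)).2.1 := by
    rw [clm_apply_snd_fst, hs.1]; ring
  have hUa : (fderiv ℝ Φ (t, x, y) (1, 0, a)).2.2 = (fderiv ℝ Φ (t, x, y) (1, 0, 0)).2.2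
      + a * (fderiv ℝ Φ (t, x, y) (0, 0, 1)).2.2 := by
    rw [clm_apply_snd_snd]; ring
  simp only [slope, hD, hN, hXa, hUa, div_div, ← pow_succ] at h3
  exact h3

/-- The three conclusions are the coefficients of u_x², u_x and 1 in the transformed equation after
u_xx is eliminated. Taking u_t = 0 is enough here, since the relation between u_t and u_xx has been
used in `fderiv_space`. -/
theorem fderiv_value (h : IsAdmissible J I K I' θ θ' Φ) {t x y : ℝ}
    (hz : (t, x, y) ∈ box J I K) :
    fderiv ℝ (fun z => (fderiv ℝ Φ z (0, 0, 1)).2.2) (t, x, y) (0, 0, 1) = 0 ∧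
    - θ'.f (Φ (t, x, y)).2.1 * (fderiv ℝ Φ (t, x, y) (0, 0, 1)).2.2
        * (fderiv ℝ Φ (t, x, y) (1, 0, 0)).2.1 * (fderiv ℝ Φ (t, x, y) (0, 1, 0)).2.1 ^ 2 * θ.g x
      = (fderiv ℝ Φ (t, x, y) (1, 0, 0)).1 * (θ'.g (Φ (t, x, y)).2.1 *
        ((2 * θ.g x * fderiv ℝ (fun z => (fderiv ℝ Φ z (0, 0, 1)).2.2) (t, x, y) (0, 1, 0)
            - (fderiv ℝ Φ (t, x, y) (0, 0, 1)).2.2 * deriv θ.g x)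
            * (fderiv ℝ Φ (t, x, y) (0, 1, 0)).2.1
          - (fderiv ℝ Φ (t, x, y) (0, 0, 1)).2.2 * θ.g x
            * fderiv ℝ (fun z => (fderiv ℝ Φ z (0, 1, 0)).2.1) (t, x, y) (0, 1, 0))
        + deriv θ'.g (Φ (t, x, y)).2.1 * (fderiv ℝ Φ (t, x, y) (0, 0, 1)).2.2
          * (fderiv ℝ Φ (t, x, y) (0, 1, 0)).2.1 ^ 2 * θ.g x) ∧
    θ'.f (Φ (t, x, y)).2.1 * (((fderiv ℝ Φ (t, x, y) (1, 0, 0)).2.2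
        - (fderiv ℝ Φ (t, x, y) (0, 1, 0)).2.2
          / (fderiv ℝ Φ (t, x, y) (0, 1, 0)).2.1 * (fderiv ℝ Φ (t, x, y) (1, 0, 0)).2.1)
          / (fderiv ℝ Φ (t, x, y) (1, 0, 0)).1) =
      θ'.g (Φ (t, x, y)).2.1 *
        (((fderiv ℝ (fun z => (fderiv ℝ Φ z (0, 1, 0)).2.2) (t, x, y) (0, 1, 0)
          - (fderiv ℝ Φ (t, x, y) (0, 0, 1)).2.2 * (θ.h x * Real.exp (θ.m * y) / θ.g x))
            * (fderiv ℝ Φ (t, x, y) (0, 1, 0)).2.1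
        - (fderiv ℝ Φ (t, x, y) (0, 1, 0)).2.2
          * fderiv ℝ (fun z => (fderiv ℝ Φ z (0, 1, 0)).2.1) (t, x, y) (0, 1, 0))
        / (fderiv ℝ Φ (t, x, y) (0, 1, 0)).2.1 ^ 3)
        + deriv θ'.g (Φ (t, x, y)).2.1 * ((fderiv ℝ Φ (t, x, y) (0, 1, 0)).2.2
          / (fderiv ℝ Φ (t, x, y) (0, 1, 0)).2.1)
        + θ'.h (Φ (t, x, y)).2.1 * Real.exp (θ'.m * (Φ (t, x, y)).2.2) := by
  have hg := θ.g_ne_zero x hz.2.1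
  have hg' := θ'.g_ne_zero _ (h.mapsTo _ hz)
  obtain ⟨-, hT, hXx, -, -⟩ := h.fderiv_space hz
  have key := fun b => h.jet_iff_quadratic hz 0 b
    ((- deriv θ.g x * b - θ.h x * Real.exp (θ.m * y)) / θ.g x) (by field_simp; ring)
  -- A quadratic polynomial in u_x is determined by its values at 0, 1 and -1.
  have k0 := key 0
  have k1 := key 1
  have k2 := key (-1)
  generalize fderiv ℝ (fun z => (fderiv ℝ Φ z (0, 0, 1)).2.2) (t, x, y) (0, 0, 1) = Uuu at *
  generalize fderiv ℝ (fun z => (fderiv ℝ Φ z (0, 0, 1)).2.2) (t, x, y) (0, 1, 0) = Uxu at *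
  generalize fderiv ℝ (fun z => (fderiv ℝ Φ z (0, 1, 0)).2.2) (t, x, y) (0, 1, 0) = Uxx at *
  generalize fderiv ℝ (fun z => (fderiv ℝ Φ z (0, 1, 0)).2.1) (t, x, y) (0, 1, 0) = Xxx at *
  generalize (fderiv ℝ Φ (t, x, y) (1, 0, 0)).1 = T at *
  generalize (fderiv ℝ Φ (t, x, y) (1, 0, 0)).2.1 = Xt at *
  generalize (fderiv ℝ Φ (t, x, y) (0, 1, 0)).2.1 = Xx at *
  generalize (fderiv ℝ Φ (t, x, y) (1, 0, 0)).2.2 = Ut at *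
  generalize (fderiv ℝ Φ (t, x, y) (0, 1, 0)).2.2 = Ux at *
  generalize (fderiv ℝ Φ (t, x, y) (0, 0, 1)).2.2 = Uu at *
  generalize deriv θ.g x = g₁ at *
  generalize deriv θ'.g (Φ (t, x, y)).2.1 = g₂ at *
  generalize θ'.g (Φ (t, x, y)).2.1 = G at *
  generalize θ'.f (Φ (t, x, y)).2.1 = F at *
  generalize θ'.h (Φ (t, x, y)).2.1 * Real.exp (θ'.m * (Φ (t, x, y)).2.2) = H at *
  generalize θ.h x * Real.exp (θ.m * y) = H₀ at *
  generalize θ.g x = g at *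
  refine ⟨?_, ?_, ?_⟩
  · have h1 : G * (Uuu * Xx / Xx ^ 3) = 0 := by linear_combination k0 - (k1 + k2) / 2
    simpa [hg', hXx] using h1
  · have h1 : F * ((- Uu / Xx * Xt) / T) = G * (((2 * Uxu - Uu * (g₁ / g)) * Xx - Uu * Xxx) / Xx ^ 3)
        + g₂ * (Uu / Xx) := by
      linear_combination (k1 - k2) / 2
    field_simp at h1
    linear_combination h1
  · linear_combination k0

end IsAdmissible

/-! ### Normal form of a single admissible transformation. -/

theorem contDiffOn_fderiv_apply {E F : Type*} [NormedAddCommGroup E] [NormedSpace ℝ E]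
    [NormedAddCommGroup F] [NormedSpace ℝ F] {f : E → F} {s : Set E} (hs : IsOpen s)
    (hf : ContDiffOn ℝ ∞ f s) (w : E) : ContDiffOn ℝ ∞ (fun z => fderiv ℝ f z w) s :=
  (hf.fderiv_of_isOpen hs (by simp)).clm_apply contDiffOn_const

/-- The point transformation is `t' = T(t)`, `x' = X(t, x)`, `u' = (m / m') u + U₀(t, x)` with
components that satisfy the determining equations. -/
structure IsNormalForm (J I K I' : Set ℝ) (θ : Coeff I) (θ' : Coeff I') (Φ : Pt → Pt)
    (T : ℝ → ℝ) (X U₀ : ℝ × ℝ → ℝ) : Prop where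
  smooth_T : ContDiffOn ℝ ∞ T J
  smooth_X : ContDiffOn ℝ ∞ X (J ×ˢ I)
  smooth_U : ContDiffOn ℝ ∞ U₀ (J ×ˢ I)
  eq : ∀ t ∈ J, ∀ x ∈ I, ∀ y ∈ K, Φ (t, x, y) = (T t, X (t, x), θ.m / θ'.m * y + U₀ (t, x))
  mem : ∀ t ∈ J, ∀ x ∈ I, X (t, x) ∈ I'
  deriv_T : ∀ t ∈ J, deriv T t ≠ 0
  deriv_X : ∀ t ∈ J, ∀ x ∈ I, fderiv ℝ X (t, x) (0, 1) ≠ 0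
  eq_fg : ∀ t ∈ J, ∀ x ∈ I, θ'.f (X (t, x)) * θ.g x * fderiv ℝ X (t, x) (0, 1) ^ 2
    = deriv T t * θ'.g (X (t, x)) * θ.f x
  eq_g : ∀ t ∈ J, ∀ x ∈ I, - θ'.f (X (t, x)) * fderiv ℝ X (t, x) (1, 0)
      * fderiv ℝ X (t, x) (0, 1) ^ 2 * θ.g x
    = deriv T t * (deriv θ'.g (X (t, x)) * fderiv ℝ X (t, x) (0, 1) ^ 2 * θ.g x
      - θ'.g (X (t, x)) * (deriv θ.g x * fderiv ℝ X (t, x) (0, 1)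
        + θ.g x * fderiv ℝ (fun p => fderiv ℝ X p (0, 1)) (t, x) (0, 1)))
  eq_U : ∀ t ∈ J, ∀ x ∈ I, θ'.f (X (t, x)) * (fderiv ℝ U₀ (t, x) (1, 0) * fderiv ℝ X (t, x) (0, 1)
      - fderiv ℝ U₀ (t, x) (0, 1) * fderiv ℝ X (t, x) (1, 0)) * fderiv ℝ X (t, x) (0, 1) ^ 2
    = deriv T t * (θ'.g (X (t, x)) * (fderiv ℝ (fun p => fderiv ℝ U₀ p (0, 1)) (t, x) (0, 1)
          * fderiv ℝ X (t, x) (0, 1)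
        - fderiv ℝ U₀ (t, x) (0, 1) * fderiv ℝ (fun p => fderiv ℝ X p (0, 1)) (t, x) (0, 1))
      + deriv θ'.g (X (t, x)) * fderiv ℝ U₀ (t, x) (0, 1) * fderiv ℝ X (t, x) (0, 1) ^ 2)
  eq_h : ∀ t ∈ J, ∀ x ∈ I, θ'.h (X (t, x)) * Real.exp (θ'.m * U₀ (t, x))
      * fderiv ℝ X (t, x) (0, 1) ^ 2 * θ.g x
    = θ'.g (X (t, x)) * (θ.m / θ'.m) * θ.h x

namespace IsAdmissible

variable {J I K I' : Set ℝ} {θ : Coeff I} {θ' : Coeff I'} {Φ : Pt → Pt}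

/-- The components of `Φ`, with the dependence on the variables that the determining equations
allow. -/
theorem exists_components (h : IsAdmissible J I K I' θ θ' Φ) :
    ∃ (T : ℝ → ℝ) (X U₁ U₀ : ℝ × ℝ → ℝ), ContDiffOn ℝ ∞ T J ∧ ContDiffOn ℝ ∞ X (J ×ˢ I) ∧
      ContDiffOn ℝ ∞ U₁ (J ×ˢ I) ∧ ContDiffOn ℝ ∞ U₀ (J ×ˢ I) ∧
      ∀ t ∈ J, ∀ x ∈ I, ∀ y ∈ K,
        Φ (t, x, y) = (T t, X (t, x), U₁ (t, x) * y + U₀ (t, x)) := by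
  obtain ⟨t₀, ht₀⟩ := h.time.2.2
  obtain ⟨x₀, hx₀⟩ := h.space.2.2
  obtain ⟨y₀, hy₀⟩ := h.value.2.2
  have hU : ContDiffOn ℝ ∞ (fun z => (fderiv ℝ Φ z (0, 0, 1)).2.2) (box J I K) :=
    (contDiffOn_fderiv_apply h.isOpen_box h.smooth (0, 0, 1)).snd.snd
  have hs1 : ContDiffOn ℝ ∞ (fun t : ℝ => ((t, x₀, y₀) : Pt)) J := by fun_prop
  have hs2 : ContDiffOn ℝ ∞ (fun q : ℝ × ℝ => ((q.1, q.2, y₀) : Pt)) (J ×ˢ I) := by fun_prop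
  have hm1 : Set.MapsTo (fun t : ℝ => ((t, x₀, y₀) : Pt)) J (box J I K) :=
    fun t ht => ⟨ht, hx₀, hy₀⟩
  have hm2 : Set.MapsTo (fun q : ℝ × ℝ => ((q.1, q.2, y₀) : Pt)) (J ×ˢ I) (box J I K) :=
    fun q hq => ⟨hq.1, hq.2, hy₀⟩
  have hΦ2 := h.smooth.comp hs2 hm2
  have hU2 : ContDiffOn ℝ ∞ (fun q : ℝ × ℝ => (fderiv ℝ Φ (q.1, q.2, y₀) (0, 0, 1)).2.2)
    (J ×ˢ I) := hU.comp hs2 hm2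
  -- The components are read off at base points. U₁ is the slope of U in u, and U₀ its intercept:
  -- the value at y₀ minus U₁ y₀.
  refine ⟨fun t => (Φ (t, x₀, y₀)).1, fun q => (Φ (q.1, q.2, y₀)).2.1,
    fun q => (fderiv ℝ Φ (q.1, q.2, y₀) (0, 0, 1)).2.2,
    fun q => (Φ (q.1, q.2, y₀)).2.2 - (fderiv ℝ Φ (q.1, q.2, y₀) (0, 0, 1)).2.2 * y₀,
    (h.smooth.comp hs1 hm1).fst, hΦ2.snd.fst, hU2, hΦ2.snd.snd.sub (hU2.mul contDiffOn_const), ?_⟩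
  intro t ht x hx y hy
  have hd : ∀ x ∈ I, ∀ y ∈ K, DifferentiableAt ℝ Φ (t, x, y) := fun x hx y hy =>
    (h.contDiffAt ⟨ht, hx, hy⟩).differentiableAt (by simp)
  ext
  · have h1 : (Φ (t, x, y)).1 = (Φ (t, x, y₀)).1 :=
      h.value.eq_of_deriv_eq_zero (k := fun s => (Φ (t, x, s)).1) (fun s hs => by
        rw [← (h.fderiv_time (z := (t, x, s)) ⟨ht, hx, hs⟩).2]
        exact (hasDerivAt_slice_three (hd x hx s hs)).2.2.fst) hy hy₀
    have h2 : (Φ (t, x, y₀)).1 = (Φ (t, x₀, y₀)).1 :=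
      h.space.eq_of_deriv_eq_zero (k := fun s => (Φ (t, s, y₀)).1) (fun s hs => by
        rw [← (h.fderiv_time (z := (t, s, y₀)) ⟨ht, hs, hy₀⟩).1]
        exact (hasDerivAt_slice_three (hd s hs y₀ hy₀)).2.1.fst) hx hx₀
    exact h1.trans h2
  · exact h.value.eq_of_deriv_eq_zero (k := fun s => (Φ (t, x, s)).2.1) (fun s hs => by
      rw [← (h.fderiv_space (z := (t, x, s)) ⟨ht, hx, hs⟩).1]
      exact (hasDerivAt_slice_three (hd x hx s hs)).2.2.snd.fst) hy hy₀
  · have h1 : ∀ s ∈ K, (fderiv ℝ Φ (t, x, s) (0, 0, 1)).2.2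
        = (fderiv ℝ Φ (t, x, y₀) (0, 0, 1)).2.2 := fun s hs =>
      h.value.eq_of_deriv_eq_zero (k := fun s => (fderiv ℝ Φ (t, x, s) (0, 0, 1)).2.2)
        (fun s hs => by
          have hz : ((t, x, s) : Pt) ∈ box J I K := ⟨ht, hx, hs⟩
          have h0 := (hasDerivAt_slice_three ((hU.contDiffAt (h.isOpen_box.mem_nhds hz)
            ).differentiableAt (by simp))).2.2
          rwa [(h.fderiv_value hz).1] at h0) hs hy₀
    have h2 := h.value.eq_of_deriv_eq_zero (k := fun s => (Φ (t, x, s)).2.2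
        - (fderiv ℝ Φ (t, x, y₀) (0, 0, 1)).2.2 * s) (fun s hs => by
      have h3 : HasDerivAt (fun s => (Φ (t, x, s)).2.2) (fderiv ℝ Φ (t, x, s) (0, 0, 1)).2.2 s :=
        (hasDerivAt_slice_three (hd x hx s hs)).2.2.snd.snd
      have h4 := h3.sub ((hasDerivAt_id s).const_mul (fderiv ℝ Φ (t, x, y₀) (0, 0, 1)).2.2)
      rw [h1 s hs, mul_one, sub_self] at h4
      exact h4) hy hy₀
    dsimp only at h2 ⊢
    linarith

/-- Inserting U = U₁ u + U₀ into the coefficient free of u_x leaves A e^{m' U₁ u} - C e^{m u} = p u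
+ q for all u in an interval. Independence gives m' U₁ = m, so U₁ is constant; A = C is `eq_h` and q
= 0 is `eq_U`. -/
theorem exists_normalForm (h : IsAdmissible J I K I' θ θ' Φ) :
    ∃ (T : ℝ → ℝ) (X U₀ : ℝ × ℝ → ℝ), IsNormalForm J I K I' θ θ' Φ T X U₀ := by
  obtain ⟨T, X, U₁, U₀, hT, hX, hU₁, hU₀, hΦ⟩ := h.exists_components
  have hJI : IsOpen (J ×ˢ I) := h.time.1.prod h.space.1
  have hmem : ∀ t ∈ J, ∀ x ∈ I, X (t, x) ∈ I' := by
    intro t ht x hx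
    obtain ⟨y, hy⟩ := h.value.2.2
    have := h.mapsTo (t, x, y) ⟨ht, hx, hy⟩
    rwa [hΦ t ht x hx y hy] at this
  have diff : ∀ {f : ℝ × ℝ → ℝ}, ContDiffOn ℝ ∞ f (J ×ˢ I) → ∀ t ∈ J, ∀ x ∈ I,
      HasDerivAt (fun s => f (s, x)) (fderiv ℝ f (t, x) (1, 0)) t ∧
        HasDerivAt (fun s => f (t, s)) (fderiv ℝ f (t, x) (0, 1)) x := by
    intro f hf t ht x hx
    have : DifferentiableAt ℝ f (t, x) :=
      (hf.contDiffAt (hJI.mem_nhds ⟨ht, hx⟩)).differentiableAt (by simp)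
    exact ⟨hasDerivAt_slice_fst this, hasDerivAt_slice_snd this⟩
  have hTd : ∀ t ∈ J, HasDerivAt T (deriv T t) t := fun t ht =>
    ((hT.contDiffAt (h.time.1.mem_nhds ht)).differentiableAt (by simp)).hasDerivAt
  have pt : ∀ t ∈ J, ∀ x ∈ I, ∀ y ∈ K, fderiv ℝ Φ (t, x, y) (1, 0, 0) = (deriv T t,
      fderiv ℝ X (t, x) (1, 0), fderiv ℝ U₁ (t, x) (1, 0) * y + fderiv ℝ U₀ (t, x) (1, 0)) := by
    intro t ht x hx y hy
    have h1 := (hasDerivAt_slice_three ((h.contDiffAt (z := (t, x, y))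
      ⟨ht, hx, hy⟩).differentiableAt (by simp))).1
    refine h1.unique (HasDerivAt.congr_of_eventuallyEq ((hTd t ht).prodMk
      ((diff hX t ht x hx).1.prodMk (((diff hU₁ t ht x hx).1.mul_const y).add
        (diff hU₀ t ht x hx).1))) ?_)
    filter_upwards [h.time.1.mem_nhds ht] with s hs using hΦ s hs x hx y hy
  have px : ∀ t ∈ J, ∀ x ∈ I, ∀ y ∈ K, fderiv ℝ Φ (t, x, y) (0, 1, 0) = (0,
      fderiv ℝ X (t, x) (0, 1), fderiv ℝ U₁ (t, x) (0, 1) * y + fderiv ℝ U₀ (t, x) (0, 1)) := by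
    intro t ht x hx y hy
    have h1 := (hasDerivAt_slice_three ((h.contDiffAt (z := (t, x, y))
      ⟨ht, hx, hy⟩).differentiableAt (by simp))).2.1
    refine h1.unique (HasDerivAt.congr_of_eventuallyEq ((hasDerivAt_const x (T t)).prodMk
      ((diff hX t ht x hx).2.prodMk (((diff hU₁ t ht x hx).2.mul_const y).add
        (diff hU₀ t ht x hx).2))) ?_)
    filter_upwards [h.space.1.mem_nhds hx] with s hs using hΦ t ht s hs y hy
  have pu : ∀ t ∈ J, ∀ x ∈ I, ∀ y ∈ K, fderiv ℝ Φ (t, x, y) (0, 0, 1) = (0, 0, U₁ (t, x)) := by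
    intro t ht x hx y hy
    have h1 := (hasDerivAt_slice_three ((h.contDiffAt (z := (t, x, y))
      ⟨ht, hx, hy⟩).differentiableAt (by simp))).2.2
    have h2 : HasDerivAt (fun s => U₁ (t, x) * s + U₀ (t, x)) (U₁ (t, x)) y := by
      simpa using ((hasDerivAt_id y).const_mul (U₁ (t, x))).add_const (U₀ (t, x))
    refine h1.unique (HasDerivAt.congr_of_eventuallyEq ((hasDerivAt_const y (T t)).prodMk
      ((hasDerivAt_const y (X (t, x))).prodMk h2)) ?_)
    filter_upwards [h.value.1.mem_nhds hy] with s hs using hΦ t ht x hx s hs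
  have second : ∀ {f : Pt → ℝ}, ContDiffOn ℝ ∞ f (box J I K) → ∀ {k : ℝ → ℝ} {k' : ℝ},
      ∀ t ∈ J, ∀ x ∈ I, ∀ y ∈ K, (∀ s ∈ I, f (t, s, y) = k s) → HasDerivAt k k' x →
        fderiv ℝ f (t, x, y) (0, 1, 0) = k' := by
    intro f hf k k' t ht x hx y hy hfk hk
    have hz : ((t, x, y) : Pt) ∈ box J I K := ⟨ht, hx, hy⟩
    have h1 := (hasDerivAt_slice_three ((hf.contDiffAt (h.isOpen_box.mem_nhds hz)
      ).differentiableAt (by simp))).2.1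
    refine h1.unique (hk.congr_of_eventuallyEq ?_)
    filter_upwards [h.space.1.mem_nhds hx] with s hs using hfk s hs
  have hXx := contDiffOn_fderiv_apply hJI hX (0, 1)
  have hU₁x := contDiffOn_fderiv_apply hJI hU₁ (0, 1)
  have hU₀x := contDiffOn_fderiv_apply hJI hU₀ (0, 1)
  have sX := contDiffOn_fderiv_apply h.isOpen_box h.smooth (0, 1, 0)
  have sU := contDiffOn_fderiv_apply h.isOpen_box h.smooth (0, 0, 1)
  have pxx : ∀ t ∈ J, ∀ x ∈ I, ∀ y ∈ K,
      fderiv ℝ (fun z => (fderiv ℝ Φ z (0, 1, 0)).2.1) (t, x, y) (0, 1, 0)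
        = fderiv ℝ (fun p => fderiv ℝ X p (0, 1)) (t, x) (0, 1) := fun t ht x hx y hy =>
    second sX.snd.fst (k := fun s => fderiv ℝ X (t, s) (0, 1)) t ht x hx y hy
      (fun s hs => by rw [px t ht s hs y hy]) (diff hXx t ht x hx).2
  have puxx : ∀ t ∈ J, ∀ x ∈ I, ∀ y ∈ K,
      fderiv ℝ (fun z => (fderiv ℝ Φ z (0, 1, 0)).2.2) (t, x, y) (0, 1, 0)
        = fderiv ℝ (fun p => fderiv ℝ U₁ p (0, 1)) (t, x) (0, 1) * y
          + fderiv ℝ (fun p => fderiv ℝ U₀ p (0, 1)) (t, x) (0, 1) := fun t ht x hx y hy =>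
    second sX.snd.snd (k := fun s => fderiv ℝ U₁ (t, s) (0, 1) * y + fderiv ℝ U₀ (t, s) (0, 1))
      t ht x hx y hy (fun s hs => by rw [px t ht s hs y hy])
      (((diff hU₁x t ht x hx).2.mul_const y).add (diff hU₀x t ht x hx).2)
  have pux : ∀ t ∈ J, ∀ x ∈ I, ∀ y ∈ K,
      fderiv ℝ (fun z => (fderiv ℝ Φ z (0, 0, 1)).2.2) (t, x, y) (0, 1, 0)
        = fderiv ℝ U₁ (t, x) (0, 1) := fun t ht x hx y hy =>
    second sU.snd.snd (k := fun s => U₁ (t, s)) t ht x hx y hy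
      (fun s hs => by rw [pu t ht s hs y hy]) (diff hU₁ t ht x hx).2
  have facts : ∀ t ∈ J, ∀ x ∈ I, deriv T t ≠ 0 ∧ fderiv ℝ X (t, x) (0, 1) ≠ 0 ∧ U₁ (t, x) ≠ 0 ∧
      θ'.f (X (t, x)) * θ.g x * fderiv ℝ X (t, x) (0, 1) ^ 2
        = deriv T t * θ'.g (X (t, x)) * θ.f x := by
    intro t ht x hx
    obtain ⟨y, hy⟩ := h.value.2.2
    have := (h.fderiv_space (z := (t, x, y)) ⟨ht, hx, hy⟩).2
    rwa [pt t ht x hx y hy, px t ht x hx y hy, pu t ht x hx y hy, hΦ t ht x hx y hy] at this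
  have exps : ∀ t ∈ J, ∀ x ∈ I, θ'.m * U₁ (t, x) = θ.m ∧
      θ'.h (X (t, x)) * Real.exp (θ'.m * U₀ (t, x))
        = θ'.g (X (t, x)) * U₁ (t, x) * θ.h x / (θ.g x * fderiv ℝ X (t, x) (0, 1) ^ 2) ∧
      θ'.f (X (t, x)) * ((fderiv ℝ U₀ (t, x) (1, 0)
        - fderiv ℝ U₀ (t, x) (0, 1) / fderiv ℝ X (t, x) (0, 1) * fderiv ℝ X (t, x) (1, 0))
          / deriv T t)
      - θ'.g (X (t, x)) * ((fderiv ℝ (fun p => fderiv ℝ U₀ p (0, 1)) (t, x) (0, 1)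
          * fderiv ℝ X (t, x) (0, 1)
        - fderiv ℝ U₀ (t, x) (0, 1) * fderiv ℝ (fun p => fderiv ℝ X p (0, 1)) (t, x) (0, 1))
          / fderiv ℝ X (t, x) (0, 1) ^ 3)
      - deriv θ'.g (X (t, x)) * (fderiv ℝ U₀ (t, x) (0, 1) / fderiv ℝ X (t, x) (0, 1)) = 0 := by
    intro t ht x hx
    obtain ⟨hT0, hX0, hU0, -⟩ := facts t ht x hx
    have hg := θ.g_ne_zero x hx
    have hX' := hmem t ht x hx
    obtain ⟨e1, e2, -, e4⟩ := exp_sub_exp_eq_affine h.value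
      (A := θ'.h (X (t, x)) * Real.exp (θ'.m * U₀ (t, x)))
      (C := θ'.g (X (t, x)) * U₁ (t, x) * θ.h x / (θ.g x * fderiv ℝ X (t, x) (0, 1) ^ 2))
      (α := θ'.m * U₁ (t, x)) (m := θ.m)
      (p := θ'.f (X (t, x)) * ((fderiv ℝ U₁ (t, x) (1, 0)
        - fderiv ℝ U₁ (t, x) (0, 1) / fderiv ℝ X (t, x) (0, 1) * fderiv ℝ X (t, x) (1, 0))
          / deriv T t)
      - θ'.g (X (t, x)) * ((fderiv ℝ (fun p => fderiv ℝ U₁ p (0, 1)) (t, x) (0, 1)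
          * fderiv ℝ X (t, x) (0, 1)
        - fderiv ℝ U₁ (t, x) (0, 1) * fderiv ℝ (fun p => fderiv ℝ X p (0, 1)) (t, x) (0, 1))
          / fderiv ℝ X (t, x) (0, 1) ^ 3)
      - deriv θ'.g (X (t, x)) * (fderiv ℝ U₁ (t, x) (0, 1) / fderiv ℝ X (t, x) (0, 1)))
      (q := θ'.f (X (t, x)) * ((fderiv ℝ U₀ (t, x) (1, 0)
        - fderiv ℝ U₀ (t, x) (0, 1) / fderiv ℝ X (t, x) (0, 1) * fderiv ℝ X (t, x) (1, 0))
          / deriv T t)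
      - θ'.g (X (t, x)) * ((fderiv ℝ (fun p => fderiv ℝ U₀ p (0, 1)) (t, x) (0, 1)
          * fderiv ℝ X (t, x) (0, 1)
        - fderiv ℝ U₀ (t, x) (0, 1) * fderiv ℝ (fun p => fderiv ℝ X p (0, 1)) (t, x) (0, 1))
          / fderiv ℝ X (t, x) (0, 1) ^ 3)
      - deriv θ'.g (X (t, x)) * (fderiv ℝ U₀ (t, x) (0, 1) / fderiv ℝ X (t, x) (0, 1)))
      (mul_ne_zero (θ'.h_ne_zero _ hX') (Real.exp_ne_zero _))
      (div_ne_zero (mul_ne_zero (mul_ne_zero (θ'.g_ne_zero _ hX') hU0) (θ.h_ne_zero x hx))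
        (mul_ne_zero hg (pow_ne_zero 2 hX0)))
      (mul_ne_zero θ'.m_ne_zero hU0) θ.m_ne_zero (by
        intro y hy
        have hz : ((t, x, y) : Pt) ∈ box J I K := ⟨ht, hx, hy⟩
        have key := (h.fderiv_value hz).2.2
        rw [pxx t ht x hx y hy, puxx t ht x hx y hy, pt t ht x hx y hy,
          px t ht x hx y hy, pu t ht x hx y hy, hΦ t ht x hx y hy] at key
        -- The exponential of m' U splits into an amplitude depending on (t, x) and a pure
        -- exponential of u.
        have hexp : Real.exp (θ'.m * (U₁ (t, x) * y + U₀ (t, x)))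
            = Real.exp (θ'.m * U₀ (t, x)) * Real.exp (θ'.m * U₁ (t, x) * y) := by
          rw [← Real.exp_add]; congr 1; ring
        dsimp only at key
        rw [hexp] at key
        have hC : θ'.g (X (t, x)) * U₁ (t, x) * θ.h x / (θ.g x * fderiv ℝ X (t, x) (0, 1) ^ 2)
            * Real.exp (θ.m * y) = θ'.g (X (t, x)) * (U₁ (t, x)
              * (θ.h x * Real.exp (θ.m * y) / θ.g x)) * fderiv ℝ X (t, x) (0, 1)
                / fderiv ℝ X (t, x) (0, 1) ^ 3 := by
          field_simp
        rw [hC]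
        linear_combination -key)
    exact ⟨e1, e2, e4⟩
  have hU₁c : ∀ t ∈ J, ∀ x ∈ I, U₁ (t, x) = θ.m / θ'.m := fun t ht x hx => by
    rw [eq_div_iff θ'.m_ne_zero, mul_comm]; exact (exps t ht x hx).1
  have hU₁0 : ∀ t ∈ J, ∀ x ∈ I, fderiv ℝ U₁ (t, x) (0, 1) = 0 := fun t ht x hx =>
    hasDerivAt_eq_zero_of_isOpen h.space.1 (fun s hs => hU₁c t ht s hs) hx (diff hU₁ t ht x hx).2
  refine ⟨T, X, U₀, hT, hX, hU₀, fun t ht x hx y hy => ?_, hmem, fun t ht => ?_,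
    fun t ht x hx => (facts t ht x hx).2.1, fun t ht x hx => (facts t ht x hx).2.2.2,
    fun t ht x hx => ?_, fun t ht x hx => ?_, fun t ht x hx => ?_⟩
  · rw [hΦ t ht x hx y hy, hU₁c t ht x hx]
  · obtain ⟨x, hx⟩ := h.space.2.2
    exact (facts t ht x hx).1
  · obtain ⟨y, hy⟩ := h.value.2.2
    have hz : ((t, x, y) : Pt) ∈ box J I K := ⟨ht, hx, hy⟩
    have key := (h.fderiv_value hz).2.1
    rw [pxx t ht x hx y hy, pux t ht x hx y hy, pt t ht x hx y hy,
      px t ht x hx y hy, pu t ht x hx y hy, hΦ t ht x hx y hy, hU₁0 t ht x hx] at key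
    refine mul_left_cancel₀ (facts t ht x hx).2.2.1 ?_
    dsimp only at key
    linear_combination key
  · obtain ⟨hT0, hX0, hU0, -⟩ := facts t ht x hx
    have := (exps t ht x hx).2.2
    field_simp at this
    linear_combination this
  · obtain ⟨hT0, hX0, hU0, -⟩ := facts t ht x hx
    have hg := θ.g_ne_zero x hx
    rw [(exps t ht x hx).2.1, hU₁c t ht x hx]
    field_simp

end IsAdmissible

theorem hasDerivAt_slices {J I : Set ℝ} (hJ : IsOpen J) (hI : IsOpen I) {f : ℝ × ℝ → ℝ}
    (hf : ContDiffOn ℝ ∞ f (J ×ˢ I)) {t x : ℝ} (ht : t ∈ J) (hx : x ∈ I) :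
    HasDerivAt (fun s => f (s, x)) (fderiv ℝ f (t, x) (1, 0)) t ∧
      HasDerivAt (fun s => f (t, s)) (fderiv ℝ f (t, x) (0, 1)) x := by
  have : DifferentiableAt ℝ f (t, x) :=
    (hf.contDiffAt ((hJ.prod hI).mem_nhds ⟨ht, hx⟩)).differentiableAt (by simp)
  exact ⟨hasDerivAt_slice_fst this, hasDerivAt_slice_snd this⟩

theorem hasDerivAt_of_contDiffOn {I : Set ℝ} (hI : IsOpen I) {f : ℝ → ℝ} (hf : ContDiffOn ℝ ∞ f I)
    {x : ℝ} (hx : x ∈ I) : HasDerivAt f (deriv f x) x :=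
  ((hf.contDiffAt (hI.mem_nhds hx)).differentiableAt (by simp)).hasDerivAt

theorem contDiffOn_deriv {I : Set ℝ} (hI : IsOpen I) {f : ℝ → ℝ} (hf : ContDiffOn ℝ ∞ f I) :
    ContDiffOn ℝ ∞ (deriv f) I := hf.deriv_of_isOpen hI (by simp)

namespace IsNormalForm

variable {J I K I' : Set ℝ} {θ : Coeff I} {θ' : Coeff I'} {Φ : Pt → Pt} {T : ℝ → ℝ}
  {X U₀ : ℝ × ℝ → ℝ}

/-- The velocity `X_t / X_x` of the change of the space variable. -/
theorem contDiffOn_velocity (hJ : IsOpen J) (hI : IsOpen I)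
    (h : IsNormalForm J I K I' θ θ' Φ T X U₀) :
    ContDiffOn ℝ ∞ (fun p => fderiv ℝ X p (1, 0) / fderiv ℝ X p (0, 1)) (J ×ˢ I) :=
  (contDiffOn_fderiv_apply (hJ.prod hI) h.smooth_X (1, 0)).div
    (contDiffOn_fderiv_apply (hJ.prod hI) h.smooth_X (0, 1)) fun p hp => h.deriv_X p.1 hp.1 p.2 hp.2

theorem fderiv_velocity (hJ : IsOpen J) (hI : IsOpen I)
    (h : IsNormalForm J I K I' θ θ' Φ T X U₀) {t x : ℝ} (ht : t ∈ J) (hx : x ∈ I) :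
    fderiv ℝ (fun p => fderiv ℝ X p (1, 0) / fderiv ℝ X p (0, 1)) (t, x) (0, 1)
      = (fderiv ℝ (fun p => fderiv ℝ X p (0, 1)) (t, x) (1, 0) * fderiv ℝ X (t, x) (0, 1)
        - fderiv ℝ X (t, x) (1, 0) * fderiv ℝ (fun p => fderiv ℝ X p (0, 1)) (t, x) (0, 1))
          / fderiv ℝ X (t, x) (0, 1) ^ 2 := by
  have hXt := contDiffOn_fderiv_apply (hJ.prod hI) h.smooth_X (1, 0)
  have hXx := contDiffOn_fderiv_apply (hJ.prod hI) h.smooth_X (0, 1)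
  have h1 := (hasDerivAt_slices hJ hI (h.contDiffOn_velocity hJ hI) ht hx).2
  have h2 := (hasDerivAt_slices hJ hI hXt ht hx).2.div (hasDerivAt_slices hJ hI hXx ht hx).2
    (h.deriv_X t ht x hx)
  rw [h1.unique h2, fderiv_fderiv_comm (h.smooth_X.contDiffAt ((hJ.prod hI).mem_nhds ⟨ht, hx⟩))
    (1, 0) (0, 1)]

/-- The operator X_x ∂_t - X_t ∂_x annihilates functions of X. Applied to f'(X) g X_x² = T_t g'(X) f
it removes the unknown derivatives of f' and g'; the values of f' and g' then cancel by the same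
relation. -/
theorem velocity_eq (hJ : IsOpen J) (hI : IsOpen I) (hI' : IsOpen I')
    (h : IsNormalForm J I K I' θ θ' Φ T X U₀) {t x : ℝ} (ht : t ∈ J) (hx : x ∈ I) :
    2 * fderiv ℝ (fun p => fderiv ℝ X p (1, 0) / fderiv ℝ X p (0, 1)) (t, x) (0, 1)
      + fderiv ℝ X (t, x) (1, 0) / fderiv ℝ X (t, x) (0, 1)
        * (deriv θ.f x / θ.f x - deriv θ.g x / θ.g x) = deriv (deriv T) t / deriv T t := by
  have hXx := contDiffOn_fderiv_apply (hJ.prod hI) h.smooth_X (0, 1)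
  have hX' := h.mem t ht x hx
  have sX := hasDerivAt_slices hJ hI h.smooth_X ht hx
  have sXx := hasDerivAt_slices hJ hI hXx ht hx
  have df := hasDerivAt_of_contDiffOn hI θ.f_smooth hx
  have dg := hasDerivAt_of_contDiffOn hI θ.g_smooth hx
  have df' := hasDerivAt_of_contDiffOn hI' θ'.f_smooth hX'
  have dg' := hasDerivAt_of_contDiffOn hI' θ'.g_smooth hX'
  have dT := hasDerivAt_of_contDiffOn hJ (contDiffOn_deriv hJ h.smooth_T) ht
  have e1 := hasDerivAt_eq_zero_of_isOpen hJ (c := 0)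
    (k := fun s => θ'.f (X (s, x)) * θ.g x * fderiv ℝ X (s, x) (0, 1) ^ 2
      - deriv T s * θ'.g (X (s, x)) * θ.f x)
    (fun s hs => sub_eq_zero.2 (h.eq_fg s hs x hx)) ht
    (((((df'.comp t sX.1).mul_const (θ.g x)).mul (sXx.1.pow 2))).sub
      ((dT.mul (dg'.comp t sX.1)).mul_const (θ.f x)))
  have e2 := hasDerivAt_eq_zero_of_isOpen hI (c := 0)
    (k := fun s => θ'.f (X (t, s)) * θ.g s * fderiv ℝ X (t, s) (0, 1) ^ 2
      - deriv T t * θ'.g (X (t, s)) * θ.f s)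
    (fun s hs => sub_eq_zero.2 (h.eq_fg t ht s hs)) hx
    (((((df'.comp x sX.2).mul dg).mul (sXx.2.pow 2))).sub
      (((dg'.comp x sX.2).const_mul (deriv T t)).mul df))
  have e0 := h.eq_fg t ht x hx
  rw [h.fderiv_velocity hJ hI ht hx]
  have hT0 := h.deriv_T t ht
  have hX0 := h.deriv_X t ht x hx
  have hf := θ.f_ne_zero x hx
  have hg := θ.g_ne_zero x hx
  have hg' := θ'.g_ne_zero _ hX'
  have hf' := θ'.f_ne_zero _ hX'
  simp only [Function.comp_apply, Nat.cast_ofNat, Nat.add_one_sub_one, pow_one, Pi.mul_apply,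
    Pi.pow_apply] at e1 e2
  generalize fderiv ℝ (fun p => fderiv ℝ X p (0, 1)) (t, x) (1, 0) = Xxt at *
  generalize fderiv ℝ (fun p => fderiv ℝ X p (0, 1)) (t, x) (0, 1) = Xxx at *
  generalize fderiv ℝ X (t, x) (0, 1) = Xx at *
  generalize fderiv ℝ X (t, x) (1, 0) = Xt at *
  generalize deriv (deriv T) t = T₂ at *
  generalize deriv T t = T₁ at *
  generalize deriv θ.f x = f₁ at *
  generalize deriv θ.g x = g₁ at *
  generalize deriv θ'.f (X (t, x)) = f₂ at *
  generalize deriv θ'.g (X (t, x)) = g₂ at *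
  generalize θ'.f (X (t, x)) = F at *
  generalize θ'.g (X (t, x)) = G at *
  generalize θ.f x = f at *
  generalize θ.g x = g at *
  -- This is the combination X_x ∂_t - X_t ∂_x of the relation between f' and g'.
  have e3 : 2 * F * g * Xx * (Xx * Xxt - Xt * Xxx) - F * g₁ * Xx ^ 2 * Xt
      = T₂ * G * f * Xx - T₁ * G * f₁ * Xt := by
    linear_combination Xx * e1 - Xt * e2
  field_simp
  refine mul_left_cancel₀ (mul_ne_zero hf' hX0) ?_
  linear_combination (T₁ * f) * e3 + (f₁ * T₁ * Xt - f * T₂ * Xx) * e0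

/-- Let ξ = X_t / X_x and τ = T_tt / T_t. By `velocity_eq`, ξ r is affine in y for each t. The
function L = log |g'(X) / (g X_x)| satisfies L_x = -(f / g) ξ, while L_t is an expression in ξ, τ
and θ. Equality of the mixed derivatives makes L_t(t₁, ·) a quadratic polynomial in y, and the
formula for L_t becomes the condition on f g. The affine factor α y + β is ξ r at t₁, which is
nonzero at x₁. -/
theorem exists_quadratic (hJ : IsOpenInterval J) (hI : IsOpenInterval I) (hI' : IsOpen I')
    (h : IsNormalForm J I K I' θ θ' Φ T X U₀) {t₁ x₁ : ℝ} (ht₁ : t₁ ∈ J) (hx₁ : x₁ ∈ I)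
    (hXt : fderiv ℝ X (t₁, x₁) (1, 0) ≠ 0) {y r : ℝ → ℝ} {ε : ℝ} (hε : ε ≠ 0)
    (hy : ∀ x ∈ I, HasDerivAt y (r x) x) (hr0 : ∀ x ∈ I, r x ≠ 0)
    (hr : ∀ x ∈ I, HasDerivAt r (r x * ((deriv θ.f x / θ.f x - deriv θ.g x / θ.g x) / 2)) x)
    (hr2 : ∀ x ∈ I, θ.f x / θ.g x = r x ^ 2 / ε) :
    ∃ α β q₀ q₁ q₂ : ℝ, (α ≠ 0 ∨ β ≠ 0) ∧ ∀ x ∈ I,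
      (α * y x + β) * ((deriv θ.f x / θ.f x + deriv θ.g x / θ.g x) / 2)
        = (q₀ + q₁ * y x + q₂ * y x ^ 2) * r x := by
  set ξ : ℝ × ℝ → ℝ := fun p => fderiv ℝ X p (1, 0) / fderiv ℝ X p (0, 1) with hξ
  set τ : ℝ → ℝ := fun t => deriv (deriv T) t / deriv T t with hτ
  have hξs : ContDiffOn ℝ ∞ ξ (J ×ˢ I) := h.contDiffOn_velocity hJ.1 hI.1
  have hT1 := contDiffOn_deriv hJ.1 h.smooth_T
  have hτs : ContDiffOn ℝ ∞ τ J := (contDiffOn_deriv hJ.1 hT1).div hT1 h.deriv_T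
  have hvel : ∀ t ∈ J, ∀ x ∈ I, 2 * fderiv ℝ ξ (t, x) (0, 1)
      + ξ (t, x) * (deriv θ.f x / θ.f x - deriv θ.g x / θ.g x) = τ t := fun t ht x hx =>
    h.velocity_eq hJ.1 hI.1 hI' ht hx
  have hXx := contDiffOn_fderiv_apply (hJ.1.prod hI.1) h.smooth_X (0, 1)
  -- The intercept of the affine function ξ r of y, read off at x₁; its slope is τ / 2.
  set β : ℝ → ℝ := fun t => ξ (t, x₁) * r x₁ - τ t * y x₁ / 2 with hβ
  have hlin : ∀ t ∈ J, ∀ x ∈ I, ξ (t, x) * r x = τ t * y x / 2 + β t := by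
    intro t ht x hx
    have := hI.eq_of_deriv_eq_zero (k := fun x => ξ (t, x) * r x - τ t * y x / 2)
      (fun x hx => by
        have h1 := ((hasDerivAt_slices hJ.1 hI.1 hξs ht hx).2.mul (hr x hx)).sub
          (((hy x hx).const_mul (τ t)).div_const 2)
        convert! h1 using 1
        linear_combination (-(r x) / 2) * hvel t ht x hx) hx hx₁
    simp only [hβ]
    linarith
  have hβd : HasDerivAt β (fderiv ℝ ξ (t₁, x₁) (1, 0) * r x₁ - deriv τ t₁ * y x₁ / 2) t₁ :=
    ((hasDerivAt_slices hJ.1 hI.1 hξs ht₁ hx₁).1.mul_const (r x₁)).sub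
      (((hasDerivAt_of_contDiffOn hJ.1 hτs ht₁).mul_const (y x₁)).div_const 2)
  set β₁ := fderiv ℝ ξ (t₁, x₁) (1, 0) * r x₁ - deriv τ t₁ * y x₁ / 2 with hβ₁
  have hξt : ∀ x ∈ I, fderiv ℝ ξ (t₁, x) (1, 0) * r x = deriv τ t₁ * y x / 2 + β₁ := by
    intro x hx
    have h1 := (hasDerivAt_slices hJ.1 hI.1 hξs ht₁ hx).1.mul_const (r x)
    have h2 := (((hasDerivAt_of_contDiffOn hJ.1 hτs ht₁).mul_const (y x)).div_const 2).add hβd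
    refine h1.unique (h2.congr_of_eventuallyEq ?_)
    filter_upwards [hJ.1.mem_nhds ht₁] with s hs using hlin s hs x hx
  -- `Real.log` is the logarithm of the absolute value, so no sign of g' / (g X_x) has to be fixed.
  set L : ℝ × ℝ → ℝ := fun p => Real.log (θ'.g (X p) / (θ.g p.2 * fderiv ℝ X p (0, 1))) with hL
  have hne : ∀ t ∈ J, ∀ x ∈ I, θ'.g (X (t, x)) / (θ.g x * fderiv ℝ X (t, x) (0, 1)) ≠ 0 :=
    fun t ht x hx => div_ne_zero (θ'.g_ne_zero _ (h.mem t ht x hx))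
      (mul_ne_zero (θ.g_ne_zero x hx) (h.deriv_X t ht x hx))
  have hLs : ContDiffOn ℝ ∞ L (J ×ˢ I) := by
    refine ContDiffOn.log (ContDiffOn.div (θ'.g_smooth.comp h.smooth_X
      fun p hp => h.mem p.1 hp.1 p.2 hp.2) ((θ.g_smooth.comp contDiffOn_snd
        fun p hp => hp.2).mul hXx) ?_) ?_
    · exact fun p hp => mul_ne_zero (θ.g_ne_zero _ hp.2) (h.deriv_X p.1 hp.1 p.2 hp.2)
    · exact fun p hp => hne p.1 hp.1 p.2 hp.2
  have hL1 : ∀ t ∈ J, ∀ x ∈ I, fderiv ℝ L (t, x) (0, 1) = - (θ.f x / θ.g x) * ξ (t, x) ∧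
      fderiv ℝ L (t, x) (1, 0) = ξ (t, x) * ((deriv θ.f x / θ.f x + deriv θ.g x / θ.g x) / 2)
        - ξ (t, x) ^ 2 * (θ.f x / θ.g x) - τ t / 2 := by
    intro t ht x hx
    have hX' := h.mem t ht x hx
    have sX := hasDerivAt_slices hJ.1 hI.1 h.smooth_X ht hx
    have sXx := hasDerivAt_slices hJ.1 hI.1 hXx ht hx
    have sL := hasDerivAt_slices hJ.1 hI.1 hLs ht hx
    have dg := hasDerivAt_of_contDiffOn hI.1 θ.g_smooth hx
    have dg' := hasDerivAt_of_contDiffOn hI' θ'.g_smooth hX'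
    have hX0 := h.deriv_X t ht x hx
    have hg := θ.g_ne_zero x hx
    have hgX := mul_ne_zero hg hX0
    have e1 := sL.2.unique (((dg'.comp x sX.2).div (dg.mul sXx.2) hgX).log (hne t ht x hx))
    have e2 := sL.1.unique (((dg'.comp t sX.1).div (sXx.1.const_mul (θ.g x)) hgX).log
      (hne t ht x hx))
    rw [e1, e2]
    have hv := hvel t ht x hx
    rw [h.fderiv_velocity hJ.1 hI.1 ht hx] at hv
    have hfg := h.eq_fg t ht x hx
    have heg := h.eq_g t ht x hx
    have hT0 := h.deriv_T t ht
    have hg' := θ'.g_ne_zero _ hX'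
    -- Eliminating f' from `eq_g` by `eq_fg` cancels T_t; divided by g' g X_x, this is L_x = -(f /
    -- g) ξ.
    have heg' : - (fderiv ℝ X (t, x) (1, 0)) * θ'.g (X (t, x)) * θ.f x =
      deriv θ'.g (X (t, x)) * fderiv ℝ X (t, x) (0, 1) ^ 2 * θ.g x
      - θ'.g (X (t, x)) * (deriv θ.g x * fderiv ℝ X (t, x) (0, 1)
        + θ.g x * fderiv ℝ (fun p => fderiv ℝ X p (0, 1)) (t, x) (0, 1)) := by
      refine mul_left_cancel₀ hT0 ?_
      linear_combination heg + fderiv ℝ X (t, x) (1, 0) * hfg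
    have hf := θ.f_ne_zero x hx
    simp only [Function.comp_apply, Pi.mul_apply, Pi.div_apply, hξ] at hv ⊢
    rw [show τ t / 2 = (2 * ((fderiv ℝ (fun p => fderiv ℝ X p (0, 1)) (t, x) (1, 0)
        * fderiv ℝ X (t, x) (0, 1) - fderiv ℝ X (t, x) (1, 0)
        * fderiv ℝ (fun p => fderiv ℝ X p (0, 1)) (t, x) (0, 1)) / fderiv ℝ X (t, x) (0, 1) ^ 2)
      + fderiv ℝ X (t, x) (1, 0) / fderiv ℝ X (t, x) (0, 1)
        * (deriv θ.f x / θ.f x - deriv θ.g x / θ.g x)) / 2 by rw [← hv]]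
    clear hv e1 e2
    generalize fderiv ℝ (fun p => fderiv ℝ X p (0, 1)) (t, x) (1, 0) = Xxt at *
    generalize fderiv ℝ (fun p => fderiv ℝ X p (0, 1)) (t, x) (0, 1) = Xxx at *
    generalize fderiv ℝ X (t, x) (0, 1) = Xx at *
    generalize fderiv ℝ X (t, x) (1, 0) = Xt at *
    generalize deriv θ'.g (X (t, x)) = g₂ at *
    generalize θ'.g (X (t, x)) = G at *
    constructor
    · field_simp
      linear_combination -heg'
    · field_simp
      linear_combination -2 * Xt * θ.f x * heg'
  have hLt := contDiffOn_fderiv_apply (hJ.1.prod hI.1) hLs (1, 0)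
  have hLx := contDiffOn_fderiv_apply (hJ.1.prod hI.1) hLs (0, 1)
  -- L_tx is computed as L_xt, from L_x = -(f / g) ξ and the affine form of ξ_t r; it is then
  -- integrated in x.
  have hLtx : ∀ x ∈ I, fderiv ℝ (fun p => fderiv ℝ L p (1, 0)) (t₁, x) (0, 1)
      = - (r x / ε) * (deriv τ t₁ * y x / 2 + β₁) := by
    intro x hx
    rw [fderiv_fderiv_comm (hLs.contDiffAt ((hJ.1.prod hI.1).mem_nhds ⟨ht₁, hx⟩)) (1, 0) (0, 1)]
    have h1 := (hasDerivAt_slices hJ.1 hI.1 hLx ht₁ hx).1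
    have h2 := (hasDerivAt_slices hJ.1 hI.1 hξs ht₁ hx).1.const_mul (- (θ.f x / θ.g x))
    have h3 := h1.unique (h2.congr_of_eventuallyEq (by
      filter_upwards [hJ.1.mem_nhds ht₁] with s hs using (hL1 s hs x hx).1))
    rw [h3, ← hξt x hx, hr2 x hx]
    ring
  set γ := fderiv ℝ L (t₁, x₁) (1, 0) + (deriv τ t₁ * y x₁ ^ 2 / 4 + β₁ * y x₁) / ε with hγ
  have hLq : ∀ x ∈ I, fderiv ℝ L (t₁, x) (1, 0)
      = γ - (deriv τ t₁ * y x ^ 2 / 4 + β₁ * y x) / ε := by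
    intro x hx
    have := hI.eq_of_deriv_eq_zero (k := fun x => fderiv ℝ L (t₁, x) (1, 0)
        + (deriv τ t₁ * y x ^ 2 / 4 + β₁ * y x) / ε) (fun x hx => by
      have h1 := (hasDerivAt_slices hJ.1 hI.1 hLt ht₁ hx).2.add ((((((hy x hx).pow 2).const_mul
        (deriv τ t₁)).div_const 4).add ((hy x hx).const_mul β₁)).div_const ε)
      convert! h1 using 1
      rw [hLtx x hx]
      simp
      field_simp
      ring) hx hx₁
    simp only [hγ]
    linarith
  -- The constants q₀, q₁, q₂ are the coefficients in y of L_t + (ξ r)² / ε + τ / 2, where (ξ r)² /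
  -- ε = ξ² f / g.
  refine ⟨τ t₁ / 2, β t₁, γ + τ t₁ / 2 + β t₁ ^ 2 / ε,
    (τ t₁ * β t₁ - β₁) / ε, (τ t₁ ^ 2 / 4 - deriv τ t₁ / 4) / ε, ?_, ?_⟩
  · by_contra! hcon
    have h1 := hlin t₁ ht₁ x₁ hx₁
    rw [show τ t₁ * y x₁ / 2 = τ t₁ / 2 * y x₁ by ring, hcon.1, hcon.2, zero_mul, zero_add] at h1
    exact mul_ne_zero (div_ne_zero hXt (h.deriv_X t₁ ht₁ x₁ hx₁)) (hr0 x₁ hx₁) h1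
  · intro x hx
    have h1 := (hL1 t₁ ht₁ x hx).2
    rw [hLq x hx, hr2 x hx] at h1
    have h2 := hlin t₁ ht₁ x hx
    have h3 : τ t₁ / 2 * y x + β t₁ = ξ (t₁, x) * r x := by rw [h2]; ring
    rw [h3]
    have h4 : ξ (t₁, x) * ((deriv θ.f x / θ.f x + deriv θ.g x / θ.g x) / 2)
      = γ - (deriv τ t₁ * y x ^ 2 / 4 + β₁ * y x) / ε + (τ t₁ * y x / 2 + β t₁) ^ 2 / ε
        + τ t₁ / 2 := by
      rw [← h2]; linear_combination -h1
    linear_combination r x * h4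

end IsNormalForm

/-! ### The natural coordinate, and perturbation away from the exceptional elements. -/

/-- By the intermediate value theorem f keeps its sign on I, so one of its values can serve as the
sign factor ε. -/
theorem IsOpenInterval.exists_sign {I : Set ℝ} (hI : IsOpenInterval I) {f : ℝ → ℝ}
    (hf : ContinuousOn f I) (hf0 : ∀ x ∈ I, f x ≠ 0) :
    ∃ ε : ℝ, ε ≠ 0 ∧ ∀ x ∈ I, 0 < ε * f x := by
  obtain ⟨x₀, hx₀⟩ := hI.2.2
  refine ⟨f x₀, hf0 x₀ hx₀, fun x hx => ?_⟩
  by_contra hneg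
  have hc : ContinuousOn (fun x => f x₀ * f x) I := continuousOn_const.mul hf
  obtain ⟨z, hz, hz0⟩ := hI.2.1.isPreconnected.intermediate_value hx hx₀ hc
    ⟨not_lt.1 hneg, mul_self_nonneg (f x₀)⟩
  exact mul_ne_zero (hf0 x₀ hx₀) (hf0 z hz) hz0

theorem IsOpenInterval.hasDerivAt_primitive {I : Set ℝ} (hI : IsOpenInterval I) {k : ℝ → ℝ}
    (hk : ContinuousOn k I) {x₀ x : ℝ} (hx₀ : x₀ ∈ I) (hx : x ∈ I) :
    HasDerivAt (fun x => ∫ y in x₀..x, k y) (k x) x := by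
  refine intervalIntegral.integral_hasDerivAt_right ?_ ?_ (hk.continuousAt (hI.1.mem_nhds hx))
  · exact (hk.mono (hI.2.1.uIcc_subset hx₀ hx)).intervalIntegrable
  · exact hk.stronglyMeasurableAtFilter hI.1 x hx

theorem contDiffOn_of_hasDerivAt {I : Set ℝ} (hI : IsOpen I) {y r : ℝ → ℝ}
    (hy : ∀ x ∈ I, HasDerivAt y (r x) x) (hr : ContDiffOn ℝ ∞ r I) : ContDiffOn ℝ ∞ y I :=
  (contDiffOn_infty_iff_deriv_of_isOpen hI).2
    ⟨fun x hx => (hy x hx).differentiableAt.differentiableWithinAt,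
      hr.congr fun x hx => (hy x hx).deriv⟩

theorem IsOpenInterval.injOn_of_deriv_ne_zero {I : Set ℝ} (hI : IsOpenInterval I) {y r : ℝ → ℝ}
    (hy : ∀ x ∈ I, HasDerivAt y (r x) x) (hr : ∀ x ∈ I, r x ≠ 0) : Set.InjOn y I := by
  have key : ∀ a ∈ I, ∀ b ∈ I, a < b → y a ≠ y b := by
    intro a ha b hb hab heq
    have hsub : Set.Icc a b ⊆ I := hI.2.1.out ha hb
    obtain ⟨c, hc, hc0⟩ := exists_hasDerivAt_eq_zero hab
      (fun x hx => (hy x (hsub hx)).continuousAt.continuousWithinAt) heq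
      (fun x hx => hy x (hsub (Set.Ioo_subset_Icc_self hx)))
    exact hr c (hsub (Set.Ioo_subset_Icc_self hc)) hc0
  intro a ha b hb heq
  rcases lt_trichotomy a b with h | h | h
  · exact absurd heq (key a ha b hb h)
  · exact h
  · exact absurd heq.symm (key b hb a ha h)

theorem IsOpenInterval.infinite {I : Set ℝ} (hI : IsOpenInterval I) : I.Infinite := by
  obtain ⟨x, hx⟩ := hI.2.2
  exact infinite_of_mem_nhds x (hI.1.mem_nhds hx)

/-- A variable with polynomial coefficients on an infinite set: a perturbation by `y⁴` is not
compatible with quadratic right-hand sides. -/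
theorem quadratic_perturbation {S : Set ℝ} (hS : S.Infinite) {s α β q₀ q₁ q₂ α' β' q₀' q₁' q₂' : ℝ}
    (hs : s ≠ 0) (hl : α ≠ 0 ∨ β ≠ 0) (hl' : α' ≠ 0 ∨ β' ≠ 0)
    (h : ∀ y ∈ S, (α' * y + β') * (q₀ + q₁ * y + q₂ * y ^ 2)
      + s * y ^ 4 * (α * y + β) * (α' * y + β') = (α * y + β) * (q₀' + q₁' * y + q₂' * y ^ 2)) :
    False := by
  open Polynomial in
  set p : ℝ[X] := C (s * α * α') * X ^ 6 + C (s * (α * β' + β * α')) * X ^ 5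
    + C (s * β * β') * X ^ 4 + C (α' * q₂ - α * q₂') * X ^ 3
    + C (α' * q₁ + β' * q₂ - α * q₁' - β * q₂') * X ^ 2
    + C (α' * q₀ + β' * q₁ - α * q₀' - β * q₁') * X + C (β' * q₀ - β * q₀') with hp
  have hp0 : p = 0 := by
    refine Polynomial.eq_zero_of_infinite_isRoot p (hS.mono fun y hy => ?_)
    simp only [Set.mem_ofPred_eq, Polynomial.IsRoot, hp, Polynomial.eval_add, Polynomial.eval_mul,
      Polynomial.eval_C, Polynomial.eval_pow, Polynomial.eval_X]
    linear_combination h y hy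
  -- All other terms have degree at most 3, so the degrees 6, 5, 4 see only s y⁴ (α y + β) (α' y +
  -- β'). Their vanishing says that the product of the two nonzero affine functions is zero.
  have c6 : p.coeff 6 = s * α * α' := by
    simp only [hp, Polynomial.coeff_add, Polynomial.coeff_C_mul, Polynomial.coeff_X_pow,
      Polynomial.coeff_X, Polynomial.coeff_C]
    norm_num
  have c5 : p.coeff 5 = s * (α * β' + β * α') := by
    simp only [hp, Polynomial.coeff_add, Polynomial.coeff_C_mul, Polynomial.coeff_X_pow,
      Polynomial.coeff_X, Polynomial.coeff_C]
    norm_num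
  have c4 : p.coeff 4 = s * β * β' := by
    simp only [hp, Polynomial.coeff_add, Polynomial.coeff_C_mul, Polynomial.coeff_X_pow,
      Polynomial.coeff_X, Polynomial.coeff_C]
    norm_num
  rw [hp0, Polynomial.coeff_zero] at c6 c5 c4
  have d6 : α = 0 ∨ α' = 0 := by simpa [hs] using c6.symm
  have d4 : β = 0 ∨ β' = 0 := by simpa [hs] using c4.symm
  have d5 : α * β' + β * α' = 0 := by simpa [hs] using c5.symm
  rcases d6 with h6 | h6
  · have hβ : β ≠ 0 := hl.resolve_left (not_not.2 h6)
    have hβ' : β' = 0 := d4.resolve_left hβ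
    have hα' : α' ≠ 0 := hl'.resolve_right (not_not.2 hβ')
    rw [h6, zero_mul, zero_add] at d5
    exact mul_ne_zero hβ hα' d5
  · have hβ' : β' ≠ 0 := hl'.resolve_left (not_not.2 h6)
    have hβ : β = 0 := d4.resolve_right hβ'
    have hα : α ≠ 0 := hl.resolve_right (not_not.2 hβ)
    rw [h6, mul_zero, add_zero] at d5
    exact mul_ne_zero hα hβ' d5

/-- The natural space coordinate `y`, in which the equation has `|f| = |g|`. -/
theorem Coeff.exists_coordinate {I : Set ℝ} (hI : IsOpenInterval I) (θ : Coeff I) :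
    ∃ (y r : ℝ → ℝ) (ε : ℝ), ε ≠ 0 ∧ ContDiffOn ℝ ∞ y I ∧ (∀ x ∈ I, HasDerivAt y (r x) x) ∧
      (∀ x ∈ I, r x ≠ 0) ∧
      (∀ x ∈ I, HasDerivAt r (r x * ((deriv θ.f x / θ.f x - deriv θ.g x / θ.g x) / 2)) x) ∧
      ∀ x ∈ I, θ.f x / θ.g x = r x ^ 2 / ε := by
  have hq : ContDiffOn ℝ ∞ (fun x => θ.f x / θ.g x) I := θ.f_smooth.div θ.g_smooth θ.g_ne_zero
  obtain ⟨ε, hε, hpos⟩ := hI.exists_sign hq.continuousOn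
    fun x hx => div_ne_zero (θ.f_ne_zero x hx) (θ.g_ne_zero x hx)
  -- The factor ε makes f / g positive. A square root halves the logarithmic derivative, which gives
  -- the required equation for r.
  set r : ℝ → ℝ := fun x => Real.sqrt (ε * (θ.f x / θ.g x)) with hr
  have hrs : ContDiffOn ℝ ∞ r I := (contDiffOn_const.mul hq).sqrt fun x hx => (hpos x hx).ne'
  obtain ⟨x₀, hx₀⟩ := hI.2.2
  have hy : ∀ x ∈ I, HasDerivAt (fun x => ∫ s in x₀..x, r s) (r x) x := fun x hx =>
    hI.hasDerivAt_primitive hrs.continuousOn hx₀ hx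
  have hr0 : ∀ x ∈ I, r x ≠ 0 := fun x hx => (Real.sqrt_pos.2 (hpos x hx)).ne'
  have hr2 : ∀ x ∈ I, r x ^ 2 = ε * (θ.f x / θ.g x) := fun x hx => Real.sq_sqrt (hpos x hx).le
  refine ⟨_, r, ε, hε, contDiffOn_of_hasDerivAt hI.1 hy hrs, hy, hr0, fun x hx => ?_,
    fun x hx => by rw [hr2 x hx]; field_simp⟩
  have df := hasDerivAt_of_contDiffOn hI.1 θ.f_smooth hx
  have dg := hasDerivAt_of_contDiffOn hI.1 θ.g_smooth hx
  have hf := θ.f_ne_zero x hx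
  have hg := θ.g_ne_zero x hx
  have h1 := ((df.div dg hg).const_mul ε).sqrt (hpos x hx).ne'
  convert! h1 using 1
  have h2 := hr2 x hx
  change _ = _ / (2 * r x)
  rw [eq_div_iff (mul_ne_zero two_ne_zero (hr0 x hx))]
  calc _ = r x ^ 2 * (deriv θ.f x / θ.f x - deriv θ.g x / θ.g x) := by ring
    _ = _ := by rw [h2]; field_simp

/-- The arbitrary elements with `f` and `g` multiplied by `exp (s k)`. -/
noncomputable def Coeff.mulExp {I : Set ℝ} (θ : Coeff I) {k : ℝ → ℝ} (hk : ContDiffOn ℝ ∞ k I)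
    (s : ℝ) : Coeff I where
  f x := θ.f x * Real.exp (s * k x)
  g x := θ.g x * Real.exp (s * k x)
  h := θ.h
  m := θ.m
  f_smooth := θ.f_smooth.mul (contDiffOn_const.mul hk).exp
  g_smooth := θ.g_smooth.mul (contDiffOn_const.mul hk).exp
  h_smooth := θ.h_smooth
  f_ne_zero x hx := mul_ne_zero (θ.f_ne_zero x hx) (Real.exp_ne_zero _)
  g_ne_zero x hx := mul_ne_zero (θ.g_ne_zero x hx) (Real.exp_ne_zero _)
  h_ne_zero := θ.h_ne_zero
  m_ne_zero := θ.m_ne_zero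
  f_off x hx := by rw [θ.f_off x hx, zero_mul]
  g_off x hx := by rw [θ.g_off x hx, zero_mul]
  h_off := θ.h_off

theorem Coeff.smoothCurve_mulExp {I : Set ℝ} (θ : Coeff I) {k : ℝ → ℝ} (hk : ContDiffOn ℝ ∞ k I) :
    SmoothCurve (θ.mulExp hk) := by
  have hsnd : ∀ {f : ℝ → ℝ}, ContDiffOn ℝ ∞ f I →
      ContDiffOn ℝ ∞ (fun p : ℝ × ℝ => f p.2) (Set.univ ×ˢ I) := fun hf =>
    hf.comp contDiffOn_snd fun p hp => hp.2
  have hexp : ContDiffOn ℝ ∞ (fun p : ℝ × ℝ => Real.exp (p.1 * k p.2)) (Set.univ ×ˢ I) :=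
    (contDiffOn_fst.mul (hsnd hk)).exp
  exact ⟨(hsnd θ.f_smooth).mul hexp, (hsnd θ.g_smooth).mul hexp, hsnd θ.h_smooth, contDiff_const⟩

theorem Coeff.mulExp_zero {I : Set ℝ} (θ : Coeff I) {k : ℝ → ℝ} (hk : ContDiffOn ℝ ∞ k I) :
    θ.mulExp hk 0 = θ := by
  ext <;> simp [Coeff.mulExp]

theorem Coeff.logDeriv_mulExp {I : Set ℝ} (hI : IsOpen I) (θ : Coeff I) {k : ℝ → ℝ}
    (hk : ContDiffOn ℝ ∞ k I) (s : ℝ) {x : ℝ} (hx : x ∈ I) :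
    deriv (θ.mulExp hk s).f x / (θ.mulExp hk s).f x = deriv θ.f x / θ.f x + s * deriv k x ∧
      deriv (θ.mulExp hk s).g x / (θ.mulExp hk s).g x = deriv θ.g x / θ.g x + s * deriv k x := by
  have he := ((hasDerivAt_of_contDiffOn hI hk hx).const_mul s).exp
  have h0 := Real.exp_ne_zero (s * k x)
  have hf := θ.f_ne_zero x hx
  have hg := θ.g_ne_zero x hx
  have h1 : HasDerivAt (θ.mulExp hk s).f _ x :=
    (hasDerivAt_of_contDiffOn hI θ.f_smooth hx).mul he
  have h2 : HasDerivAt (θ.mulExp hk s).g _ x :=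
    (hasDerivAt_of_contDiffOn hI θ.g_smooth hx).mul he
  rw [h1.deriv, h2.deriv]
  simp only [Coeff.mulExp]
  constructor <;> field_simp

theorem smoothCurve_const {I : Set ℝ} (θ : Coeff I) : SmoothCurve fun _ : ℝ => θ :=
  ⟨θ.f_smooth.comp contDiffOn_snd fun _ hp => hp.2,
    θ.g_smooth.comp contDiffOn_snd fun _ hp => hp.2,
    θ.h_smooth.comp contDiffOn_snd fun _ hp => hp.2, contDiff_const⟩

namespace Transformation

variable {J I K I' : Set ℝ}

theorem contDiffOn_point (T : Transformation J I K I') (θ : Coeff I) :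
    ContDiffOn ℝ ∞ (T.point θ) (box J I K) :=
  (T.point_smooth _ (smoothCurve_const θ)).comp (f := fun z : Pt => ((0 : ℝ), z)) (by fun_prop)
    fun _ hz => ⟨trivial, hz⟩

theorem mapsTo_range (T : Transformation J I K I') (θ : Coeff I) :
    ∀ z ∈ box J I K, (T.point θ z).2.1 ∈ I' := fun z hz =>
  (T.range_x θ).le ⟨z, hz, rfl⟩

theorem IsEquivalence.isAdmissible {T : Transformation J I K I'} (hT : T.IsEquivalence)
    (hJ : IsOpenInterval J) (hI : IsOpenInterval I) (hK : IsOpenInterval K)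
    (hI' : IsOpenInterval I') (θ : Coeff I) : IsAdmissible J I K I' θ (T.coeff θ) (T.point θ) :=
  ⟨hJ, hI, hK, hI', T.contDiffOn_point θ, T.nondegenerate θ, T.mapsTo_range θ, hT θ⟩

/-- The new space variable of an equivalence transformation does not depend on time. For special
arbitrary elements this uses the smooth dependence on the arbitrary elements. -/
theorem IsEquivalence.space_eq {T : Transformation J I K I'} (hT : T.IsEquivalence)
    (hJ : IsOpenInterval J) (hI : IsOpenInterval I) (hK : IsOpenInterval K)
    (hI' : IsOpenInterval I') (θ : Coeff I) {t t' x u : ℝ} (ht : t ∈ J) (ht' : t' ∈ J)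
    (hx : x ∈ I) (hu : u ∈ K) : (T.point θ (t, x, u)).2.1 = (T.point θ (t', x, u)).2.1 := by
  obtain ⟨y, r, ε, hε, hys, hy, hr0, hr, hr2⟩ := θ.exists_coordinate hI
  -- At the given x, either X_t vanishes at all times and X takes equal values at t and t', or X_t ≠
  -- 0 at some time and θ is exceptional.
  have alt : ∀ θ : Coeff I, (T.point θ (t, x, u)).2.1 = (T.point θ (t', x, u)).2.1 ∨
      ∃ (T₀ : ℝ → ℝ) (X U₀ : ℝ × ℝ → ℝ) (t₁ : ℝ),
        IsNormalForm J I K I' θ (T.coeff θ) (T.point θ) T₀ X U₀ ∧ t₁ ∈ J ∧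
          fderiv ℝ X (t₁, x) (1, 0) ≠ 0 := by
    intro θ
    obtain ⟨T₀, X, U₀, h⟩ := (hT.isAdmissible hJ hI hK hI' θ).exists_normalForm
    by_cases hX : ∀ t₁ ∈ J, fderiv ℝ X (t₁, x) (1, 0) = 0
    · left
      rw [h.eq t ht x hx u hu, h.eq t' ht' x hx u hu]
      exact hJ.eq_of_deriv_eq_zero (k := fun s => X (s, x)) (fun s hs => by
        rw [← hX s hs]; exact (hasDerivAt_slices hJ.1 hI.1 h.smooth_X hs hx).1) ht ht'
    · push Not at hX
      obtain ⟨t₁, ht₁, h1⟩ := hX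
      exact Or.inr ⟨T₀, X, U₀, t₁, h, ht₁, h1⟩
  rcases alt θ with h0 | ⟨T₀, X, U₀, t₁, h, ht₁, hXt⟩
  · exact h0
  obtain ⟨α, β, q₀, q₁, q₂, hl, hq⟩ := h.exists_quadratic hJ hI hI'.1 ht₁ hx hXt hε hy hr0 hr hr2
  -- Multiplying f and g by exp(s y⁵) leaves f / g, hence y, r and ε, unchanged and adds 5 s y⁴ r to
  -- half the logarithmic derivative of f g. The fourth power puts even its lowest contribution
  -- beyond degree three.
  have hk : ContDiffOn ℝ ∞ (fun x => y x ^ 5) I := hys.pow 5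
  have hdk : ∀ x ∈ I, deriv (fun x => y x ^ 5) x = 5 * y x ^ 4 * r x := fun x hx => by
    have h5 : HasDerivAt (fun x => y x ^ 5) _ x := (hy x hx).pow 5
    rw [h5.deriv]; norm_num
  have hne : ∀ s : ℝ, s ≠ 0 → (T.point (θ.mulExp hk s) (t, x, u)).2.1
      = (T.point (θ.mulExp hk s) (t', x, u)).2.1 := by
    intro s hs
    rcases alt (θ.mulExp hk s) with h0 | ⟨T₀', X', U₀', t₂, h', ht₂, hXt'⟩
    · exact h0
    exfalso
    obtain ⟨α', β', q₀', q₁', q₂', hl', hq'⟩ := h'.exists_quadratic hJ hI hI'.1 ht₂ hx hXt' hε hy hr0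
      (fun x hx => by
        have hld := θ.logDeriv_mulExp hI.1 hk s hx
        rw [hld.1, hld.2]
        convert! hr x hx using 1
        ring)
      (fun x hx => by
        rw [← hr2 x hx]
        exact mul_div_mul_right _ _ (Real.exp_ne_zero _))
    have hinf : (y '' I).Infinite := hI.infinite.image (hI.injOn_of_deriv_ne_zero hy hr0)
    refine quadratic_perturbation hinf (s := 5 * s) (mul_ne_zero (by norm_num) hs) hl hl' ?_
      (q₀ := q₀) (q₁ := q₁) (q₂ := q₂) (q₀' := q₀') (q₁' := q₁') (q₂' := q₂')
    rintro _ ⟨x, hx, rfl⟩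
    have e1 := hq x hx
    have e2 := hq' x hx
    have hld := θ.logDeriv_mulExp hI.1 hk s hx
    rw [hld.1, hld.2, hdk x hx] at e2
    refine mul_right_cancel₀ (hr0 x hx) ?_
    linear_combination (α * y x + β) * e2 - (α' * y x + β') * e1
  -- The equality for all s ≠ 0 is carried to s = 0 by continuity. This is where smooth dependence
  -- on the arbitrary elements is indispensable.
  have hc : ∀ t ∈ J, ContinuousAt (fun s => (T.point (θ.mulExp hk s) (t, x, u)).2.1) 0 := by
    intro t ht
    have hopen : IsOpen ((Set.univ : Set ℝ) ×ˢ box J I K) :=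
      isOpen_univ.prod (isOpen_box hJ.1 hI.1 hK.1)
    have h1 := ((T.point_smooth _ (θ.smoothCurve_mulExp hk)).contDiffAt
      (hopen.mem_nhds (x := ((0 : ℝ), (t, x, u))) ⟨trivial, ht, hx, hu⟩)).continuousAt
    exact (ContinuousAt.comp (f := fun s : ℝ => (s, ((t, x, u) : Pt)))
      (g := fun q : ℝ × Pt => T.point (θ.mulExp hk q.1) q.2) h1 (by fun_prop)).snd.fst
  have hlim : (fun s => (T.point (θ.mulExp hk s) (t, x, u)).2.1) =ᶠ[𝓝[≠] 0]
      fun s => (T.point (θ.mulExp hk s) (t', x, u)).2.1 := by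
    filter_upwards [self_mem_nhdsWithin] with s hs using hne s hs
  have hlim' := tendsto_nhds_unique (((hc t ht).mono_left nhdsWithin_le_nhds).congr' hlim)
    ((hc t' ht').mono_left nhdsWithin_le_nhds)
  simpa only [θ.mulExp_zero hk] using hlim'

end Transformation

/-! ### From the normal form to the stated form, and back. -/

theorem Coeff.hasDerivAt_intInvG {I : Set ℝ} (hI : IsOpenInterval I) (θ : Coeff I) {x₀ x : ℝ}
    (hx₀ : x₀ ∈ I) (hx : x ∈ I) : HasDerivAt (θ.intInvG x₀) (1 / θ.g x) x :=
  hI.hasDerivAt_primitive (k := fun y => 1 / θ.g y)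
    (continuousOn_const.div θ.g_smooth.continuousOn θ.g_ne_zero) hx₀ hx

namespace Transformation

variable {J I K I' : Set ℝ}

/-- Once X = φ(x), `eq_fg` makes T_t constant in t, `eq_g` says that g'(φ) / (φ_x g) is constant in
x, `eq_h` makes U₀ independent of t, and `eq_U` becomes (g ψ_x)_x = 0. The formulas for f' and h'
are then `eq_fg` and `eq_h` again. -/
theorem IsEquivalence.exists_hasForm {T : Transformation J I K I'} (hT : T.IsEquivalence)
    (hJ : IsOpenInterval J) (hI : IsOpenInterval I) (hK : IsOpenInterval K)
    (hI' : IsOpenInterval I') (θ : Coeff I) {x₀ : ℝ} (hx₀ : x₀ ∈ I) :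
    ∃ (δ₀ δ₁ δ₂ δ₃ δ₄ δ₅ : ℝ) (φ : ℝ → ℝ), δ₀ * δ₁ * δ₃ ≠ 0 ∧ IsChangeOfVariable I I' φ ∧
      T.HasForm θ δ₀ δ₁ δ₂ δ₃ δ₄ δ₅ φ (θ.intInvG x₀) := by
  obtain ⟨T₀, X, U₀, h⟩ := (hT.isAdmissible hJ hI hK hI' θ).exists_normalForm
  obtain ⟨t₀, ht₀⟩ := hJ.2.2
  obtain ⟨u₀, hu₀⟩ := hK.2.2
  set θ' := T.coeff θ with hθ'
  set φ : ℝ → ℝ := fun x => X (t₀, x) with hφ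
  have hXφ : ∀ t ∈ J, ∀ x ∈ I, X (t, x) = φ x := by
    intro t ht x hx
    have := hT.space_eq hJ hI hK hI' θ ht ht₀ hx hu₀
    rwa [h.eq t ht x hx u₀ hu₀, h.eq t₀ ht₀ x hx u₀ hu₀] at this
  have hφs : ContDiffOn ℝ ∞ φ I :=
    h.smooth_X.comp (f := fun x : ℝ => (t₀, x)) (by fun_prop) fun x hx => ⟨ht₀, hx⟩
  have hφ'I : ∀ x ∈ I, φ x ∈ I' := fun x hx => h.mem t₀ ht₀ x hx
  have dφ : ∀ x ∈ I, HasDerivAt φ (deriv φ x) x := fun x hx => hasDerivAt_of_contDiffOn hI.1 hφs hx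
  have dφ' : ∀ x ∈ I, HasDerivAt (deriv φ) (deriv (deriv φ) x) x := fun x hx =>
    hasDerivAt_of_contDiffOn hI.1 (contDiffOn_deriv hI.1 hφs) hx
  have hXt : ∀ t ∈ J, ∀ x ∈ I, fderiv ℝ X (t, x) (1, 0) = 0 := fun t ht x hx =>
    hasDerivAt_eq_zero_of_isOpen hJ.1 (fun s hs => hXφ s hs x hx) ht
      (hasDerivAt_slices hJ.1 hI.1 h.smooth_X ht hx).1
  have hXx : ∀ t ∈ J, ∀ x ∈ I, fderiv ℝ X (t, x) (0, 1) = deriv φ x := by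
    intro t ht x hx
    refine (hasDerivAt_slices hJ.1 hI.1 h.smooth_X ht hx).2.unique
      ((dφ x hx).congr_of_eventuallyEq ?_)
    filter_upwards [hI.1.mem_nhds hx] with s hs using hXφ t ht s hs
  have hXxx : fderiv ℝ (fun p => fderiv ℝ X p (0, 1)) (t₀, x₀) (0, 1) = deriv (deriv φ) x₀ ∧
      ∀ x ∈ I, fderiv ℝ (fun p => fderiv ℝ X p (0, 1)) (t₀, x) (0, 1) = deriv (deriv φ) x := by
    have : ∀ x ∈ I, fderiv ℝ (fun p => fderiv ℝ X p (0, 1)) (t₀, x) (0, 1)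
        = deriv (deriv φ) x := by
      intro x hx
      refine (hasDerivAt_slices hJ.1 hI.1 (contDiffOn_fderiv_apply (hJ.1.prod hI.1) h.smooth_X
        (0, 1)) ht₀ hx).2.unique ((dφ' x hx).congr_of_eventuallyEq ?_)
      filter_upwards [hI.1.mem_nhds hx] with s hs using hXx t₀ ht₀ s hs
    exact ⟨this x₀ hx₀, this⟩
  have hφ0 : ∀ x ∈ I, deriv φ x ≠ 0 := fun x hx => by
    rw [← hXx t₀ ht₀ x hx]; exact h.deriv_X t₀ ht₀ x hx
  have hg'φ : ∀ x ∈ I, θ'.g (φ x) ≠ 0 := fun x hx => θ'.g_ne_zero _ (hφ'I x hx)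
  have dg : ∀ x ∈ I, HasDerivAt θ.g (deriv θ.g x) x := fun x hx =>
    hasDerivAt_of_contDiffOn hI.1 θ.g_smooth hx
  have dg' : ∀ x ∈ I, HasDerivAt θ'.g (deriv θ'.g (φ x)) (φ x) := fun x hx =>
    hasDerivAt_of_contDiffOn hI'.1 θ'.g_smooth (hφ'I x hx)
  set δ₁ := deriv T₀ t₀ with hδ₁
  have hδ₁0 : δ₁ ≠ 0 := h.deriv_T t₀ ht₀
  have hfg : ∀ x ∈ I, θ'.f (φ x) * θ.g x * deriv φ x ^ 2 = δ₁ * θ'.g (φ x) * θ.f x := by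
    intro x hx
    have := h.eq_fg t₀ ht₀ x hx
    rwa [hXx t₀ ht₀ x hx] at this
  have hT1 : ∀ t ∈ J, deriv T₀ t = δ₁ := by
    intro t ht
    have h1 := h.eq_fg t ht x₀ hx₀
    rw [hXx t ht x₀ hx₀, hXφ t ht x₀ hx₀, hfg x₀ hx₀] at h1
    refine mul_right_cancel₀ (mul_ne_zero (hg'φ x₀ hx₀) (θ.f_ne_zero x₀ hx₀)) ?_
    linear_combination -h1
  have hT2 : ∀ t ∈ J, T₀ t = δ₁ * t + (T₀ t₀ - δ₁ * t₀) := by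
    intro t ht
    have := hJ.eq_of_deriv_eq_zero (k := fun t => T₀ t - δ₁ * t) (fun t ht => by
      have h1 := (hasDerivAt_of_contDiffOn hJ.1 h.smooth_T ht).sub
        ((hasDerivAt_id t).const_mul δ₁)
      rw [hT1 t ht, mul_one, sub_self] at h1
      exact h1) ht ht₀
    linarith
  have hB : ∀ x ∈ I, deriv θ'.g (φ x) * deriv φ x ^ 2 * θ.g x
      = θ'.g (φ x) * (deriv θ.g x * deriv φ x + θ.g x * deriv (deriv φ) x) := by
    intro x hx
    have h1 := h.eq_g t₀ ht₀ x hx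
    rw [hXt t₀ ht₀ x hx, hXx t₀ ht₀ x hx, hXxx.2 x hx] at h1
    refine mul_left_cancel₀ hδ₁0 ?_
    linear_combination -h1
  set δ₀ := θ'.g (φ x₀) / (deriv φ x₀ * θ.g x₀) with hδ₀
  have hδ₀0 : δ₀ ≠ 0 := div_ne_zero (hg'φ x₀ hx₀) (mul_ne_zero (hφ0 x₀ hx₀) (θ.g_ne_zero x₀ hx₀))
  have hg : ∀ x ∈ I, θ'.g (φ x) = δ₀ * deriv φ x * θ.g x := by
    intro x hx
    have h1 : θ'.g (φ x) / (deriv φ x * θ.g x) = δ₀ :=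
      hI.eq_of_deriv_eq_zero (k := fun x => θ'.g (φ x) / (deriv φ x * θ.g x)) (fun x hx => by
        have h2 := ((dg' x hx).comp x (dφ x hx)).div ((dφ' x hx).mul (dg x hx))
          (mul_ne_zero (hφ0 x hx) (θ.g_ne_zero x hx))
        convert! h2 using 1
        symm
        rw [div_eq_zero_iff]
        left
        simp only [Function.comp_apply, Pi.mul_apply]
        linear_combination hB x hx) hx hx₀
    rw [← h1]
    have := hφ0 x hx
    have := θ.g_ne_zero x hx
    field_simp
  set ψ : ℝ → ℝ := fun x => U₀ (t₀, x) with hψ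
  have hm' := θ'.m_ne_zero
  set δ₃ := θ.m / θ'.m with hδ₃
  have hδ₃0 : δ₃ ≠ 0 := div_ne_zero θ.m_ne_zero hm'
  have hUψ : ∀ t ∈ J, ∀ x ∈ I, U₀ (t, x) = ψ x := by
    intro t ht x hx
    have h1 := h.eq_h t ht x hx
    have h2 := h.eq_h t₀ ht₀ x hx
    rw [hXx t ht x hx, hXφ t ht x hx] at h1
    rw [hXx t₀ ht₀ x hx] at h2
    -- In `eq_h` only the exponential could depend on t, so comparing two times gives equal
    -- exponentials.
    have h3 : Real.exp (θ'.m * U₀ (t, x)) = Real.exp (θ'.m * ψ x) := by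
      have hne : θ'.h (φ x) * deriv φ x ^ 2 * θ.g x ≠ 0 :=
        mul_ne_zero (mul_ne_zero (θ'.h_ne_zero _ (hφ'I x hx)) (pow_ne_zero 2 (hφ0 x hx)))
          (θ.g_ne_zero x hx)
      refine mul_left_cancel₀ hne ?_
      linear_combination h1 - h2
    exact mul_left_cancel₀ hm' (Real.exp_injective h3)
  have hψs : ContDiffOn ℝ ∞ ψ I :=
    h.smooth_U.comp (f := fun x : ℝ => (t₀, x)) (by fun_prop) fun x hx => ⟨ht₀, hx⟩
  have dψ : ∀ x ∈ I, HasDerivAt ψ (deriv ψ x) x := fun x hx => hasDerivAt_of_contDiffOn hI.1 hψs hx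
  have dψ' : ∀ x ∈ I, HasDerivAt (deriv ψ) (deriv (deriv ψ) x) x := fun x hx =>
    hasDerivAt_of_contDiffOn hI.1 (contDiffOn_deriv hI.1 hψs) hx
  have hUx : ∀ x ∈ I, fderiv ℝ U₀ (t₀, x) (0, 1) = deriv ψ x := fun x hx =>
    (hasDerivAt_slices hJ.1 hI.1 h.smooth_U ht₀ hx).2.unique (dψ x hx)
  have hgψ : ∀ x ∈ I, deriv θ.g x * deriv ψ x + θ.g x * deriv (deriv ψ) x = 0 := by
    intro x hx
    have h1 := h.eq_U t₀ ht₀ x hx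
    have hUt : fderiv ℝ U₀ (t₀, x) (1, 0) = 0 :=
      hasDerivAt_eq_zero_of_isOpen hJ.1 (fun s hs => hUψ s hs x hx) ht₀
        (hasDerivAt_slices hJ.1 hI.1 h.smooth_U ht₀ hx).1
    have hUxx : fderiv ℝ (fun p => fderiv ℝ U₀ p (0, 1)) (t₀, x) (0, 1) = deriv (deriv ψ) x := by
      refine (hasDerivAt_slices hJ.1 hI.1 (contDiffOn_fderiv_apply (hJ.1.prod hI.1) h.smooth_U
        (0, 1)) ht₀ hx).2.unique ((dψ' x hx).congr_of_eventuallyEq ?_)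
      filter_upwards [hI.1.mem_nhds hx] with s hs using hUx s hs
    rw [hUt, hUxx, hUx x hx, hXt t₀ ht₀ x hx, hXx t₀ ht₀ x hx, hXxx.2 x hx] at h1
    -- The derivatives of g' and φ_x in `eq_U` are eliminated with `hB`; what is left is (g ψ_x)_x =
    -- 0 times a nonzero factor.
    have hne : δ₁ * (θ'.g (φ x) * deriv φ x) ≠ 0 :=
      mul_ne_zero hδ₁0 (mul_ne_zero (hg'φ x hx) (hφ0 x hx))
    refine mul_left_cancel₀ hne ?_
    linear_combination -θ.g x * h1 - δ₁ * deriv ψ x * hB x hx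
  set δ₄ := θ.g x₀ * deriv ψ x₀ with hδ₄
  have hψ' : ∀ x ∈ I, θ.g x * deriv ψ x = δ₄ := fun x hx =>
    hI.eq_of_deriv_eq_zero (k := fun x => θ.g x * deriv ψ x) (fun x hx => by
      have h1 := (dg x hx).mul (dψ' x hx)
      rw [hgψ x hx] at h1
      exact h1) hx hx₀
  have dG : ∀ x ∈ I, HasDerivAt (θ.intInvG x₀) (1 / θ.g x) x := fun x hx =>
    θ.hasDerivAt_intInvG hI hx₀ hx
  set δ₅ := ψ x₀ - δ₄ * θ.intInvG x₀ x₀ with hδ₅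
  have hψ5 : ∀ x ∈ I, ψ x = δ₄ * θ.intInvG x₀ x + δ₅ := by
    intro x hx
    have := hI.eq_of_deriv_eq_zero (k := fun x => ψ x - δ₄ * θ.intInvG x₀ x) (fun x hx => by
      have h1 := (dψ x hx).sub ((dG x hx).const_mul δ₄)
      convert! h1 using 1
      rw [← hψ' x hx]
      have := θ.g_ne_zero x hx
      field_simp
      ring) hx hx₀
    simp only [hδ₅]
    linarith
  -- Since x' = φ(x) does not depend on t and u, the range of the x'-component over the box is φ(I).
  have hrange : φ '' I = I' := by
    apply Set.Subset.antisymm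
    · rintro _ ⟨x, hx, rfl⟩
      exact hφ'I x hx
    · intro x' hx'
      obtain ⟨⟨t, x, u⟩, hz, hzx⟩ := (T.range_x θ).ge hx'
      refine ⟨x, hz.2.1, ?_⟩
      rw [← hzx, ← hXφ t hz.1 x hz.2.1]
      simp only [h.eq t hz.1 x hz.2.1 u hz.2.2]
  refine ⟨δ₀, δ₁, T₀ t₀ - δ₁ * t₀, δ₃, δ₄, δ₅, φ, mul_ne_zero (mul_ne_zero hδ₀0 hδ₁0) hδ₃0,
    ⟨hφs, hφ0, hrange⟩, dG, fun t ht x hx u hu => ?_, fun x hx => ⟨?_, hg x hx, ?_⟩, ?_⟩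
  · rw [h.eq t ht x hx u hu, hXφ t ht x hx, hUψ t ht x hx, ← hψ5 x hx, ← hT2 t ht]
  · have h1 := hfg x hx
    have h2 := hφ0 x hx
    have h3 := θ.g_ne_zero x hx
    rw [hg x hx] at h1
    field_simp
    refine mul_right_cancel₀ (mul_ne_zero h3 h2) ?_
    linear_combination h1
  · have h1 := h.eq_h t₀ ht₀ x hx
    rw [hXx t₀ ht₀ x hx, hXφ t₀ ht₀ x hx, hg x hx, hUψ t₀ ht₀ x hx] at h1
    have h2 := hφ0 x hx
    have h3 := θ.g_ne_zero x hx
    rw [← hψ5 x hx]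
    have h4 : -(θ.m * ψ x) / δ₃ = -(θ'.m * ψ x) := by
      rw [hδ₃]; have := θ.m_ne_zero; field_simp
    rw [h4, Real.exp_neg]
    have h5 := Real.exp_ne_zero (θ'.m * ψ x)
    field_simp
    refine mul_right_cancel₀ (mul_ne_zero h3 h2) ?_
    linear_combination h1
  · rw [hδ₃]; have := θ.m_ne_zero; field_simp; rfl

/-- The flux transforms by g' v_{x'} = δ₀ (δ₃ g u_x + δ₄), so the contribution of ψ is a constant
that ∂_x removes. All terms of the new equation are the old ones times δ₀ δ₃ / φ_x ≠ 0; in the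
source term the factor e^{-mψ/δ₃} of h' compensates the shift of u. -/
theorem HasForm.mapsEquation {T : Transformation J I K I'} (hJ : IsOpenInterval J)
    (hI : IsOpenInterval I) (hK : IsOpenInterval K) (hI' : IsOpenInterval I') {θ : Coeff I}
    {δ₀ δ₁ δ₂ δ₃ δ₄ δ₅ : ℝ} {φ G : ℝ → ℝ} (hδ : δ₀ * δ₁ * δ₃ ≠ 0) (hφ : IsChangeOfVariable I I' φ)
    (hF : T.HasForm θ δ₀ δ₁ δ₂ δ₃ δ₄ δ₅ φ G) :
    MapsEquation (box J I K) θ (T.coeff θ) (T.point θ) := by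
  rintro u v ⟨t, x⟩ hp hu - hv hvu
  obtain ⟨hG, hpt, hc, hm⟩ := hF
  have hδ₁ : δ₁ ≠ 0 := right_ne_zero_of_mul (left_ne_zero_of_mul hδ)
  have hδ₀ : δ₀ ≠ 0 := left_ne_zero_of_mul (left_ne_zero_of_mul hδ)
  have hδ₃ : δ₃ ≠ 0 := right_ne_zero_of_mul hδ
  set θ' := T.coeff θ
  have hx : x ∈ I := hp.2.1
  have hφI : ∀ x ∈ I, φ x ∈ I' := fun x hx => hφ.2.2.le ⟨x, hx, rfl⟩
  have dφ : ∀ x ∈ I, HasDerivAt φ (deriv φ x) x := fun x hx =>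
    hasDerivAt_of_contDiffOn hI.1 hφ.1 hx
  set B : ℝ × ℝ → ℝ × ℝ := fun q => (δ₁ * q.1 + δ₂, φ q.2) with hB
  have hbox : ∀ᶠ q in 𝓝 ((t, x) : ℝ × ℝ), graphPt u q ∈ box J I K := by
    have hc : ContinuousAt (graphPt u) (t, x) :=
      continuousAt_fst.prodMk (continuousAt_snd.prodMk hu.continuousAt)
    exact hc.eventually ((isOpen_box hJ.1 hI.1 hK.1).mem_nhds hp)
  have hbase : ∀ᶠ q in 𝓝 ((t, x) : ℝ × ℝ), newBase (T.point θ) u q = B q ∧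
      newValue (T.point θ) u q = δ₃ * u q + (δ₄ * G q.2 + δ₅) := by
    filter_upwards [hbox] with q hq
    have := hpt q.1 hq.1 q.2 hq.2.1 (u q) hq.2.2
    simp only [newBase, newValue, graphPt, this, hB, and_self]
  have hud : ∀ᶠ q in 𝓝 ((t, x) : ℝ × ℝ), DifferentiableAt ℝ u q := by
    filter_upwards [(hu.of_le (m := 1) (by norm_cast)).eventually (by simp)]
      with q hq using hq.differentiableAt (by simp)
  have hBc : ContinuousAt B (t, x) := by
    have : ContinuousAt (fun q : ℝ × ℝ => φ q.2) (t, x) :=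
      ContinuousAt.comp (g := φ) (f := Prod.snd) (dφ x hx).continuousAt continuousAt_snd
    exact ContinuousAt.prodMk (by fun_prop) this
  rw [hbase.self_of_nhds.1] at hv ⊢
  have hvd : ∀ᶠ q in 𝓝 ((t, x) : ℝ × ℝ), DifferentiableAt ℝ v (B q) := by
    refine hBc.eventually ?_
    filter_upwards [(hv.of_le (m := 1) (by norm_cast)).eventually (by simp)]
      with q hq using hq.differentiableAt (by simp)
  have hI2 : ∀ᶠ q in 𝓝 ((t, x) : ℝ × ℝ), q.2 ∈ I := hbox.mono fun q hq => hq.2.1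
  have heq : ∀ᶠ q in 𝓝 ((t, x) : ℝ × ℝ), v (B q) = δ₃ * u q + (δ₄ * G q.2 + δ₅) := by
    filter_upwards [hvu, hbase] with q hq hbq
    rw [← hbq.1, hq, hbq.2]
  have hder : ∀ᶠ q in 𝓝 ((t, x) : ℝ × ℝ),
      δ₁ * fderiv ℝ v (B q) (1, 0) = δ₃ * fderiv ℝ u q (1, 0) ∧
      deriv φ q.2 * fderiv ℝ v (B q) (0, 1) = δ₃ * fderiv ℝ u q (0, 1) + δ₄ * (1 / θ.g q.2) := by
    filter_upwards [heq.eventually_nhds, hud, hvd, hI2] with q hq huq hvq hqI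
    constructor
    · have h1 : HasDerivAt (fun s => v (B (s, q.2))) (fderiv ℝ v (B q) (1, 0) * δ₁) q.1 := by
        have h2 := hasDerivAt_slice_fst (p := B q) hvq
        have h3 : HasDerivAt (fun s => δ₁ * s + δ₂) δ₁ q.1 := by
          simpa using ((hasDerivAt_id q.1).const_mul δ₁).add_const δ₂
        exact HasDerivAt.comp (h := fun s => δ₁ * s + δ₂) q.1 h2 h3
      have h2 := (hasDerivAt_slice_fst huq).const_mul δ₃ |>.add_const (δ₄ * G q.2 + δ₅)
      have h3 : Filter.Tendsto (fun s : ℝ => (s, q.2)) (𝓝 q.1) (𝓝 q) :=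
        Continuous.tendsto (by fun_prop) _
      rw [mul_comm]
      exact h1.unique (h2.congr_of_eventuallyEq (h3.eventually hq))
    · have h1 : HasDerivAt (fun s => v (B (q.1, s)))
          (fderiv ℝ v (B q) (0, 1) * deriv φ q.2) q.2 := by
        have h2 := hasDerivAt_slice_snd (p := B q) hvq
        exact HasDerivAt.comp (h := φ) q.2 h2 (dφ q.2 hqI)
      have h2 := ((hasDerivAt_slice_snd huq).const_mul δ₃).add
        (((hG q.2 hqI).const_mul δ₄).add_const δ₅)
      have h3 : Filter.Tendsto (fun s : ℝ => (q.1, s)) (𝓝 q.2) (𝓝 q) :=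
        Continuous.tendsto (by fun_prop) _
      rw [mul_comm]
      exact h1.unique (h2.congr_of_eventuallyEq (h3.eventually hq))
  -- The flux identity is needed along the x-line near the point, because it is differentiated in x.
  have hflux : ∀ᶠ s in 𝓝 x, θ'.g (φ s) * fderiv ℝ v (B (t, s)) (0, 1)
      = δ₀ * (δ₃ * (θ.g s * fderiv ℝ u (t, s) (0, 1)) + δ₄) := by
    have h3 : Filter.Tendsto (fun s : ℝ => (t, s)) (𝓝 x) (𝓝 (t, x)) :=
      Continuous.tendsto (by fun_prop) _
    filter_upwards [h3.eventually hder, h3.eventually hI2] with s hs hsI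
    have h4 := θ.g_ne_zero s hsI
    rw [(hc s hsI).2.1]
    calc _ = δ₀ * θ.g s * (deriv φ s * fderiv ℝ v (B (t, s)) (0, 1)) := by ring
      _ = _ := by rw [hs.2]; field_simp
  have hvx : DifferentiableAt ℝ (fun p => fderiv ℝ v p (0, 1)) (B (t, x)) :=
    ((hv.fderiv_right (m := ∞) (by simp)).clm_apply contDiffAt_const).differentiableAt (by simp)
  have hux : DifferentiableAt ℝ (fun p => fderiv ℝ u p (0, 1)) (t, x) :=
    ((hu.fderiv_right (m := ∞) (by simp)).clm_apply contDiffAt_const).differentiableAt (by simp)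
  have hdiff : (deriv θ'.g (φ x) * deriv φ x) * fderiv ℝ v (B (t, x)) (0, 1)
      + θ'.g (φ x) * (fderiv ℝ (fun p => fderiv ℝ v p (0, 1)) (B (t, x)) (0, 1) * deriv φ x)
      = δ₀ * (δ₃ * (deriv θ.g x * fderiv ℝ u (t, x) (0, 1)
        + θ.g x * fderiv ℝ (fun p => fderiv ℝ u p (0, 1)) (t, x) (0, 1))) := by
    have dg := hasDerivAt_of_contDiffOn hI.1 θ.g_smooth hx
    have dg' := hasDerivAt_of_contDiffOn hI'.1 θ'.g_smooth (hφI x hx)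
    have h1 : HasDerivAt (fun s => fderiv ℝ v (B (t, s)) (0, 1))
        (fderiv ℝ (fun p => fderiv ℝ v p (0, 1)) (B (t, x)) (0, 1) * deriv φ x) x :=
      HasDerivAt.comp (h := φ) x (hasDerivAt_slice_snd (p := B (t, x)) hvx) (dφ x hx)
    have h2 := (dg'.comp x (dφ x hx)).mul h1
    have h3 := (((dg.mul (hasDerivAt_slice_snd hux)).const_mul δ₃).add_const δ₄).const_mul δ₀
    exact h2.unique (h3.congr_of_eventuallyEq hflux)
  rw [θ.satisfiedAt_iff hI.1 hx hu, θ'.satisfiedAt_iff hI'.1 (hφI x hx) hv, heq.self_of_nhds, hm]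
  have hφ0 : deriv φ x ≠ 0 := hφ.2.1 x hx
  have hexp : θ'.h (φ x) * Real.exp (θ.m / δ₃ * (δ₃ * u (t, x) + (δ₄ * G x + δ₅)))
      = δ₀ * δ₃ / deriv φ x * (θ.h x * Real.exp (θ.m * u (t, x))) := by
    rw [(hc x hx).2.2]
    have : Real.exp (-(θ.m * (δ₄ * G x + δ₅)) / δ₃)
        * Real.exp (θ.m / δ₃ * (δ₃ * u (t, x) + (δ₄ * G x + δ₅))) = Real.exp (θ.m * u (t, x)) := by
      rw [← Real.exp_add]; congr 1; field_simp; ring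
    rw [← this]; ring
  have ht' := hder.self_of_nhds.1
  have hκ : δ₀ * δ₃ / deriv φ x ≠ 0 := div_ne_zero (mul_ne_zero hδ₀ hδ₃) hφ0
  have e1 : θ'.f (φ x) * fderiv ℝ v (B (t, x)) (1, 0)
      = δ₀ * δ₃ / deriv φ x * (θ.f x * fderiv ℝ u (t, x) (1, 0)) := by
    rw [(hc x hx).1]
    calc _ = δ₀ / deriv φ x * θ.f x * (δ₁ * fderiv ℝ v (B (t, x)) (1, 0)) := by ring
      _ = _ := by rw [ht']; ring
  have e2 : θ'.g (φ x) * fderiv ℝ (fun p => fderiv ℝ v p (0, 1)) (B (t, x)) (0, 1)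
      + deriv θ'.g (φ x) * fderiv ℝ v (B (t, x)) (0, 1)
      = δ₀ * δ₃ / deriv φ x * (θ.g x * fderiv ℝ (fun p => fderiv ℝ u p (0, 1)) (t, x) (0, 1)
        + deriv θ.g x * fderiv ℝ u (t, x) (0, 1)) := by
    field_simp
    linear_combination hdiff
  constructor
  · intro h
    change θ'.f (φ x) * _ = θ'.g (φ x) * _ + deriv θ'.g (φ x) * _ + θ'.h (φ x) * _
    rw [e1, e2, hexp, ← mul_add, h]
  · intro h
    change θ'.f (φ x) * _ = θ'.g (φ x) * _ + deriv θ'.g (φ x) * _ + θ'.h (φ x) * _ at h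
    rw [e1, e2, hexp, ← mul_add] at h
    exact mul_left_cancel₀ hκ h

theorem isEquivalence_iff (hJ : IsOpenInterval J) (hI : IsOpenInterval I) (hK : IsOpenInterval K)
    (hI' : IsOpenInterval I') (T : Transformation J I K I') :
    T.IsEquivalence ↔ ∀ θ, ∃ (δ₀ δ₁ δ₂ δ₃ δ₄ δ₅ : ℝ) (φ G : ℝ → ℝ), δ₀ * δ₁ * δ₃ ≠ 0 ∧
      IsChangeOfVariable I I' φ ∧ T.HasForm θ δ₀ δ₁ δ₂ δ₃ δ₄ δ₅ φ G := by
  constructor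
  · intro hT θ
    obtain ⟨x₀, hx₀⟩ := hI.2.2
    obtain ⟨δ₀, δ₁, δ₂, δ₃, δ₄, δ₅, φ, h1, h2, h3⟩ := hT.exists_hasForm hJ hI hK hI' θ hx₀
    exact ⟨δ₀, δ₁, δ₂, δ₃, δ₄, δ₅, φ, _, h1, h2, h3⟩
  · intro h θ
    obtain ⟨δ₀, δ₁, δ₂, δ₃, δ₄, δ₅, φ, G, h1, h2, h3⟩ := h θ
    exact h3.mapsEquation hJ hI hK hI' h1 h2

end Transformation

/-! ### Smooth families of functions of the space variable -/

/-- A smooth one-parameter family of functions on `I`. -/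
def SmoothFamily (I : Set ℝ) (k : ℝ → ℝ → ℝ) : Prop :=
  ContDiffOn ℝ ∞ (fun p : ℝ × ℝ => k p.1 p.2) (Set.univ ×ˢ I)

namespace SmoothFamily

variable {I I' : Set ℝ} {k l : ℝ → ℝ → ℝ}

theorem slice (hk : SmoothFamily I k) (s : ℝ) : ContDiffOn ℝ ∞ (k s) I :=
  ContDiffOn.comp (g := fun p : ℝ × ℝ => k p.1 p.2) (f := fun x : ℝ => (s, x)) hk (by fun_prop)
    fun _ hx => ⟨trivial, hx⟩

theorem of_contDiffOn {f : ℝ → ℝ} (hf : ContDiffOn ℝ ∞ f I) : SmoothFamily I fun _ => f :=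
  hf.comp contDiffOn_snd fun _ hp => hp.2

theorem of_contDiff {c : ℝ → ℝ} (hc : ContDiff ℝ ∞ c) : SmoothFamily I fun s _ => c s :=
  (hc.comp contDiff_fst).contDiffOn

theorem mul (hk : SmoothFamily I k) (hl : SmoothFamily I l) :
    SmoothFamily I fun s x => k s x * l s x := ContDiffOn.mul hk hl

theorem add (hk : SmoothFamily I k) (hl : SmoothFamily I l) :
    SmoothFamily I fun s x => k s x + l s x := ContDiffOn.add hk hl

theorem neg (hk : SmoothFamily I k) : SmoothFamily I fun s x => - k s x := ContDiffOn.neg hk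

theorem exp (hk : SmoothFamily I k) : SmoothFamily I fun s x => Real.exp (k s x) :=
  ContDiffOn.exp hk

theorem const_mul (c : ℝ) (hk : SmoothFamily I k) : SmoothFamily I fun s x => c * k s x :=
  ContDiffOn.mul contDiffOn_const hk

theorem div_const (hk : SmoothFamily I k) (c : ℝ) : SmoothFamily I fun s x => k s x / c :=
  ContDiffOn.div_const hk c

theorem const_div (c : ℝ) (hk : SmoothFamily I k) (h0 : ∀ s, ∀ x ∈ I, k s x ≠ 0) :
    SmoothFamily I fun s x => c / k s x :=
  ContDiffOn.div contDiffOn_const hk fun p hp => h0 p.1 p.2 hp.2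

theorem div (hk : SmoothFamily I k) (hl : SmoothFamily I l) (h0 : ∀ s, ∀ x ∈ I, l s x ≠ 0) :
    SmoothFamily I fun s x => k s x / l s x :=
  ContDiffOn.div hk hl fun p hp => h0 p.1 p.2 hp.2

theorem comp (hk : SmoothFamily I' k) {φ : ℝ → ℝ} (hφ : ContDiffOn ℝ ∞ φ I)
    (hm : Set.MapsTo φ I I') : SmoothFamily I fun s x => k s (φ x) :=
  ContDiffOn.comp (g := fun p : ℝ × ℝ => k p.1 p.2) (f := fun p : ℝ × ℝ => (p.1, φ p.2)) hk
    (contDiffOn_fst.prodMk (hφ.comp contDiffOn_snd fun _ hp => hp.2))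
    fun _ hp => ⟨trivial, hm hp.2⟩

theorem indicator (hk : SmoothFamily I k) : SmoothFamily I fun s => I.indicator (k s) :=
  ContDiffOn.congr hk fun p hp => Set.indicator_of_mem hp.2 (k p.1)

theorem primitive (hI : IsOpenInterval I) (hk : SmoothFamily I k) {x₀ : ℝ} (hx₀ : x₀ ∈ I) :
    SmoothFamily I fun s x => ∫ y in x₀..x, k s y :=
  contDiffOn_primitive hI hk hx₀

end SmoothFamily

/-- ∫ dx / g is the only nonlocal ingredient of the formulas; this gives its smoothness along
families. -/
theorem SmoothCurve.intInvG {I : Set ℝ} (hI : IsOpenInterval I) {c : ℝ → Coeff I}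
    (hc : SmoothCurve c) {x₀ : ℝ} (hx₀ : x₀ ∈ I) :
    SmoothFamily I fun s => (c s).intInvG x₀ :=
  (SmoothFamily.const_div 1 (k := fun s => (c s).g) hc.2.1 fun s => (c s).g_ne_zero).primitive
    hI hx₀

/-! ### Changes of the space variable -/

namespace IsChangeOfVariable

variable {I I' : Set ℝ} {φ : ℝ → ℝ}

theorem hasDerivAt (hI : IsOpen I) (h : IsChangeOfVariable I I' φ) {x : ℝ} (hx : x ∈ I) :
    HasDerivAt φ (deriv φ x) x := hasDerivAt_of_contDiffOn hI h.1 hx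

theorem injOn (hI : IsOpenInterval I) (h : IsChangeOfVariable I I' φ) : Set.InjOn φ I :=
  hI.injOn_of_deriv_ne_zero (fun _ hx => h.hasDerivAt hI.1 hx) h.2.1

theorem mapsTo (h : IsChangeOfVariable I I' φ) : Set.MapsTo φ I I' := fun x hx =>
  h.2.2.le ⟨x, hx, rfl⟩

theorem inv_mem (h : IsChangeOfVariable I I' φ) {x' : ℝ} (hx' : x' ∈ I') :
    Function.invFunOn φ I x' ∈ I := Function.invFunOn_mem (h.2.2.ge hx')

theorem apply_inv (h : IsChangeOfVariable I I' φ) {x' : ℝ} (hx' : x' ∈ I') :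
    φ (Function.invFunOn φ I x') = x' := Function.invFunOn_eq (h.2.2.ge hx')

theorem inv_apply (hI : IsOpenInterval I) (h : IsChangeOfVariable I I' φ) {x : ℝ} (hx : x ∈ I) :
    Function.invFunOn φ I (φ x) = x :=
  h.injOn hI (h.inv_mem (h.mapsTo hx)) hx (h.apply_inv (h.mapsTo hx))

theorem contDiffOn_inv (hI : IsOpenInterval I) (h : IsChangeOfVariable I I' φ) :
    ContDiffOn ℝ ∞ (Function.invFunOn φ I) I' := by
  rw [← h.2.2]
  refine contDiffOn_invFunOn hI.1 h.1 (h.injOn hI) fun x hx => ?_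
  apply isInvertible_of_injective
  rw [injective_iff_map_eq_zero]
  intro r hr
  have h1 : fderiv ℝ φ x r = r * deriv φ x := by
    rw [(h.hasDerivAt hI.1 hx).hasFDerivAt.fderiv]; simp
  rw [h1] at hr
  exact (mul_eq_zero.1 hr).resolve_right (h.2.1 x hx)

theorem hasDerivAt_inv (hI : IsOpenInterval I) (hI' : IsOpen I') (h : IsChangeOfVariable I I' φ)
    {x : ℝ} (hx : x ∈ I) : HasDerivAt (Function.invFunOn φ I) (1 / deriv φ x) (φ x) := by
  have h1 := hasDerivAt_of_contDiffOn hI' (h.contDiffOn_inv hI) (h.mapsTo hx)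
  have h2 := h1.comp x (h.hasDerivAt hI.1 hx)
  have h3 : (Function.invFunOn φ I ∘ φ) =ᶠ[𝓝 x] id := by
    filter_upwards [hI.1.mem_nhds hx] with s hs using h.inv_apply hI hs
  have h4 := h2.unique ((hasDerivAt_id x).congr_of_eventuallyEq h3)
  rw [← eq_div_iff (h.2.1 x hx)] at h4
  rwa [h4] at h1

theorem inv (hI : IsOpenInterval I) (hI' : IsOpen I') (h : IsChangeOfVariable I I' φ) :
    IsChangeOfVariable I' I (Function.invFunOn φ I) := by
  refine ⟨h.contDiffOn_inv hI, fun x' hx' => ?_, ?_⟩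
  · rw [← h.apply_inv hx', (h.hasDerivAt_inv hI hI' (h.inv_mem hx')).deriv]
    exact div_ne_zero one_ne_zero (h.2.1 _ (h.inv_mem hx'))
  · apply Set.Subset.antisymm
    · rintro _ ⟨x', hx', rfl⟩
      exact h.inv_mem hx'
    · exact fun x hx => ⟨φ x, h.mapsTo hx, h.inv_apply hI hx⟩

theorem comp {I'' : Set ℝ} {φ' : ℝ → ℝ} (hI : IsOpen I) (hI' : IsOpen I')
    (h : IsChangeOfVariable I I' φ) (h' : IsChangeOfVariable I' I'' φ') :
    IsChangeOfVariable I I'' (φ' ∘ φ) ∧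
      ∀ x ∈ I, deriv (φ' ∘ φ) x = deriv φ' (φ x) * deriv φ x := by
  have hd : ∀ x ∈ I, deriv (φ' ∘ φ) x = deriv φ' (φ x) * deriv φ x := fun x hx =>
    ((h'.hasDerivAt hI' (h.mapsTo hx)).comp x (h.hasDerivAt hI hx)).deriv
  refine ⟨⟨h'.1.comp h.1 h.mapsTo, fun x hx => ?_, ?_⟩, hd⟩
  · rw [hd x hx]
    exact mul_ne_zero (h'.2.1 _ (h.mapsTo hx)) (h.2.1 x hx)
  · rw [Set.image_comp, h.2.2, h'.2.2]

theorem contDiffOn_deriv (hI : IsOpen I) (h : IsChangeOfVariable I I' φ) :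
    ContDiffOn ℝ ∞ (deriv φ) I := ReactionDiffusion.contDiffOn_deriv hI h.1

end IsChangeOfVariable

/-! ### Transformations with prescribed parameters -/

/-- A point transformation `(δ₁ t + δ₂, φ(x), δ₃ u + ψ(x))` is nondegenerate. -/
theorem isInvertible_fderiv_of_form {J I K I' : Set ℝ} (hJ : IsOpen J) (hI : IsOpen I)
    (hK : IsOpen K) {Φ : Pt → Pt} {δ₁ δ₂ δ₃ : ℝ} {φ ψ : ℝ → ℝ} (hδ₁ : δ₁ ≠ 0) (hδ₃ : δ₃ ≠ 0)
    (hφ : IsChangeOfVariable I I' φ) (hψ : ∀ x ∈ I, DifferentiableAt ℝ ψ x)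
    (hΦ : ∀ t ∈ J, ∀ x ∈ I, ∀ u ∈ K, Φ (t, x, u) = (δ₁ * t + δ₂, φ x, δ₃ * u + ψ x)) :
    ∀ z ∈ box J I K, (fderiv ℝ Φ z).IsInvertible := by
  rintro ⟨t, x, u⟩ hz
  have hev : Φ =ᶠ[𝓝 (t, x, u)]
      fun z => (δ₁ * z.1 + δ₂, φ z.2.1, δ₃ * z.2.2 + ψ z.2.1) := by
    filter_upwards [(isOpen_box hJ hI hK).mem_nhds hz] with z hz
      using hΦ z.1 hz.1 z.2.1 hz.2.1 z.2.2 hz.2.2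
  have h21 : HasFDerivAt (fun z : Pt => z.2.1) ((ContinuousLinearMap.fst ℝ ℝ ℝ).comp
      (ContinuousLinearMap.snd ℝ ℝ (ℝ × ℝ))) (t, x, u) := hasFDerivAt_snd.fst
  have h22 : HasFDerivAt (fun z : Pt => z.2.2) ((ContinuousLinearMap.snd ℝ ℝ ℝ).comp
      (ContinuousLinearMap.snd ℝ ℝ (ℝ × ℝ))) (t, x, u) := hasFDerivAt_snd.snd
  have hφd : HasFDerivAt (fun z : Pt => φ z.2.1) (deriv φ x • ((ContinuousLinearMap.fst ℝ ℝ ℝ).comp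
      (ContinuousLinearMap.snd ℝ ℝ (ℝ × ℝ)))) (t, x, u) :=
    HasDerivAt.comp_hasFDerivAt (h₂ := φ) (t, x, u) (hφ.hasDerivAt hI hz.2.1) h21
  have hψd : HasFDerivAt (fun z : Pt => ψ z.2.1) (deriv ψ x • ((ContinuousLinearMap.fst ℝ ℝ ℝ).comp
      (ContinuousLinearMap.snd ℝ ℝ (ℝ × ℝ)))) (t, x, u) :=
    HasDerivAt.comp_hasFDerivAt (h₂ := ψ) (t, x, u) (hψ x hz.2.1).hasDerivAt h21
  have hd := ((hasFDerivAt_fst (𝕜 := ℝ) (p := ((t, x, u) : Pt))).const_mul δ₁ |>.add_const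
    δ₂).prodMk (hφd.prodMk ((h22.const_mul δ₃).add hψd))
  have hd' := hd.congr_of_eventuallyEq hev
  rw [hd'.fderiv]
  apply isInvertible_of_injective
  rw [injective_iff_map_eq_zero]
  rintro ⟨a, b, c⟩ hw
  have hb0 := hφ.2.1 x hz.2.1
  simp [Prod.ext_iff, hδ₁, hb0] at hw
  obtain ⟨rfl, rfl, hc⟩ := hw
  simpa [hδ₃] using hc

section Construction

variable {I I' : Set ℝ} (hI : IsOpenInterval I) (δ₀ δ₁ δ₃ δ₄ δ₅ : ℝ) {φ : ℝ → ℝ}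
  (hφ : IsChangeOfVariable I I' φ) {x₀ : ℝ} (hx₀ : x₀ ∈ I)

/-- The formulas for f', g', h' at x = φ⁻¹(x'), extended by zero. Stating them along curves covers
both the smoothness of families and, for a constant curve, that of single arbitrary elements. -/
theorem SmoothCurve.push {c : ℝ → Coeff I} (hc : SmoothCurve c)
    (hI : IsOpenInterval I) (hφ : IsChangeOfVariable I I' φ) (hx₀ : x₀ ∈ I) :
    SmoothFamily I' (fun s => I'.indicator fun x' => δ₀ * δ₁ / deriv φ (Function.invFunOn φ I x')
        * (c s).f (Function.invFunOn φ I x')) ∧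
    SmoothFamily I' (fun s => I'.indicator fun x' => δ₀ * deriv φ (Function.invFunOn φ I x')
        * (c s).g (Function.invFunOn φ I x')) ∧
    SmoothFamily I' (fun s => I'.indicator fun x' => δ₀ * δ₃ / deriv φ (Function.invFunOn φ I x')
        * Real.exp (-((c s).m * (δ₄ * (c s).intInvG x₀ (Function.invFunOn φ I x') + δ₅)) / δ₃)
        * (c s).h (Function.invFunOn φ I x')) := by
  have hχ := hφ.contDiffOn_inv hI
  have hm : Set.MapsTo (Function.invFunOn φ I) I' I := fun x' hx' => hφ.inv_mem hx'
  have hφ' : SmoothFamily I fun _ => deriv φ :=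
    SmoothFamily.of_contDiffOn (hφ.contDiffOn_deriv hI.1)
  have h0 : ∀ _ : ℝ, ∀ x ∈ I, deriv φ x ≠ 0 := fun _ => hφ.2.1
  have hm' : SmoothFamily I fun s _ => (c s).m := SmoothFamily.of_contDiff hc.2.2.2
  have hG : SmoothFamily I fun s => (c s).intInvG x₀ := hc.intInvG hI hx₀
  have hδ : SmoothFamily I fun _ _ => δ₅ := SmoothFamily.of_contDiffOn contDiffOn_const
  have hf : SmoothFamily I fun s => (c s).f := hc.1
  have hg : SmoothFamily I fun s => (c s).g := hc.2.1
  have hh : SmoothFamily I fun s => (c s).h := hc.2.2.1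
  exact ⟨(((hφ'.const_div (δ₀ * δ₁) h0).mul hf).comp hχ hm).indicator,
    (((hφ'.const_mul δ₀).mul hg).comp hχ hm).indicator,
    ((((hφ'.const_div (δ₀ * δ₃) h0).mul
      ((hm'.mul ((hG.const_mul δ₄).add hδ)).neg.div_const δ₃).exp).mul hh).comp hχ hm).indicator⟩

/-- The old function `g` in terms of the new one. -/
noncomputable def pullG (δ₀ : ℝ) (I : Set ℝ) (φ g' : ℝ → ℝ) : ℝ → ℝ :=
  I.indicator fun x => g' (φ x) / (δ₀ * deriv φ x)

theorem pullG_ne_zero {g' : ℝ → ℝ} (hδ₀ : δ₀ ≠ 0) (hφ : IsChangeOfVariable I I' φ)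
    (hg' : ∀ x' ∈ I', g' x' ≠ 0) : ∀ x ∈ I, pullG δ₀ I φ g' x ≠ 0 := by
  intro x hx
  rw [pullG, Set.indicator_of_mem hx]
  exact div_ne_zero (hg' _ (hφ.mapsTo hx)) (mul_ne_zero hδ₀ (hφ.2.1 x hx))

/-- The inverse formulas. The nonlocal term is recoverable because g is regained from g' first, and
its primitive from x₀ is then available for h. -/
theorem SmoothCurve.pull (hc₀ : δ₀ * δ₁ * δ₃ ≠ 0) {c : ℝ → Coeff I'} (hc : SmoothCurve c)
    (hI : IsOpenInterval I) (hφ : IsChangeOfVariable I I' φ) (hx₀ : x₀ ∈ I) :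
    SmoothFamily I (fun s => I.indicator fun x => deriv φ x / (δ₀ * δ₁) * (c s).f (φ x)) ∧
    SmoothFamily I (fun s => pullG δ₀ I φ (c s).g) ∧
    SmoothFamily I (fun s => I.indicator fun x => deriv φ x / (δ₀ * δ₃)
        * Real.exp ((c s).m * (δ₄ * (∫ y in x₀..x, 1 / pullG δ₀ I φ (c s).g y) + δ₅))
        * (c s).h (φ x)) := by
  have hφ' : SmoothFamily I fun _ => deriv φ :=
    SmoothFamily.of_contDiffOn (hφ.contDiffOn_deriv hI.1)
  have hδ₀ : δ₀ ≠ 0 := left_ne_zero_of_mul (left_ne_zero_of_mul hc₀)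
  have h0 : ∀ _ : ℝ, ∀ x ∈ I, δ₀ * deriv φ x ≠ 0 := fun _ x hx => mul_ne_zero hδ₀ (hφ.2.1 x hx)
  have hm' : SmoothFamily I fun s _ => (c s).m := SmoothFamily.of_contDiff hc.2.2.2
  have hf : SmoothFamily I' fun s => (c s).f := hc.1
  have hg : SmoothFamily I' fun s => (c s).g := hc.2.1
  have hh : SmoothFamily I' fun s => (c s).h := hc.2.2.1
  have hδ : SmoothFamily I fun _ _ => δ₅ := SmoothFamily.of_contDiffOn contDiffOn_const
  have hgI : SmoothFamily I (fun s => pullG δ₀ I φ (c s).g) :=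
    ((hg.comp hφ.1 hφ.mapsTo).div (hφ'.const_mul δ₀) h0).indicator
  have hG := (hgI.const_div 1 fun s => pullG_ne_zero δ₀ hδ₀ hφ (c s).g_ne_zero).primitive hI hx₀
  exact ⟨((hφ'.div_const (δ₀ * δ₁)).mul (hf.comp hφ.1 hφ.mapsTo)).indicator, hgI,
    (((hφ'.div_const (δ₀ * δ₃)).mul (hm'.mul ((hG.const_mul δ₄).add hδ)).exp).mul
      (hh.comp hφ.1 hφ.mapsTo)).indicator⟩

/-- The transformation of the arbitrary elements with given parameters. -/
noncomputable def coeffEquiv (hδ : δ₀ * δ₁ * δ₃ ≠ 0) : Coeff I ≃ Coeff I' where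
  toFun θ :=
    { f := I'.indicator fun x' => δ₀ * δ₁ / deriv φ (Function.invFunOn φ I x')
        * θ.f (Function.invFunOn φ I x')
      g := I'.indicator fun x' => δ₀ * deriv φ (Function.invFunOn φ I x')
        * θ.g (Function.invFunOn φ I x')
      h := I'.indicator fun x' => δ₀ * δ₃ / deriv φ (Function.invFunOn φ I x')
        * Real.exp (-(θ.m * (δ₄ * θ.intInvG x₀ (Function.invFunOn φ I x') + δ₅)) / δ₃)
        * θ.h (Function.invFunOn φ I x')
      m := θ.m / δ₃
      f_smooth := ((smoothCurve_const θ).push δ₀ δ₁ δ₃ δ₄ δ₅ hI hφ hx₀).1.slice 0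
      g_smooth := ((smoothCurve_const θ).push δ₀ δ₁ δ₃ δ₄ δ₅ hI hφ hx₀).2.1.slice 0
      h_smooth := ((smoothCurve_const θ).push δ₀ δ₁ δ₃ δ₄ δ₅ hI hφ hx₀).2.2.slice 0
      f_ne_zero := fun x' hx' => by
        rw [Set.indicator_of_mem hx']
        exact mul_ne_zero (div_ne_zero (left_ne_zero_of_mul hδ) (hφ.2.1 _ (hφ.inv_mem hx')))
          (θ.f_ne_zero _ (hφ.inv_mem hx'))
      g_ne_zero := fun x' hx' => by
        rw [Set.indicator_of_mem hx']
        exact mul_ne_zero (mul_ne_zero (left_ne_zero_of_mul (left_ne_zero_of_mul hδ))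
          (hφ.2.1 _ (hφ.inv_mem hx'))) (θ.g_ne_zero _ (hφ.inv_mem hx'))
      h_ne_zero := fun x' hx' => by
        rw [Set.indicator_of_mem hx']
        exact mul_ne_zero (mul_ne_zero (div_ne_zero (mul_ne_zero
          (left_ne_zero_of_mul (left_ne_zero_of_mul hδ)) (right_ne_zero_of_mul hδ))
            (hφ.2.1 _ (hφ.inv_mem hx'))) (Real.exp_ne_zero _)) (θ.h_ne_zero _ (hφ.inv_mem hx'))
      m_ne_zero := div_ne_zero θ.m_ne_zero (right_ne_zero_of_mul hδ)
      f_off := fun x' hx' => Set.indicator_of_notMem hx' _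
      g_off := fun x' hx' => Set.indicator_of_notMem hx' _
      h_off := fun x' hx' => Set.indicator_of_notMem hx' _ }
  invFun θ' :=
    { f := I.indicator fun x => deriv φ x / (δ₀ * δ₁) * θ'.f (φ x)
      g := pullG δ₀ I φ θ'.g
      h := I.indicator fun x => deriv φ x / (δ₀ * δ₃)
        * Real.exp (θ'.m * (δ₄ * (∫ y in x₀..x, 1 / pullG δ₀ I φ θ'.g y) + δ₅)) * θ'.h (φ x)
      m := θ'.m * δ₃
      f_smooth := ((smoothCurve_const θ').pull δ₀ δ₁ δ₃ δ₄ δ₅ hδ hI hφ hx₀).1.slice 0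
      g_smooth := ((smoothCurve_const θ').pull δ₀ δ₁ δ₃ δ₄ δ₅ hδ hI hφ hx₀).2.1.slice 0
      h_smooth := ((smoothCurve_const θ').pull δ₀ δ₁ δ₃ δ₄ δ₅ hδ hI hφ hx₀).2.2.slice 0
      f_ne_zero := fun x hx => by
        rw [Set.indicator_of_mem hx]
        exact mul_ne_zero (div_ne_zero (hφ.2.1 x hx) (left_ne_zero_of_mul hδ))
          (θ'.f_ne_zero _ (hφ.mapsTo hx))
      g_ne_zero := pullG_ne_zero δ₀ (left_ne_zero_of_mul (left_ne_zero_of_mul hδ)) hφ θ'.g_ne_zero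
      h_ne_zero := fun x hx => by
        rw [Set.indicator_of_mem hx]
        exact mul_ne_zero (mul_ne_zero (div_ne_zero (hφ.2.1 x hx) (mul_ne_zero
          (left_ne_zero_of_mul (left_ne_zero_of_mul hδ)) (right_ne_zero_of_mul hδ)))
            (Real.exp_ne_zero _)) (θ'.h_ne_zero _ (hφ.mapsTo hx))
      m_ne_zero := mul_ne_zero θ'.m_ne_zero (right_ne_zero_of_mul hδ)
      f_off := fun x hx => Set.indicator_of_notMem hx _
      g_off := fun x hx => Set.indicator_of_notMem hx _
      h_off := fun x hx => Set.indicator_of_notMem hx _ }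
  left_inv θ := by
    have hδ₀ := left_ne_zero_of_mul (left_ne_zero_of_mul hδ)
    have hδ₁ := right_ne_zero_of_mul (left_ne_zero_of_mul hδ)
    have hδ₃ := right_ne_zero_of_mul hδ
    -- The recovered g is the original one, so both exponentials contain the same integral with the
    -- same lower limit x₀ and cancel.
    have hg : pullG δ₀ I φ (I'.indicator fun x' => δ₀ * deriv φ (Function.invFunOn φ I x')
        * θ.g (Function.invFunOn φ I x')) = θ.g := by
      funext x
      by_cases hx : x ∈ I
      · have h0 := hφ.2.1 x hx
        rw [pullG, Set.indicator_of_mem hx, Set.indicator_of_mem (hφ.mapsTo hx),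
          hφ.inv_apply hI hx]
        field_simp
      · rw [pullG, Set.indicator_of_notMem hx, θ.g_off x hx]
    ext x
    · by_cases hx : x ∈ I
      · have h0 := hφ.2.1 x hx
        dsimp only
        rw [Set.indicator_of_mem hx, Set.indicator_of_mem (hφ.mapsTo hx), hφ.inv_apply hI hx]
        field_simp
      · dsimp only
        rw [Set.indicator_of_notMem hx, θ.f_off x hx]
    · exact congrFun hg x
    · by_cases hx : x ∈ I
      · have h0 := hφ.2.1 x hx
        dsimp only
        rw [Set.indicator_of_mem hx, Set.indicator_of_mem (hφ.mapsTo hx), hφ.inv_apply hI hx, hg]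
        have he : Real.exp (θ.m / δ₃ * (δ₄ * (∫ y in x₀..x, 1 / θ.g y) + δ₅))
            * Real.exp (-(θ.m * (δ₄ * θ.intInvG x₀ x + δ₅)) / δ₃) = 1 := by
          rw [← Real.exp_add, Coeff.intInvG, Real.exp_eq_one_iff]
          ring
        calc _ = (deriv φ x / (δ₀ * δ₃)) * (δ₀ * δ₃ / deriv φ x)
              * (Real.exp (θ.m / δ₃ * (δ₄ * (∫ y in x₀..x, 1 / θ.g y) + δ₅))
              * Real.exp (-(θ.m * (δ₄ * θ.intInvG x₀ x + δ₅)) / δ₃)) * θ.h x := by ring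
          _ = _ := by rw [he]; field_simp
      · dsimp only
        rw [Set.indicator_of_notMem hx, θ.h_off x hx]
    · exact div_mul_cancel₀ _ hδ₃
  right_inv θ' := by
    have hδ₀ := left_ne_zero_of_mul (left_ne_zero_of_mul hδ)
    have hδ₁ := right_ne_zero_of_mul (left_ne_zero_of_mul hδ)
    have hδ₃ := right_ne_zero_of_mul hδ
    ext x'
    · by_cases hx : x' ∈ I'
      · have h0 := hφ.2.1 _ (hφ.inv_mem hx)
        dsimp only
        rw [Set.indicator_of_mem hx, Set.indicator_of_mem (hφ.inv_mem hx), hφ.apply_inv hx]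
        field_simp
      · dsimp only
        rw [Set.indicator_of_notMem hx, θ'.f_off x' hx]
    · by_cases hx : x' ∈ I'
      · have h0 := hφ.2.1 _ (hφ.inv_mem hx)
        dsimp only
        rw [Set.indicator_of_mem hx, pullG, Set.indicator_of_mem (hφ.inv_mem hx), hφ.apply_inv hx]
        field_simp
      · dsimp only
        rw [Set.indicator_of_notMem hx, θ'.g_off x' hx]
    · by_cases hx : x' ∈ I'
      · have h0 := hφ.2.1 _ (hφ.inv_mem hx)
        dsimp only [Coeff.intInvG]
        rw [Set.indicator_of_mem hx, Set.indicator_of_mem (hφ.inv_mem hx), hφ.apply_inv hx]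
        set x := Function.invFunOn φ I x'
        set G := ∫ y in x₀..x, 1 / pullG δ₀ I φ θ'.g y
        have he : Real.exp (-(θ'.m * δ₃ * (δ₄ * G + δ₅)) / δ₃)
            * Real.exp (θ'.m * (δ₄ * G + δ₅)) = 1 := by
          rw [← Real.exp_add, Real.exp_eq_one_iff]
          field_simp
          ring
        calc _ = (deriv φ x / (δ₀ * δ₃)) * (δ₀ * δ₃ / deriv φ x)
              * (Real.exp (-(θ'.m * δ₃ * (δ₄ * G + δ₅)) / δ₃)
              * Real.exp (θ'.m * (δ₄ * G + δ₅))) * θ'.h x' := by ring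
          _ = _ := by rw [he]; field_simp
      · dsimp only
        rw [Set.indicator_of_notMem hx, θ'.h_off x' hx]
    · exact mul_div_cancel_right₀ _ hδ₃

/-- The transformation with given parameters. -/
noncomputable def formTransformation {J K : Set ℝ} (hJ : IsOpenInterval J) (hK : IsOpenInterval K)
    (δ₂ : ℝ) (hδ : δ₀ * δ₁ * δ₃ ≠ 0) : Transformation J I K I' where
  coeff := coeffEquiv hI δ₀ δ₁ δ₃ δ₄ δ₅ hφ hx₀ hδ
  point θ z := (δ₁ * z.1 + δ₂, φ z.2.1, δ₃ * z.2.2 + (δ₄ * θ.intInvG x₀ z.2.1 + δ₅))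
  coeff_smooth c hc := by
    obtain ⟨h1, h2, h3⟩ := hc.push δ₀ δ₁ δ₃ δ₄ δ₅ hI hφ hx₀
    exact ⟨h1, h2, h3, hc.2.2.2.div_const δ₃⟩
  coeff_symm_smooth c hc := by
    obtain ⟨h1, h2, h3⟩ := hc.pull δ₀ δ₁ δ₃ δ₄ δ₅ hδ hI hφ hx₀
    exact ⟨h1, h2, h3, hc.2.2.2.mul contDiff_const⟩
  point_smooth c hc := by
    have hG : ContDiffOn ℝ ∞ (fun q : ℝ × Pt => (c q.1).intInvG x₀ q.2.2.1)
        (Set.univ ×ˢ box J I K) :=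
      ContDiffOn.comp (g := fun p : ℝ × ℝ => (c p.1).intInvG x₀ p.2)
        (f := fun q : ℝ × Pt => (q.1, q.2.2.1)) (hc.intInvG hI hx₀) (by fun_prop)
        fun q hq => ⟨trivial, hq.2.2.1⟩
    have hφ1 : ContDiffOn ℝ ∞ (fun q : ℝ × Pt => φ q.2.2.1) (Set.univ ×ˢ box J I K) :=
      hφ.1.comp (f := fun q : ℝ × Pt => q.2.2.1) (by fun_prop) fun q hq => hq.2.2.1
    exact ContDiffOn.prodMk (by fun_prop) (hφ1.prodMk (ContDiffOn.add (by fun_prop)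
      ((contDiffOn_const.mul hG).add contDiffOn_const)))
  nondegenerate θ := isInvertible_fderiv_of_form (ψ := fun x => δ₄ * θ.intInvG x₀ x + δ₅) hJ.1 hI.1
    hK.1 (right_ne_zero_of_mul (left_ne_zero_of_mul hδ)) (right_ne_zero_of_mul hδ) hφ
    (fun x hx => (((θ.hasDerivAt_intInvG hI hx₀ hx).const_mul δ₄).add_const δ₅).differentiableAt)
    (fun t _ x _ u _ => rfl)
  range_x θ := by
    rw [← hφ.2.2]
    obtain ⟨t, ht⟩ := hJ.2.2
    obtain ⟨u, hu⟩ := hK.2.2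
    apply Set.Subset.antisymm
    · rintro _ ⟨z, hz, rfl⟩
      exact ⟨z.2.1, hz.2.1, rfl⟩
    · rintro _ ⟨x, hx, rfl⟩
      exact ⟨(t, x, u), ⟨ht, hx, hu⟩, rfl⟩

theorem hasForm_formTransformation {J K : Set ℝ} (hJ : IsOpenInterval J) (hK : IsOpenInterval K)
    (δ₂ : ℝ) (hδ : δ₀ * δ₁ * δ₃ ≠ 0) (θ : Coeff I) :
    (formTransformation hI δ₀ δ₁ δ₃ δ₄ δ₅ hφ hx₀ hJ hK δ₂ hδ).HasForm θ δ₀ δ₁ δ₂ δ₃ δ₄ δ₅ φ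
      (θ.intInvG x₀) := by
  refine ⟨fun x hx => θ.hasDerivAt_intInvG hI hx₀ hx, fun t _ x _ u _ => rfl, fun x hx => ?_, rfl⟩
  simp only [formTransformation, coeffEquiv, Equiv.coe_fn_mk]
  rw [Set.indicator_of_mem (hφ.mapsTo hx), Set.indicator_of_mem (hφ.mapsTo hx),
    Set.indicator_of_mem (hφ.mapsTo hx), hφ.inv_apply hI hx]
  exact ⟨rfl, rfl, rfl⟩

end Construction

/-! ### Usual equivalence transformations. -/

theorem IsOpenInterval.exists_ne {I : Set ℝ} (hI : IsOpenInterval I) (x : ℝ) : ∃ y ∈ I, y ≠ x :=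
  hI.infinite.nontrivial.exists_ne x

/-- Exponential arbitrary elements, with values `a, b, c` at `x₀`. -/
noncomputable def expCoeff (I : Set ℝ) (x₀ : ℝ) {a b c m : ℝ} (p q r : ℝ) (ha : a ≠ 0) (hb : b ≠ 0)
    (hc : c ≠ 0) (hm : m ≠ 0) : Coeff I where
  f := I.indicator fun x => a * Real.exp (p * (x - x₀))
  g := I.indicator fun x => b * Real.exp (q * (x - x₀))
  h := I.indicator fun x => c * Real.exp (r * (x - x₀))
  m := m
  f_smooth := ContDiffOn.congr (f := fun x => a * Real.exp (p * (x - x₀))) (by fun_prop)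
    fun _ hx => Set.indicator_of_mem hx _
  g_smooth := ContDiffOn.congr (f := fun x => b * Real.exp (q * (x - x₀))) (by fun_prop)
    fun _ hx => Set.indicator_of_mem hx _
  h_smooth := ContDiffOn.congr (f := fun x => c * Real.exp (r * (x - x₀))) (by fun_prop)
    fun _ hx => Set.indicator_of_mem hx _
  f_ne_zero x hx := by
    rw [Set.indicator_of_mem hx]; exact mul_ne_zero ha (Real.exp_ne_zero _)
  g_ne_zero x hx := by
    rw [Set.indicator_of_mem hx]; exact mul_ne_zero hb (Real.exp_ne_zero _)
  h_ne_zero x hx := by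
    rw [Set.indicator_of_mem hx]; exact mul_ne_zero hc (Real.exp_ne_zero _)
  m_ne_zero := hm
  f_off _ hx := Set.indicator_of_notMem hx _
  g_off _ hx := Set.indicator_of_notMem hx _
  h_off _ hx := Set.indicator_of_notMem hx _

theorem expCoeff_val {I : Set ℝ} (x₀ : ℝ) {a b c m : ℝ} (p q r : ℝ) (ha : a ≠ 0) (hb : b ≠ 0)
    (hc : c ≠ 0) (hm : m ≠ 0) {x : ℝ} (hx : x ∈ I) :
    (expCoeff I x₀ p q r ha hb hc hm).val x = (a * Real.exp (p * (x - x₀)),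
      b * Real.exp (q * (x - x₀)), c * Real.exp (r * (x - x₀)), m) := by
  simp only [Coeff.val, expCoeff, Set.indicator_of_mem hx]

theorem expCoeff_val_const {I : Set ℝ} (x₀ : ℝ) {a b c m : ℝ} (ha : a ≠ 0) (hb : b ≠ 0)
    (hc : c ≠ 0) (hm : m ≠ 0) {x : ℝ} (hx : x ∈ I) :
    (expCoeff I x₀ 0 0 0 ha hb hc hm).val x = (a, b, c, m) := by
  rw [expCoeff_val x₀ 0 0 0 ha hb hc hm hx]; simp

theorem sign_cast_ne_zero {a : ℝ} (ha : a ≠ 0) : ((SignType.sign a : SignType) : ℝ) ≠ 0 := by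
  intro h
  apply ha
  rw [← sign_mul_abs a, h, zero_mul]

/-- An exponent with which the value `a` at `x₀` is connected to `sign a` at `x₁`. -/
theorem mul_exp_eq_sign {a x₀ x₁ : ℝ} (ha : a ≠ 0) (hx : x₁ ≠ x₀) :
    a * Real.exp (-Real.log |a| / (x₁ - x₀) * (x₁ - x₀)) = ((SignType.sign a : SignType) : ℝ) := by
  have h1 : x₁ - x₀ ≠ 0 := sub_ne_zero.2 hx
  have h2 : 0 < |a| := abs_pos.2 ha
  rw [div_mul_cancel₀ _ h1, Real.exp_neg, Real.exp_log h2]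
  nth_rewrite 1 [← sign_mul_abs a]
  rw [mul_assoc, mul_inv_cancel₀ h2.ne', mul_one]

theorem eventually_sign_eq {a : ℝ} (ha : a ≠ 0) :
    ∀ᶠ b in 𝓝 a, SignType.sign b = SignType.sign a := by
  rcases lt_or_gt_of_ne ha with h | h
  · filter_upwards [gt_mem_nhds h] with b hb
    rw [sign_neg hb, sign_neg h]
  · filter_upwards [lt_mem_nhds h] with b hb
    rw [sign_pos hb, sign_pos h]

theorem sign_eq_sign_iff_mul_pos {a b : ℝ} (ha : a ≠ 0) (hb : b ≠ 0) :
    SignType.sign a = SignType.sign b ↔ 0 < a * b := by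
  rcases lt_or_gt_of_ne ha with h | h <;> rcases lt_or_gt_of_ne hb with h' | h'
  · simp [sign_neg h, sign_neg h', mul_pos_of_neg_of_neg h h']
  · simp [sign_neg h, sign_pos h', (mul_neg_of_neg_of_pos h h').le]
  · simp [sign_pos h, sign_neg h', (mul_neg_of_pos_of_neg h h').le]
  · simp [sign_pos h, sign_pos h', mul_pos h h']

namespace Transformation

variable {J I K I' : Set ℝ}

/-- Only the restriction of φ to I and the sum ψ = δ₄ G + δ₅ enter, so the antiderivative can be
exchanged when the constants are adjusted. -/
theorem HasForm.congr {T : Transformation J I K I'} (hI : IsOpen I) {θ : Coeff I}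
    {δ₀ δ₁ δ₂ δ₃ δ₄ δ₅ δ₄' δ₅' : ℝ} {φ φ' G G' : ℝ → ℝ} (h : T.HasForm θ δ₀ δ₁ δ₂ δ₃ δ₄ δ₅ φ G)
    (hφ : ∀ x ∈ I, φ x = φ' x) (hG' : ∀ x ∈ I, HasDerivAt G' (1 / θ.g x) x)
    (hψ : ∀ x ∈ I, δ₄ * G x + δ₅ = δ₄' * G' x + δ₅') :
    T.HasForm θ δ₀ δ₁ δ₂ δ₃ δ₄' δ₅' φ' G' := by
  obtain ⟨-, h2, h3, h4⟩ := h
  refine ⟨hG', fun t ht x hx u hu => ?_, fun x hx => ?_, h4⟩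
  · rw [h2 t ht x hx u hu, hφ x hx, hψ x hx]
  · have hd : deriv φ x = deriv φ' x := by
      apply Filter.EventuallyEq.deriv_eq
      filter_upwards [hI.mem_nhds hx] with s hs using hφ s hs
    have := h3 x hx
    rwa [hφ x hx, hd, hψ x hx] at this

/-- The components of a point transformation of the given form determine the parameters. -/
theorem form_unique (hJ : IsOpenInterval J) (hK : IsOpenInterval K) (hI : IsOpenInterval I)
    {δ₁ δ₂ δ₃ δ₁' δ₂' δ₃' : ℝ} {φ ψ φ' ψ' : ℝ → ℝ}
    (h : ∀ t ∈ J, ∀ x ∈ I, ∀ u ∈ K, ((δ₁ * t + δ₂, φ x, δ₃ * u + ψ x) : Pt)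
      = (δ₁' * t + δ₂', φ' x, δ₃' * u + ψ' x)) :
    δ₁ = δ₁' ∧ δ₂ = δ₂' ∧ δ₃ = δ₃' ∧ (∀ x ∈ I, φ x = φ' x) ∧ ∀ x ∈ I, ψ x = ψ' x := by
  obtain ⟨t, ht⟩ := hJ.2.2
  obtain ⟨t', ht', htt⟩ := hJ.exists_ne t
  obtain ⟨x₀, hx₀⟩ := hI.2.2
  obtain ⟨u, hu⟩ := hK.2.2
  obtain ⟨u', hu', huu⟩ := hK.exists_ne u
  simp only [Prod.mk.injEq] at h
  have h1 := (h t ht x₀ hx₀ u hu).1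
  have h2 := (h t' ht' x₀ hx₀ u hu).1
  have e1 : δ₁ = δ₁' := by
    refine mul_right_cancel₀ (sub_ne_zero.2 htt) ?_
    linear_combination h2 - h1
  have h3 := (h t ht x₀ hx₀ u hu).2.2
  have h4 := (h t ht x₀ hx₀ u' hu').2.2
  have e3 : δ₃ = δ₃' := by
    refine mul_right_cancel₀ (sub_ne_zero.2 huu) ?_
    linear_combination h4 - h3
  refine ⟨e1, ?_, e3, fun x hx => (h t ht x hx u hu).2.1, fun x hx => ?_⟩
  · rw [e1] at h1; linarith
  · have h5 := (h t ht x hx u hu).2.2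
    rw [e3] at h5; linarith

/-- For a usual equivalence transformation, all parameters except for `δ₀` are independent of the
arbitrary elements. -/
theorem IsEquivalence.exists_uniform_hasForm {T : Transformation J I K I'} (hT : T.IsEquivalence)
    (hU : T.IsUsual) (hJ : IsOpenInterval J) (hI : IsOpenInterval I) (hK : IsOpenInterval K)
    (hI' : IsOpenInterval I') :
    ∃ (δ₁ δ₂ δ₃ δ₅ : ℝ) (φ : ℝ → ℝ), IsChangeOfVariable I I' φ ∧ ∀ θ, ∀ x₀ ∈ I, ∃ δ₀ : ℝ,
      δ₀ * δ₁ * δ₃ ≠ 0 ∧ T.HasForm θ δ₀ δ₁ δ₂ δ₃ 0 δ₅ φ (θ.intInvG x₀) := by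
  obtain ⟨P, Q, -, hPQ⟩ := hU
  obtain ⟨x₁, hx₁⟩ := hI.2.2
  -- The reference elements are f = g = h = m = 1. The point transformation is common to all θ, so
  -- every other parameter set is compared with this one.
  obtain ⟨δ₀, δ₁, δ₂, δ₃, δ₄, δ₅, φ, hδ, hφ, hF⟩ := hT.exists_hasForm hJ hI hK hI'
    (expCoeff I x₁ 0 0 0 one_ne_zero one_ne_zero one_ne_zero one_ne_zero) hx₁
  set θ₁ : Coeff I := expCoeff I x₁ 0 0 0 one_ne_zero one_ne_zero one_ne_zero one_ne_zero with hθ₁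
  have hg₁ : ∀ x ∈ I, θ₁.g x = 1 := fun x hx => by
    simp [hθ₁, expCoeff, Set.indicator_of_mem hx]
  have key : ∀ θ, ∀ x₀ ∈ I, ∃ δ₀ δ₄' δ₅' : ℝ, δ₀ * δ₁ * δ₃ ≠ 0 ∧
      T.HasForm θ δ₀ δ₁ δ₂ δ₃ δ₄' δ₅' φ (θ.intInvG x₀) ∧
      (∀ x ∈ I, δ₄ * θ₁.intInvG x₁ x + δ₅ = δ₄' * θ.intInvG x₀ x + δ₅') ∧
      ∀ x ∈ I, δ₄ = δ₄' / θ.g x := by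
    intro θ x₀ hx₀
    obtain ⟨δ₀', δ₁', δ₂', δ₃', δ₄', δ₅', φ', hδ', hφ', hF'⟩ := hT.exists_hasForm hJ hI hK hI' θ hx₀
    obtain ⟨e1, e2, e3, e4, e5⟩ := form_unique (φ := φ) (φ' := φ')
      (ψ := fun x => δ₄ * θ₁.intInvG x₁ x + δ₅) (ψ' := fun x => δ₄' * θ.intInvG x₀ x + δ₅')
      hJ hK hI (δ₁ := δ₁) (δ₁' := δ₁') (δ₂ := δ₂) (δ₂' := δ₂') (δ₃ := δ₃) (δ₃' := δ₃')
      fun t ht x hx u hu => by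
        rw [← hF.2.1 t ht x hx u hu, ← hF'.2.1 t ht x hx u hu, (hPQ θ₁ _ ⟨ht, hx, hu⟩).1,
          (hPQ θ _ ⟨ht, hx, hu⟩).1]
    subst e1 e2 e3
    refine ⟨δ₀', δ₄', δ₅', hδ', hF'.congr hI.1 (fun x hx => (e4 x hx).symm) hF'.1
      fun _ _ => rfl, e5, fun x hx => ?_⟩
    have h1 := ((hF.1 x hx).const_mul δ₄).add_const δ₅
    have h2 := ((hF'.1 x hx).const_mul δ₄').add_const δ₅'
    have h3 := h1.unique (h2.congr_of_eventuallyEq (by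
      filter_upwards [hI.1.mem_nhds hx] with s hs using e5 s hs))
    rw [hg₁ x hx] at h3
    simpa [div_eq_mul_inv] using h3
  -- Equal ψ_x means δ₄ = δ₄' / g on I; for the nonconstant g = e^{x - x₁} this is possible only
  -- with δ₄ = 0.
  have hδ₄ : δ₄ = 0 := by
    obtain ⟨-, δ₄', -, -, -, -, h⟩ := key
      (expCoeff I x₁ (a := 1) (b := 1) (c := 1) (m := 1) 0 1 0 one_ne_zero one_ne_zero one_ne_zero
        one_ne_zero) x₁ hx₁
    obtain ⟨x₂, hx₂, hne⟩ := hI.exists_ne x₁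
    have h1 := h x₁ hx₁
    have h2 := h x₂ hx₂
    simp only [expCoeff, Set.indicator_of_mem hx₁, Set.indicator_of_mem hx₂, one_mul, sub_self,
      Real.exp_zero, div_one] at h1 h2
    rw [← h1, eq_div_iff (Real.exp_ne_zero _)] at h2
    by_contra h0
    have h3 : Real.exp (x₂ - x₁) = 1 := mul_left_cancel₀ h0 (by rw [h2, mul_one])
    rw [Real.exp_eq_one_iff] at h3
    exact hne (sub_eq_zero.1 h3)
  refine ⟨δ₁, δ₂, δ₃, δ₅, φ, hφ, fun θ x₀ hx₀ => ?_⟩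
  obtain ⟨δ₀', δ₄', δ₅', h1, h2, h3, h4⟩ := key θ x₀ hx₀
  refine ⟨δ₀', h1, h2.congr hI.1 (fun _ _ => rfl) h2.1 fun x hx => ?_⟩
  rw [← h3 x hx, hδ₄]; ring

/-- For a usual transformation g' at φ(x) depends only on the values of θ at x, so two θ agreeing at
one point have the same δ₀. Given values at x₀ are joined to their signs at another point x₂ by
exponential functions, and these to constant functions; hence δ₀ depends on the signs and m alone.
-/
theorem IsEquivalence.exists_usual_hasForm {T : Transformation J I K I'} (hT : T.IsEquivalence)
    (hU : T.IsUsual) (hJ : IsOpenInterval J) (hI : IsOpenInterval I) (hK : IsOpenInterval K)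
    (hI' : IsOpenInterval I') :
    ∃ (κ : SignType → SignType → SignType → ℝ → ℝ) (δ₁ δ₂ δ₃ δ₅ : ℝ) (φ : ℝ → ℝ),
      IsChangeOfVariable I I' φ ∧ ∀ θ, ∀ x₀ ∈ I, ∃ δ₀ : ℝ,
        δ₀ = κ (SignType.sign (θ.f x₀)) (SignType.sign (θ.g x₀)) (SignType.sign (θ.h x₀)) θ.m ∧
        δ₀ * δ₁ * δ₃ ≠ 0 ∧ T.HasForm θ δ₀ δ₁ δ₂ δ₃ 0 δ₅ φ (θ.intInvG x₀) := by
  obtain ⟨δ₁, δ₂, δ₃, δ₅, φ, hφ, hF⟩ := hT.exists_uniform_hasForm hU hJ hI hK hI'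
  obtain ⟨P, Q, -, hPQ⟩ := hU
  obtain ⟨x₁, hx₁⟩ := hI.2.2
  obtain ⟨t, ht⟩ := hJ.2.2
  obtain ⟨u, hu⟩ := hK.2.2
  -- The factor δ₀ as an explicit function of θ, read off from g' at the fixed point x₁; this
  -- removes the dependence of the choice on the base point of the integral.
  set d : Coeff I → ℝ := fun θ => (T.coeff θ).g (φ x₁) / (deriv φ x₁ * θ.g x₁) with hd
  have hform : ∀ θ, ∀ x₀ ∈ I, d θ * δ₁ * δ₃ ≠ 0 ∧
      T.HasForm θ (d θ) δ₁ δ₂ δ₃ 0 δ₅ φ (θ.intInvG x₀) := by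
    intro θ x₀ hx₀
    obtain ⟨δ₀, h1, h2⟩ := hF θ x₀ hx₀
    have : d θ = δ₀ := by
      have h3 := hφ.2.1 x₁ hx₁
      have h4 := θ.g_ne_zero x₁ hx₁
      simp only [hd]
      rw [(h2.2.2.1 x₁ hx₁).2.1]
      field_simp
    rw [this]
    exact ⟨h1, h2⟩
  have hval : ∀ θ θ' : Coeff I, ∀ x ∈ I, θ.val x = θ'.val x → d θ = d θ' := by
    intro θ θ' x hx hv
    have hz : ((t, x, u) : Pt) ∈ box J I K := ⟨ht, hx, hu⟩
    obtain ⟨h1, h2⟩ := hform θ x hx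
    obtain ⟨h1', h2'⟩ := hform θ' x hx
    have hP : (P (t, x, u)).2.1 = φ x := by
      rw [← (hPQ θ _ hz).1, h2.2.1 t ht x hx u hu]
    have e1 := (hPQ θ _ hz).2
    have e2 := (hPQ θ' _ hz).2
    rw [hP] at e1 e2
    have e3 : (T.coeff θ).val (φ x) = (T.coeff θ').val (φ x) := by
      rw [e1, e2]; exact congrArg (Q (t, x, u)) hv
    have e4 : (T.coeff θ).g (φ x) = (T.coeff θ').g (φ x) := congrArg (fun w => w.2.1) e3
    have e5 : θ.g x = θ'.g x := congrArg (fun w => w.2.1) hv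
    rw [(h2.2.2.1 x hx).2.1, (h2'.2.2.1 x hx).2.1, e5] at e4
    refine mul_right_cancel₀ (mul_ne_zero (hφ.2.1 x hx) (θ'.g_ne_zero x hx)) ?_
    linear_combination e4
  classical
  -- κ is the factor for constant elements whose values are the signs themselves. The default 0
  -- concerns zero signs or m = 0, which do not occur.
  refine ⟨fun σ₁ σ₂ σ₃ m => if h : (σ₁ : ℝ) ≠ 0 ∧ (σ₂ : ℝ) ≠ 0 ∧ (σ₃ : ℝ) ≠ 0 ∧ m ≠ 0 then
    d (expCoeff I x₁ 0 0 0 h.1 h.2.1 h.2.2.1 h.2.2.2) else 0, δ₁, δ₂, δ₃, δ₅, φ, hφ,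
    fun θ x₀ hx₀ => ⟨d θ, ?_, hform θ x₀ hx₀⟩⟩
  have hf := θ.f_ne_zero x₀ hx₀
  have hg := θ.g_ne_zero x₀ hx₀
  have hh := θ.h_ne_zero x₀ hx₀
  dsimp only
  rw [dif_pos ⟨sign_cast_ne_zero hf, sign_cast_ne_zero hg, sign_cast_ne_zero hh, θ.m_ne_zero⟩]
  obtain ⟨x₂, hx₂, hne⟩ := hI.exists_ne x₀
  -- The intermediate exponential elements have the values of θ at x₀ and their signs at x₂.
  trans d (expCoeff I x₀ (-Real.log |θ.f x₀| / (x₂ - x₀)) (-Real.log |θ.g x₀| / (x₂ - x₀))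
    (-Real.log |θ.h x₀| / (x₂ - x₀)) hf hg hh θ.m_ne_zero)
  · refine hval _ _ x₀ hx₀ ?_
    rw [expCoeff_val _ _ _ _ _ _ _ _ hx₀]
    simp [Coeff.val]
  · refine hval _ _ x₂ hx₂ ?_
    rw [expCoeff_val _ _ _ _ _ _ _ _ hx₂, expCoeff_val_const _ _ _ _ _ hx₂, mul_exp_eq_sign hf hne,
      mul_exp_eq_sign hg hne, mul_exp_eq_sign hh hne]

/-- What needs proof is the smoothness of Q, that is, of κ in m. It comes from the smoothness of T
along families of constant f, g, h with varying m. -/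
theorem isUsual_of_hasForm {T : Transformation J I K I'} (hI : IsOpenInterval I)
    {κ : SignType → SignType → SignType → ℝ → ℝ} {δ₁ δ₂ δ₃ δ₅ : ℝ} {φ : ℝ → ℝ}
    (hφ : IsChangeOfVariable I I' φ)
    (hF : ∀ θ, ∀ x₀ ∈ I, ∃ δ₀ : ℝ, δ₀ = κ (SignType.sign (θ.f x₀)) (SignType.sign (θ.g x₀))
      (SignType.sign (θ.h x₀)) θ.m ∧ δ₀ * δ₁ * δ₃ ≠ 0 ∧
        T.HasForm θ δ₀ δ₁ δ₂ δ₃ 0 δ₅ φ (θ.intInvG x₀)) : T.IsUsual := by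
  have hκ : ∀ {a b c m : ℝ}, a ≠ 0 → b ≠ 0 → c ≠ 0 → m ≠ 0 → ContDiffAt ℝ ∞
      (κ (SignType.sign a) (SignType.sign b) (SignType.sign c)) m := by
    intro a b c m ha hb hc hm
    obtain ⟨x₀, hx₀⟩ := hI.2.2
    have hε := sign_cast_ne_zero hm
    set ε : ℝ := ((SignType.sign m : SignType) : ℝ)
    -- The curve m = ε e^s, with ε the sign of m, stays away from 0 for all s ∈ ℝ; near m the
    -- parameter is s = log |m|.
    set C : ℝ → Coeff I := fun s =>
      expCoeff I x₀ 0 0 0 ha hb hc (mul_ne_zero hε (Real.exp_ne_zero s)) with hC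
    have hCs : SmoothCurve C := by
      have h1 := smoothCurve_const (expCoeff I x₀ 0 0 0 ha hb hc one_ne_zero)
      exact ⟨h1.1, h1.2.1, h1.2.2.1, contDiff_const.mul Real.contDiff_exp⟩
    have h2 : ContDiff ℝ ∞ fun s => (T.coeff (C s)).g (φ x₀) := by
      have h3 := ContDiffOn.comp (g := fun p : ℝ × ℝ => (T.coeff (C p.1)).g p.2)
        (f := fun s : ℝ => (s, φ x₀)) (s := Set.univ) (T.coeff_smooth C hCs).2.1 (by fun_prop)
        fun s _ => ⟨trivial, hφ.mapsTo hx₀⟩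
      exact contDiffOn_univ.1 h3
    have hval : ∀ s, (C s).f x₀ = a ∧ (C s).g x₀ = b ∧ (C s).h x₀ = c := fun s => by
      have := expCoeff_val_const x₀ ha hb hc (mul_ne_zero hε (Real.exp_ne_zero s)) hx₀
      simp only [Coeff.val, Prod.mk.injEq] at this
      exact ⟨this.1, this.2.1, this.2.2.1⟩
    have h4 : ∀ s, κ (SignType.sign a) (SignType.sign b) (SignType.sign c) (ε * Real.exp s)
        = (T.coeff (C s)).g (φ x₀) / (deriv φ x₀ * b) := by
      intro s
      obtain ⟨δ₀, h5, -, h6⟩ := hF (C s) x₀ hx₀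
      rw [(hval s).1, (hval s).2.1, (hval s).2.2] at h5
      rw [(h6.2.2.1 x₀ hx₀).2.1, h5, (hval s).2.1]
      have := hφ.2.1 x₀ hx₀
      field_simp
      rfl
    have h5 : ContDiffAt ℝ ∞ (fun m => (T.coeff (C (Real.log m))).g (φ x₀) / (deriv φ x₀ * b)) m :=
      (h2.contDiffAt.comp m (Real.contDiffAt_log.2 hm)).div_const _
    refine h5.congr_of_eventuallyEq ?_
    filter_upwards [eventually_sign_eq hm, isOpen_ne.mem_nhds hm] with m' hm' hm0
    rw [← h4, Real.exp_log_eq_abs hm0]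
    congr 1
    rw [show ε = ((SignType.sign m' : SignType) : ℝ) by rw [hm'], sign_mul_abs]
  refine ⟨fun z => (δ₁ * z.1 + δ₂, φ z.2.1, δ₃ * z.2.2 + δ₅), fun z w =>
    (κ (SignType.sign w.1) (SignType.sign w.2.1) (SignType.sign w.2.2.1) w.2.2.2
        * δ₁ / deriv φ z.2.1 * w.1,
      κ (SignType.sign w.1) (SignType.sign w.2.1) (SignType.sign w.2.2.1) w.2.2.2
        * deriv φ z.2.1 * w.2.1,
      κ (SignType.sign w.1) (SignType.sign w.2.1) (SignType.sign w.2.2.1) w.2.2.2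
        * δ₃ / deriv φ z.2.1 * Real.exp (-(w.2.2.2 * δ₅) / δ₃) * w.2.2.1,
      w.2.2.2 / δ₃), ?_, ?_⟩
  · rintro ⟨z, w⟩ ⟨hz, hw1, hw2, hw3, hw4⟩
    apply ContDiffAt.contDiffWithinAt
    have hk : ContDiffAt ℝ ∞ (fun q : Pt × (ℝ × ℝ × ℝ × ℝ) =>
        κ (SignType.sign q.2.1) (SignType.sign q.2.2.1) (SignType.sign q.2.2.2.1) q.2.2.2.2)
        (z, w) := by
      have h1 : ContDiffAt ℝ ∞ (fun q : Pt × (ℝ × ℝ × ℝ × ℝ) =>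
          κ (SignType.sign w.1) (SignType.sign w.2.1) (SignType.sign w.2.2.1) q.2.2.2.2) (z, w) :=
        ContDiffAt.comp (f := fun q : Pt × (ℝ × ℝ × ℝ × ℝ) => q.2.2.2.2) (z, w)
          (hκ hw1 hw2 hw3 hw4) (by fun_prop)
      -- Signs are locally constant at nonzero values, so near (z, w) κ varies only through m.
      refine h1.congr_of_eventuallyEq ?_
      have t1 : Filter.Tendsto (fun q : Pt × (ℝ × ℝ × ℝ × ℝ) => q.2.1) (𝓝 (z, w)) (𝓝 w.1) :=
        Continuous.tendsto (by fun_prop) _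
      have t2 : Filter.Tendsto (fun q : Pt × (ℝ × ℝ × ℝ × ℝ) => q.2.2.1) (𝓝 (z, w)) (𝓝 w.2.1) :=
        Continuous.tendsto (by fun_prop) _
      have t3 : Filter.Tendsto (fun q : Pt × (ℝ × ℝ × ℝ × ℝ) => q.2.2.2.1) (𝓝 (z, w))
        (𝓝 w.2.2.1) := Continuous.tendsto (by fun_prop) _
      filter_upwards [t1.eventually (eventually_sign_eq hw1), t2.eventually (eventually_sign_eq hw2),
        t3.eventually (eventually_sign_eq hw3)] with q h1 h2 h3
      rw [h1, h2, h3]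
    have hφ' : ContDiffAt ℝ ∞ (fun q : Pt × (ℝ × ℝ × ℝ × ℝ) => deriv φ q.1.2.1) (z, w) :=
      ContDiffAt.comp (g := deriv φ) (f := fun q : Pt × (ℝ × ℝ × ℝ × ℝ) => q.1.2.1) (z, w)
        ((hφ.contDiffOn_deriv hI.1).contDiffAt (hI.1.mem_nhds hz.2.1)) (by fun_prop)
    have h0 : deriv φ z.2.1 ≠ 0 := hφ.2.1 _ hz.2.1
    exact (((hk.mul contDiffAt_const).div hφ' h0).mul (by fun_prop)).prodMk
      (((hk.mul hφ').mul (by fun_prop)).prodMk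
        (((((hk.mul contDiffAt_const).div hφ' h0).mul
          (ContDiffAt.exp (by fun_prop))).mul (by fun_prop)).prodMk (by fun_prop)))
  · rintro θ ⟨t, x, u⟩ ⟨ht, hx, hu⟩
    obtain ⟨δ₀, h1, -, h2⟩ := hF θ x hx
    refine ⟨?_, ?_⟩
    · rw [h2.2.1 t ht x hx u hu, zero_mul, zero_add]
    · have h3 := h2.2.2.1 x hx
      simp only [Coeff.val]
      rw [h3.1, h3.2.1, h3.2.2, h2.2.2.2, ← h1, zero_mul, zero_add]

theorem isEquivalence_and_isUsual_iff (hJ : IsOpenInterval J) (hI : IsOpenInterval I)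
    (hK : IsOpenInterval K) (hI' : IsOpenInterval I') (T : Transformation J I K I') :
    (T.IsEquivalence ∧ T.IsUsual) ↔
      ∃ (κ : SignType → SignType → SignType → ℝ → ℝ) (δ₁ δ₂ δ₃ δ₅ : ℝ) (φ : ℝ → ℝ),
        IsChangeOfVariable I I' φ ∧ ∀ θ, ∀ x₀ ∈ I, ∃ δ₀ : ℝ,
          δ₀ = κ (SignType.sign (θ.f x₀)) (SignType.sign (θ.g x₀)) (SignType.sign (θ.h x₀)) θ.m ∧
          δ₀ * δ₁ * δ₃ ≠ 0 ∧ T.HasForm θ δ₀ δ₁ δ₂ δ₃ 0 δ₅ φ (θ.intInvG x₀) := by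
  refine ⟨fun h => h.1.exists_usual_hasForm h.2 hJ hI hK hI', ?_⟩
  rintro ⟨κ, δ₁, δ₂, δ₃, δ₅, φ, hφ, hF⟩
  refine ⟨(T.isEquivalence_iff hJ hI hK hI').2 fun θ => ?_, isUsual_of_hasForm hI hφ hF⟩
  obtain ⟨x₀, hx₀⟩ := hI.2.2
  obtain ⟨δ₀, -, h1, h2⟩ := hF θ x₀ hx₀
  exact ⟨δ₀, δ₁, δ₂, δ₃, 0, δ₅, φ, _, h1, hφ, h2⟩

end Transformation

/-! ### Composition of equivalence transformations. -/

theorem isOpenInterval_univ : IsOpenInterval Set.univ :=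
  ⟨isOpen_univ, Set.ordConnected_univ, Set.univ_nonempty⟩

namespace Transformation

section Composition

variable {I₁ I₂ I₃ : Set ℝ} {T₁ : Transformation Set.univ I₁ Set.univ I₂}
  {T₂ : Transformation Set.univ I₂ Set.univ I₃}

theorem mapsTo_box {J K : Set ℝ} (T : Transformation J I₁ K I₂) (θ : Coeff I₁) :
    Set.MapsTo (T.point θ) (box J I₁ K) (box Set.univ I₂ Set.univ) := fun z hz =>
  ⟨trivial, T.mapsTo_range θ z hz, trivial⟩

/-- The composition of two transformations, where the new space variable of the second one depends
only on the old one. -/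
def comp (hI₁ : IsOpen I₁) (hI₂ : IsOpen I₂) (T₂ : Transformation Set.univ I₂ Set.univ I₃)
    (T₁ : Transformation Set.univ I₁ Set.univ I₂)
    (h : ∀ θ, ∀ z ∈ box Set.univ I₂ Set.univ, ∀ z' ∈ box Set.univ I₂ Set.univ, z.2.1 = z'.2.1 →
      (T₂.point θ z).2.1 = (T₂.point θ z').2.1) : Transformation Set.univ I₁ Set.univ I₃ where
  coeff := T₁.coeff.trans T₂.coeff
  point θ z := T₂.point (T₁.coeff θ) (T₁.point θ z)
  coeff_smooth c hc := T₂.coeff_smooth _ (T₁.coeff_smooth c hc)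
  coeff_symm_smooth c hc := T₁.coeff_symm_smooth _ (T₂.coeff_symm_smooth c hc)
  point_smooth c hc := ContDiffOn.comp (g := fun q : ℝ × Pt => T₂.point (T₁.coeff (c q.1)) q.2)
    (f := fun q : ℝ × Pt => (q.1, T₁.point (c q.1) q.2)) (T₂.point_smooth _ (T₁.coeff_smooth c hc))
    (contDiffOn_fst.prodMk (T₁.point_smooth c hc)) fun q hq => ⟨trivial, T₁.mapsTo_box _ hq.2⟩
  nondegenerate θ z hz := by
    have hz' := T₁.mapsTo_box θ hz
    have d₁ := ((T₁.contDiffOn_point θ).contDiffAt ((isOpen_box isOpen_univ hI₁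
      isOpen_univ).mem_nhds hz)).differentiableAt (by simp)
    have d₂ := ((T₂.contDiffOn_point (T₁.coeff θ)).contDiffAt ((isOpen_box isOpen_univ hI₂
      isOpen_univ).mem_nhds hz')).differentiableAt (by simp)
    rw [show (fun z => T₂.point (T₁.coeff θ) (T₁.point θ z)) = T₂.point (T₁.coeff θ) ∘ T₁.point θ
      from rfl, fderiv_comp z d₂ d₁]
    exact (T₂.nondegenerate _ _ hz').comp (T₁.nondegenerate θ z hz)
  range_x θ := by
    apply Set.Subset.antisymm
    · rintro _ ⟨z, hz, rfl⟩
      exact T₂.mapsTo_range _ _ (T₁.mapsTo_box θ hz)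
    · intro x hx
      obtain ⟨z', hz', rfl⟩ := (T₂.range_x (T₁.coeff θ)).ge hx
      obtain ⟨z, hz, hzz⟩ := (T₁.range_x θ).ge hz'.2.1
      exact ⟨z, hz, h _ _ (T₁.mapsTo_box θ hz) _ hz' hzz⟩

/-- From g'(φ) = δ₀ φ_x g one gets dx' / g' = dx / (δ₀ g), hence G'(φ) = G / δ₀ + const. This
explains the term δ₄' / δ₀; the integration constant goes into the last parameter. -/
theorem HasForm.comp {T : Transformation Set.univ I₁ Set.univ I₃} (hI₁ : IsOpenInterval I₁)
    (hI₂ : IsOpen I₂) {θ : Coeff I₁} (hc : T.coeff θ = T₂.coeff (T₁.coeff θ))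
    (hp : ∀ z ∈ box Set.univ I₁ Set.univ,
      T.point θ z = T₂.point (T₁.coeff θ) (T₁.point θ z))
    {δ₀ δ₁ δ₂ δ₃ δ₄ δ₅ δ₀' δ₁' δ₂' δ₃' δ₄' δ₅' : ℝ} {φ G φ' G' : ℝ → ℝ} (hδ₀ : δ₀ ≠ 0)
    (hδ₃ : δ₃ ≠ 0) (hδ₃' : δ₃' ≠ 0) (hφ : IsChangeOfVariable I₁ I₂ φ)
    (hφ' : IsChangeOfVariable I₂ I₃ φ') (h₁ : T₁.HasForm θ δ₀ δ₁ δ₂ δ₃ δ₄ δ₅ φ G)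
    (h₂ : T₂.HasForm (T₁.coeff θ) δ₀' δ₁' δ₂' δ₃' δ₄' δ₅' φ' G') :
    ∃ δ₅'', T.HasForm θ (δ₀ * δ₀') (δ₁ * δ₁') (δ₁' * δ₂ + δ₂') (δ₃ * δ₃')
      (δ₃' * δ₄ + δ₄' / δ₀) δ₅'' (φ' ∘ φ) G := by
  obtain ⟨x₀, hx₀⟩ := hI₁.2.2
  have hG : ∀ x ∈ I₁, G' (φ x) = G x / δ₀ + (G' (φ x₀) - G x₀ / δ₀) := by
    intro x hx
    have := hI₁.eq_of_deriv_eq_zero (k := fun x => G' (φ x) - G x / δ₀) (fun y hy => by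
      have h3 := (h₂.1 (φ y) (hφ.mapsTo hy)).comp y (hφ.hasDerivAt hI₁.1 hy)
      have h4 := h3.sub ((h₁.1 y hy).div_const δ₀)
      have h5 : 1 / (T₁.coeff θ).g (φ y) * deriv φ y - 1 / θ.g y / δ₀ = 0 := by
        rw [(h₁.2.2.1 y hy).2.1]
        have := hφ.2.1 y hy
        have := θ.g_ne_zero y hy
        field_simp
        ring
      rwa [h5] at h4) hx hx₀
    linarith
  refine ⟨δ₃' * δ₅ + δ₅' + δ₄' * (G' (φ x₀) - G x₀ / δ₀), h₁.1, fun t ht x hx u hu => ?_,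
    fun x hx => ?_, ?_⟩
  · rw [hp _ ⟨ht, hx, hu⟩, h₁.2.1 t ht x hx u hu, h₂.2.1 _ trivial _ (hφ.mapsTo hx) _ trivial,
      hG x hx]
    simp only [Function.comp_apply, Prod.mk.injEq, true_and]
    constructor <;> ring
  · obtain ⟨a₁, a₂, a₃⟩ := h₁.2.2.1 x hx
    obtain ⟨b₁, b₂, b₃⟩ := h₂.2.2.1 (φ x) (hφ.mapsTo hx)
    have hd := hφ.2.1 x hx
    have hd' := hφ'.2.1 (φ x) (hφ.mapsTo hx)
    rw [Function.comp_apply, (hφ.comp hI₁.1 hI₂ hφ').2 x hx, hc, b₁, b₂, b₃, a₁, a₂, a₃,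
      h₁.2.2.2, hG x hx]
    refine ⟨by field_simp, by ring, ?_⟩
    set c := G' (φ x₀) - G x₀ / δ₀
    have he : Real.exp (-(θ.m / δ₃ * (δ₄' * (G x / δ₀ + c) + δ₅')) / δ₃')
        * Real.exp (-(θ.m * (δ₄ * G x + δ₅)) / δ₃)
        = Real.exp (-(θ.m * ((δ₃' * δ₄ + δ₄' / δ₀) * G x + (δ₃' * δ₅ + δ₅' + δ₄' * c)))
          / (δ₃ * δ₃')) := by
      rw [← Real.exp_add]
      congr 1
      field_simp
      ring
    rw [← he]
    field_simp
  · rw [hc, h₂.2.2.2, h₁.2.2.2, div_div]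

theorem IsEquivalence.comp (hI₁ : IsOpenInterval I₁) (hI₂ : IsOpenInterval I₂)
    (hI₃ : IsOpenInterval I₃) {T : Transformation Set.univ I₁ Set.univ I₃}
    (hc : ∀ θ, T.coeff θ = T₂.coeff (T₁.coeff θ))
    (hp : ∀ θ, ∀ z ∈ box Set.univ I₁ Set.univ,
      T.point θ z = T₂.point (T₁.coeff θ) (T₁.point θ z))
    (h₁ : T₁.IsEquivalence) (h₂ : T₂.IsEquivalence) : T.IsEquivalence := by
  refine (T.isEquivalence_iff isOpenInterval_univ hI₁ isOpenInterval_univ hI₃).2 fun θ => ?_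
  obtain ⟨δ₀, δ₁, δ₂, δ₃, δ₄, δ₅, φ, G, hδ, hφ, hF⟩ :=
    (T₁.isEquivalence_iff isOpenInterval_univ hI₁ isOpenInterval_univ hI₂).1 h₁ θ
  obtain ⟨δ₀', δ₁', δ₂', δ₃', δ₄', δ₅', φ', G', hδ', hφ', hF'⟩ :=
    (T₂.isEquivalence_iff isOpenInterval_univ hI₂ isOpenInterval_univ hI₃).1 h₂ (T₁.coeff θ)
  obtain ⟨δ₅'', h⟩ := hF.comp hI₁ hI₂.1 (hc θ) (hp θ) (left_ne_zero_of_mul (left_ne_zero_of_mul hδ))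
    (right_ne_zero_of_mul hδ) (right_ne_zero_of_mul hδ') hφ hφ' hF'
  refine ⟨_, _, _, _, _, _, _, _, ?_, (hφ.comp hI₁.1 hI₂.1 hφ').1, h⟩
  convert mul_ne_zero hδ hδ' using 1
  ring

/-- Composing Q₂ with Q₁ requires that Q₁ takes values without zero components. Every admissible
argument w is attained by constant arbitrary elements, whose images have no zeros. -/
theorem IsUsual.comp (hI₁ : IsOpenInterval I₁) {T : Transformation Set.univ I₁ Set.univ I₃}
    (hc : ∀ θ, T.coeff θ = T₂.coeff (T₁.coeff θ))
    (hp : ∀ θ, ∀ z ∈ box Set.univ I₁ Set.univ,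
      T.point θ z = T₂.point (T₁.coeff θ) (T₁.point θ z))
    (h₁ : T₁.IsUsual) (h₂ : T₂.IsUsual) : T.IsUsual := by
  obtain ⟨P₁, Q₁, hQ₁, hPQ₁⟩ := h₁
  obtain ⟨P₂, Q₂, hQ₂, hPQ₂⟩ := h₂
  obtain ⟨x₀, hx₀⟩ := hI₁.2.2
  set θ₀ : Coeff I₁ := expCoeff I₁ x₀ 0 0 0 one_ne_zero one_ne_zero one_ne_zero one_ne_zero
  have hP₁ : ContDiffOn ℝ ∞ P₁ (box Set.univ I₁ Set.univ) :=
    (T₁.contDiffOn_point θ₀).congr fun z hz => ((hPQ₁ θ₀ z hz).1).symm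
  have hm : Set.MapsTo P₁ (box Set.univ I₁ Set.univ) (box Set.univ I₂ Set.univ) := fun z hz => by
    rw [← (hPQ₁ θ₀ z hz).1]; exact T₁.mapsTo_box θ₀ hz
  refine ⟨fun z => P₂ (P₁ z), fun z w => Q₂ (P₁ z) (Q₁ z w), ?_, fun θ z hz => ⟨?_, ?_⟩⟩
  · refine ContDiffOn.comp (g := fun q : Pt × (ℝ × ℝ × ℝ × ℝ) => Q₂ q.1 q.2)
      (f := fun q : Pt × (ℝ × ℝ × ℝ × ℝ) => (P₁ q.1, Q₁ q.1 q.2)) hQ₂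
      ((hP₁.comp contDiffOn_fst fun q hq => hq.1).prodMk hQ₁) ?_
    rintro ⟨z, a, b, d, m⟩ ⟨hz, ha, hb, hd, hm0⟩
    refine ⟨hm hz, ?_⟩
    set θ : Coeff I₁ := expCoeff I₁ x₀ 0 0 0 ha hb hd hm0
    have h1 := (hPQ₁ θ z hz).2
    rw [expCoeff_val_const x₀ ha hb hd hm0 hz.2.1] at h1
    have hx := (hm hz).2.1
    dsimp only
    rw [← h1]
    exact ⟨(T₁.coeff θ).f_ne_zero _ hx, (T₁.coeff θ).g_ne_zero _ hx, (T₁.coeff θ).h_ne_zero _ hx,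
      (T₁.coeff θ).m_ne_zero⟩
  · rw [hp θ z hz, (hPQ₁ θ z hz).1, (hPQ₂ _ _ (hm hz)).1]
  · rw [hc, (hPQ₂ _ _ (hm hz)).2, (hPQ₁ θ z hz).2]

theorem IsEquivalence.exists_comp (hI₁ : IsOpenInterval I₁) (hI₂ : IsOpenInterval I₂)
    (hI₃ : IsOpenInterval I₃) (h₁ : T₁.IsEquivalence) (h₂ : T₂.IsEquivalence) :
    ∃ T : Transformation Set.univ I₁ Set.univ I₃, T.IsEquivalence ∧
      T.coeff = T₁.coeff.trans T₂.coeff ∧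
      (∀ θ, ∀ z ∈ box Set.univ I₁ Set.univ,
        T.point θ z = T₂.point (T₁.coeff θ) (T₁.point θ z)) ∧
      (T₁.IsUsual → T₂.IsUsual → T.IsUsual) := by
  have hx : ∀ θ, ∀ z ∈ box Set.univ I₂ Set.univ, ∀ z' ∈ box Set.univ I₂ Set.univ, z.2.1 = z'.2.1 →
      (T₂.point θ z).2.1 = (T₂.point θ z').2.1 := by
    rintro θ ⟨t, x, u⟩ hz ⟨t', x', u'⟩ hz' rfl
    obtain ⟨_, _, _, _, _, _, φ, _, -, -, hF⟩ :=
      (T₂.isEquivalence_iff isOpenInterval_univ hI₂ isOpenInterval_univ hI₃).1 h₂ θ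
    rw [hF.2.1 t trivial x hz.2.1 u trivial, hF.2.1 t' trivial x hz.2.1 u' trivial]
  exact ⟨T₂.comp hI₁.1 hI₂.1 T₁ hx, h₁.comp hI₁ hI₂ hI₃ (fun _ => rfl) (fun _ _ _ => rfl) h₂, rfl,
    fun _ _ _ => rfl, IsUsual.comp hI₁ (fun _ => rfl) fun _ _ _ => rfl⟩

end Composition

end Transformation

/-! ### Inversion of equivalence transformations. -/

namespace Transformation

variable {I₁ I₂ : Set ℝ} {T : Transformation Set.univ I₁ Set.univ I₂}

section PointInverse

variable {θ : Coeff I₁} {δ₀ δ₁ δ₂ δ₃ δ₄ δ₅ : ℝ} {φ G : ℝ → ℝ}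

theorem HasForm.injOn (hI₁ : IsOpenInterval I₁) (hδ₁ : δ₁ ≠ 0) (hδ₃ : δ₃ ≠ 0)
    (hφ : IsChangeOfVariable I₁ I₂ φ) (h : T.HasForm θ δ₀ δ₁ δ₂ δ₃ δ₄ δ₅ φ G) :
    Set.InjOn (T.point θ) (box Set.univ I₁ Set.univ) := by
  rintro ⟨t, x, u⟩ hz ⟨t', x', u'⟩ hz' heq
  rw [h.2.1 t trivial x hz.2.1 u trivial, h.2.1 t' trivial x' hz'.2.1 u' trivial] at heq
  simp only [Prod.mk.injEq] at heq
  obtain ⟨h1, h2, h3⟩ := heq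
  obtain rfl := hφ.injOn hI₁ hz.2.1 hz'.2.1 h2
  rw [mul_left_cancel₀ hδ₁ (add_right_cancel h1), mul_left_cancel₀ hδ₃ (add_right_cancel h3)]

/-- The inverse of a point transformation of the given form. -/
theorem HasForm.point_inverse (hδ₁ : δ₁ ≠ 0) (hδ₃ : δ₃ ≠ 0)
    (hφ : IsChangeOfVariable I₁ I₂ φ) (h : T.HasForm θ δ₀ δ₁ δ₂ δ₃ δ₄ δ₅ φ G) (t u : ℝ) {x : ℝ}
    (hx : x ∈ I₂) :
    T.point θ (1 / δ₁ * t + -δ₂ / δ₁, Function.invFunOn φ I₁ x,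
      1 / δ₃ * u + -(δ₄ * G (Function.invFunOn φ I₁ x) + δ₅) / δ₃) = (t, x, u) := by
  rw [h.2.1 _ trivial _ (hφ.inv_mem hx) _ trivial, hφ.apply_inv hx]
  simp only [Prod.mk.injEq, true_and]
  constructor <;> field_simp <;> ring

theorem HasForm.invFunOn_point (hI₁ : IsOpenInterval I₁) (hδ₁ : δ₁ ≠ 0) (hδ₃ : δ₃ ≠ 0)
    (hφ : IsChangeOfVariable I₁ I₂ φ) (h : T.HasForm θ δ₀ δ₁ δ₂ δ₃ δ₄ δ₅ φ G) (t u : ℝ) {x : ℝ}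
    (hx : x ∈ I₂) :
    Function.invFunOn (T.point θ) (box Set.univ I₁ Set.univ) (t, x, u)
      = (1 / δ₁ * t + -δ₂ / δ₁, Function.invFunOn φ I₁ x,
        1 / δ₃ * u + -(δ₄ * G (Function.invFunOn φ I₁ x) + δ₅) / δ₃) := by
  have hb : ((1 / δ₁ * t + -δ₂ / δ₁, Function.invFunOn φ I₁ x,
      1 / δ₃ * u + -(δ₄ * G (Function.invFunOn φ I₁ x) + δ₅) / δ₃) : Pt)
      ∈ box Set.univ I₁ Set.univ := ⟨trivial, hφ.inv_mem hx, trivial⟩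
  have hex : ∃ z ∈ box Set.univ I₁ Set.univ, T.point θ z = (t, x, u) :=
    ⟨_, hb, h.point_inverse hδ₁ hδ₃ hφ t u hx⟩
  refine h.injOn hI₁ hδ₁ hδ₃ hφ (Function.invFunOn_mem hex) hb ?_
  rw [Function.invFunOn_eq hex, h.point_inverse hδ₁ hδ₃ hφ t u hx]

/-- As dx' / g' = dx / (δ₀ g), an antiderivative of 1 / g' is G ∘ φ⁻¹ / δ₀. Solving u' = δ₃ u + δ₄ G
+ δ₅ for u in terms of it gives the coefficient -δ₄ δ₀ / δ₃. -/
theorem HasForm.inverse {S : Transformation Set.univ I₂ Set.univ I₁} {θ' : Coeff I₂}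
    (hI₁ : IsOpenInterval I₁) (hI₂ : IsOpen I₂)
    (hδ₀ : δ₀ ≠ 0) (hδ₁ : δ₁ ≠ 0) (hδ₃ : δ₃ ≠ 0)
    (hφ : IsChangeOfVariable I₁ I₂ φ) (h : T.HasForm θ δ₀ δ₁ δ₂ δ₃ δ₄ δ₅ φ G)
    (hT : T.coeff θ = θ') (hS : S.coeff θ' = θ)
    (hp : ∀ z ∈ box Set.univ I₂ Set.univ,
      S.point θ' z = Function.invFunOn (T.point θ) (box Set.univ I₁ Set.univ) z) :
    S.HasForm θ' (1 / δ₀) (1 / δ₁) (-δ₂ / δ₁) (1 / δ₃) (-δ₄ * δ₀ / δ₃) (-δ₅ / δ₃)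
      (Function.invFunOn φ I₁) (fun x => G (Function.invFunOn φ I₁ x) / δ₀) := by
  subst hT
  refine ⟨fun x' hx' => ?_, fun t _ x hx u _ => ?_, fun x' hx' => ?_, ?_⟩
  · obtain ⟨x, hx, rfl⟩ := hφ.2.2.ge hx'
    have h1 := HasDerivAt.comp (h₂ := G) (φ x) (by rw [hφ.inv_apply hI₁ hx]; exact h.1 x hx)
      (hφ.hasDerivAt_inv hI₁ hI₂ hx)
    have h2 := h1.div_const δ₀
    have h3 : 1 / θ.g x * (1 / deriv φ x) / δ₀ = 1 / (T.coeff θ).g (φ x) := by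
      rw [(h.2.2.1 x hx).2.1]
      have := hφ.2.1 x hx
      have := θ.g_ne_zero x hx
      field_simp
    rwa [h3] at h2
  · rw [hp _ ⟨trivial, hx, trivial⟩, h.invFunOn_point hI₁ hδ₁ hδ₃ hφ t u hx]
    simp only [Prod.mk.injEq, true_and]
    field_simp
    ring
  · obtain ⟨x, hx, rfl⟩ := hφ.2.2.ge hx'
    obtain ⟨a₁, a₂, a₃⟩ := h.2.2.1 x hx
    have hd := hφ.2.1 x hx
    beta_reduce
    rw [hS, (hφ.hasDerivAt_inv hI₁ hI₂ hx).deriv, hφ.inv_apply hI₁ hx, a₁, a₂, a₃, h.2.2.2]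
    refine ⟨by field_simp, by field_simp, ?_⟩
    have he : Real.exp (-(θ.m / δ₃ * (-δ₄ * δ₀ / δ₃ * (G x / δ₀) + -δ₅ / δ₃)) / (1 / δ₃))
        * Real.exp (-(θ.m * (δ₄ * G x + δ₅)) / δ₃) = 1 := by
      rw [← Real.exp_add, Real.exp_eq_one_iff]
      field_simp
      ring
    symm
    calc _ = 1 / δ₀ * (1 / δ₃) / (1 / deriv φ x) * (δ₀ * δ₃ / deriv φ x)
          * (Real.exp (-(θ.m / δ₃ * (-δ₄ * δ₀ / δ₃ * (G x / δ₀) + -δ₅ / δ₃)) / (1 / δ₃))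
            * Real.exp (-(θ.m * (δ₄ * G x + δ₅)) / δ₃)) * θ.h x := by ring
      _ = _ := by rw [he]; field_simp
  · rw [hS, h.2.2.2]
    field_simp

end PointInverse

/-- A smooth family of bijective nondegenerate point transformations has a smooth family of
inverses. -/
theorem contDiffOn_invFunOn_family {B B' : Set Pt} (hB : IsOpen B) {Φ : ℝ → Pt → Pt}
    (hΦ : ContDiffOn ℝ ∞ (fun q : ℝ × Pt => Φ q.1 q.2) (Set.univ ×ˢ B))
    (hinj : ∀ s, Set.InjOn (Φ s) B) (himg : ∀ s, Φ s '' B = B')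
    (hinv : ∀ s, ∀ z ∈ B, (fderiv ℝ (Φ s) z).IsInvertible) :
    ContDiffOn ℝ ∞ (fun q : ℝ × Pt => Function.invFunOn (Φ q.1) B q.2) (Set.univ ×ˢ B') := by
  -- Adjoining the parameter as a coordinate gives one injective map with block triangular
  -- invertible derivative, so the inverse is smooth in the parameter and the point jointly.
  set F : ℝ × Pt → ℝ × Pt := fun q => (q.1, Φ q.1 q.2) with hF
  have hΩ : IsOpen (Set.univ ×ˢ B : Set (ℝ × Pt)) := isOpen_univ.prod hB
  have hFs : ContDiffOn ℝ ∞ F (Set.univ ×ˢ B) := contDiffOn_fst.prodMk hΦ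
  have hFi : Set.InjOn F (Set.univ ×ˢ B) := by
    rintro ⟨s, z⟩ hz ⟨s', z'⟩ hz' heq
    simp only [hF, Prod.mk.injEq] at heq
    obtain ⟨rfl, h⟩ := heq
    exact congrArg (Prod.mk s) (hinj s hz.2 hz'.2 h)
  have hFd : ∀ q ∈ (Set.univ ×ˢ B : Set (ℝ × Pt)), (fderiv ℝ F q).IsInvertible := by
    rintro ⟨s, z⟩ hz
    have hd : HasFDerivAt (fun q : ℝ × Pt => Φ q.1 q.2)
        (fderiv ℝ (fun q : ℝ × Pt => Φ q.1 q.2) (s, z)) (s, z) :=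
      ((hΦ.contDiffAt (hΩ.mem_nhds hz)).differentiableAt (by simp)).hasFDerivAt
    have hd' : HasFDerivAt F _ (s, z) := hasFDerivAt_fst.prodMk hd
    have hs : HasFDerivAt (Φ s) _ z :=
      HasFDerivAt.comp (g := fun q : ℝ × Pt => Φ q.1 q.2) (f := fun z : Pt => (s, z)) z hd
        (hasFDerivAt_prodMk_right s z)
    rw [hd'.fderiv]
    apply isInvertible_of_injective
    rw [injective_iff_map_eq_zero]
    rintro ⟨τ, ζ⟩ h0
    simp only [ContinuousLinearMap.prod_apply, ContinuousLinearMap.coe_fst', Prod.mk_eq_zero] at h0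
    obtain ⟨rfl, h1⟩ := h0
    have h2 : fderiv ℝ (Φ s) z ζ = 0 := by
      rw [hs.fderiv]; exact h1
    rw [(hinv s z hz.2).injective (h2.trans (map_zero _).symm)]
    rfl
  have himgF : F '' (Set.univ ×ˢ B) = Set.univ ×ˢ B' := by
    apply Set.Subset.antisymm
    · rintro _ ⟨q, hq, rfl⟩
      exact ⟨trivial, (himg q.1).le ⟨q.2, hq.2, rfl⟩⟩
    · rintro ⟨s, z'⟩ ⟨-, hz'⟩
      obtain ⟨z, hz, rfl⟩ := (himg s).ge hz'
      exact ⟨(s, z), ⟨trivial, hz⟩, rfl⟩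
  have h1 := contDiffOn_invFunOn hΩ hFs hFi hFd
  rw [himgF] at h1
  refine h1.snd.congr ?_
  rintro ⟨s, z'⟩ ⟨-, hz'⟩
  have hex : ∃ z ∈ B, Φ s z = z' := (himg s).ge hz'
  have hm : ((s, Function.invFunOn (Φ s) B z') : ℝ × Pt) ∈ (Set.univ ×ˢ B : Set (ℝ × Pt)) :=
    ⟨trivial, Function.invFunOn_mem hex⟩
  have he : F (s, Function.invFunOn (Φ s) B z') = (s, z') := by
    simp only [hF, Function.invFunOn_eq hex]
  have hex' : ∃ q ∈ (Set.univ ×ˢ B : Set (ℝ × Pt)), F q = (s, z') := ⟨_, hm, he⟩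
  have := hFi hm (Function.invFunOn_mem hex') (he.trans (Function.invFunOn_eq hex').symm)
  exact congrArg Prod.snd this

/-- The parameters of an equivalence transformation. -/
theorem IsEquivalence.hasForm (hI₁ : IsOpenInterval I₁) (hI₂ : IsOpenInterval I₂)
    (hT : T.IsEquivalence) (θ : Coeff I₁) :
    ∃ (δ₀ δ₁ δ₂ δ₃ δ₄ δ₅ : ℝ) (φ G : ℝ → ℝ), δ₀ ≠ 0 ∧ δ₁ ≠ 0 ∧ δ₃ ≠ 0 ∧
      IsChangeOfVariable I₁ I₂ φ ∧ T.HasForm θ δ₀ δ₁ δ₂ δ₃ δ₄ δ₅ φ G := by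
  obtain ⟨δ₀, δ₁, δ₂, δ₃, δ₄, δ₅, φ, G, hδ, hφ, hF⟩ :=
    (T.isEquivalence_iff isOpenInterval_univ hI₁ isOpenInterval_univ hI₂).1 hT θ
  exact ⟨δ₀, δ₁, δ₂, δ₃, δ₄, δ₅, φ, G, left_ne_zero_of_mul (left_ne_zero_of_mul hδ),
    right_ne_zero_of_mul (left_ne_zero_of_mul hδ), right_ne_zero_of_mul hδ, hφ, hF⟩

theorem IsEquivalence.injOn_point (hI₁ : IsOpenInterval I₁) (hI₂ : IsOpenInterval I₂)
    (hT : T.IsEquivalence) (θ : Coeff I₁) :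
    Set.InjOn (T.point θ) (box Set.univ I₁ Set.univ) := by
  obtain ⟨δ₀, δ₁, δ₂, δ₃, δ₄, δ₅, φ, G, -, hδ₁, hδ₃, hφ, hF⟩ := hT.hasForm hI₁ hI₂ θ
  exact hF.injOn hI₁ hδ₁ hδ₃ hφ

theorem IsEquivalence.image_point (hI₁ : IsOpenInterval I₁) (hI₂ : IsOpenInterval I₂)
    (hT : T.IsEquivalence) (θ : Coeff I₁) :
    T.point θ '' box Set.univ I₁ Set.univ = box Set.univ I₂ Set.univ := by
  obtain ⟨δ₀, δ₁, δ₂, δ₃, δ₄, δ₅, φ, G, -, hδ₁, hδ₃, hφ, hF⟩ := hT.hasForm hI₁ hI₂ θ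
  apply Set.Subset.antisymm
  · exact (T.mapsTo_box θ).image_subset
  · rintro ⟨t, x, u⟩ ⟨-, hx, -⟩
    exact ⟨_, ⟨trivial, hφ.inv_mem hx, trivial⟩, hF.point_inverse hδ₁ hδ₃ hφ t u hx⟩

/-- The inverse of an equivalence transformation. -/
noncomputable def inverse (hI₁ : IsOpenInterval I₁) (hI₂ : IsOpenInterval I₂)
    (T : Transformation Set.univ I₁ Set.univ I₂) (hT : T.IsEquivalence) :
    Transformation Set.univ I₂ Set.univ I₁ where
  coeff := T.coeff.symm
  point θ' := Function.invFunOn (T.point (T.coeff.symm θ')) (box Set.univ I₁ Set.univ)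
  coeff_smooth := T.coeff_symm_smooth
  coeff_symm_smooth := T.coeff_smooth
  point_smooth c hc := contDiffOn_invFunOn_family (isOpen_box isOpen_univ hI₁.1 isOpen_univ)
    (Φ := fun s => T.point (T.coeff.symm (c s))) (T.point_smooth _ (T.coeff_symm_smooth c hc))
    (fun _ => hT.injOn_point hI₁ hI₂ _) (fun _ => hT.image_point hI₁ hI₂ _)
    fun _ => T.nondegenerate _
  nondegenerate θ' := by
    obtain ⟨δ₀, δ₁, δ₂, δ₃, δ₄, δ₅, φ, G, -, hδ₁, hδ₃, hφ, hF⟩ :=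
      hT.hasForm hI₁ hI₂ (T.coeff.symm θ')
    refine isInvertible_fderiv_of_form isOpen_univ hI₂.1 isOpen_univ (one_div_ne_zero hδ₁)
      (one_div_ne_zero hδ₃) (hφ.inv hI₁ hI₂.1) (fun x' hx' => ?_)
      fun t _ x hx u _ => hF.invFunOn_point hI₁ hδ₁ hδ₃ hφ t u hx
    obtain ⟨x, hx, rfl⟩ := hφ.2.2.ge hx'
    have h1 := HasDerivAt.comp (h₂ := G) (φ x) (by rw [hφ.inv_apply hI₁ hx]; exact hF.1 x hx)
      (hφ.hasDerivAt_inv hI₁ hI₂.1 hx)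
    exact (((h1.const_mul δ₄).add_const δ₅).neg.div_const δ₃).differentiableAt
  range_x θ' := by
    obtain ⟨δ₀, δ₁, δ₂, δ₃, δ₄, δ₅, φ, G, -, hδ₁, hδ₃, hφ, hF⟩ :=
      hT.hasForm hI₁ hI₂ (T.coeff.symm θ')
    have hχ := (hφ.inv hI₁ hI₂.1).2.2
    apply Set.Subset.antisymm
    · rintro _ ⟨⟨t, x, u⟩, ⟨-, hx, -⟩, rfl⟩
      dsimp only
      rw [hF.invFunOn_point hI₁ hδ₁ hδ₃ hφ t u hx]
      exact hφ.inv_mem hx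
    · intro y hy
      obtain ⟨x, hx, rfl⟩ := hχ.ge hy
      refine ⟨(0, x, 0), ⟨trivial, hx, trivial⟩, ?_⟩
      dsimp only
      rw [hF.invFunOn_point hI₁ hδ₁ hδ₃ hφ 0 0 hx]

theorem IsEquivalence.inverse (hI₁ : IsOpenInterval I₁) (hI₂ : IsOpenInterval I₂)
    (hT : T.IsEquivalence) : (T.inverse hI₁ hI₂ hT).IsEquivalence := by
  refine ((T.inverse hI₁ hI₂ hT).isEquivalence_iff isOpenInterval_univ hI₂ isOpenInterval_univ
    hI₁).2 fun θ' => ?_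
  obtain ⟨δ₀, δ₁, δ₂, δ₃, δ₄, δ₅, φ, G, hδ₀, hδ₁, hδ₃, hφ, hF⟩ :=
    hT.hasForm hI₁ hI₂ (T.coeff.symm θ')
  exact ⟨_, _, _, _, _, _, _, _, mul_ne_zero (mul_ne_zero (one_div_ne_zero hδ₀)
    (one_div_ne_zero hδ₁)) (one_div_ne_zero hδ₃), hφ.inv hI₁ hI₂.1,
    hF.inverse hI₁ hI₂.1 hδ₀ hδ₁ hδ₃ hφ (T.coeff.apply_symm_apply θ') rfl fun _ _ => rfl⟩

end Transformation

/-- The multiples of arbitrary elements. -/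
noncomputable def Coeff.scale {I : Set ℝ} (θ : Coeff I) {r : ℝ} (hr : r ≠ 0) : Coeff I where
  f x := r * θ.f x
  g x := r * θ.g x
  h x := r * θ.h x
  m := θ.m
  f_smooth := contDiffOn_const.mul θ.f_smooth
  g_smooth := contDiffOn_const.mul θ.g_smooth
  h_smooth := contDiffOn_const.mul θ.h_smooth
  f_ne_zero x hx := mul_ne_zero hr (θ.f_ne_zero x hx)
  g_ne_zero x hx := mul_ne_zero hr (θ.g_ne_zero x hx)
  h_ne_zero x hx := mul_ne_zero hr (θ.h_ne_zero x hx)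
  m_ne_zero := θ.m_ne_zero
  f_off x hx := by rw [θ.f_off x hx, mul_zero]
  g_off x hx := by rw [θ.g_off x hx, mul_zero]
  h_off x hx := by rw [θ.h_off x hx, mul_zero]

/-- Here a and b are the factors δ₀ of two sets of arbitrary elements. Equal signs of the
transformed values become equal signs after the first set is rescaled by a / b; the common factor e
drops out. -/
theorem sign_div_mul_eq {a b e p q : ℝ} (hb : b ≠ 0) (ha : a ≠ 0) (he : e ≠ 0) (hp : p ≠ 0)
    (hq : q ≠ 0) (h : SignType.sign (a * e * p) = SignType.sign (b * e * q)) :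
    SignType.sign (a / b * p) = SignType.sign q := by
  rw [sign_eq_sign_iff_mul_pos (mul_ne_zero (mul_ne_zero ha he) hp)
    (mul_ne_zero (mul_ne_zero hb he) hq)] at h
  rw [sign_eq_sign_iff_mul_pos (mul_ne_zero (div_ne_zero ha hb) hp) hq]
  have h1 : a / b * p * q = a * e * p * (b * e * q) / (b * e) ^ 2 := by field_simp
  rw [h1]
  exact div_pos h (by positivity)

namespace Transformation

variable {I₁ I₂ : Set ℝ} {T : Transformation Set.univ I₁ Set.univ I₂}

/-- The factor of the inverse is 1 / δ₀, so δ₀ has to be a function of the signs and m' of the new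
arbitrary elements. If the images of θ and θ₁ agree in these data, then rescaling θ by r, the ratio
of their factors δ₀, gives elements with the signs and m of θ₁, hence with its factor. The rescaled
elements have the same image as θ, so injectivity gives r = 1 and the factors are equal. -/
theorem IsUsual.inverse (hI₁ : IsOpenInterval I₁) (hI₂ : IsOpenInterval I₂)
    (hT : T.IsEquivalence) (hU : T.IsUsual) : (T.inverse hI₁ hI₂ hT).IsUsual := by
  obtain ⟨κ, δ₁, δ₂, δ₃, δ₅, φ, hφ, hF⟩ :=
    hT.exists_usual_hasForm hU isOpenInterval_univ hI₁ isOpenInterval_univ hI₂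
  obtain ⟨x₁, hx₁⟩ := hI₁.2.2
  set d : Coeff I₁ → ℝ := fun θ => κ (SignType.sign (θ.f x₁)) (SignType.sign (θ.g x₁))
    (SignType.sign (θ.h x₁)) θ.m with hd
  have hform : ∀ θ, d θ * δ₁ * δ₃ ≠ 0 ∧
      T.HasForm θ (d θ) δ₁ δ₂ δ₃ 0 δ₅ φ (θ.intInvG x₁) := fun θ => by
    obtain ⟨δ₀, rfl, h1, h2⟩ := hF θ x₁ hx₁
    exact ⟨h1, h2⟩
  have hd0 : ∀ θ, d θ ≠ 0 := fun θ => left_ne_zero_of_mul (left_ne_zero_of_mul (hform θ).1)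
  have hδ₁ : δ₁ ≠ 0 := right_ne_zero_of_mul (left_ne_zero_of_mul
    (hform (expCoeff I₁ x₁ 0 0 0 one_ne_zero one_ne_zero one_ne_zero one_ne_zero)).1)
  have hδ₃ : δ₃ ≠ 0 := right_ne_zero_of_mul
    (hform (expCoeff I₁ x₁ 0 0 0 one_ne_zero one_ne_zero one_ne_zero one_ne_zero)).1
  -- δ₀ is determined by g' at x₁, so κ gives the same value at every point x of I₁.
  have hdx : ∀ θ, ∀ x ∈ I₁, κ (SignType.sign (θ.f x)) (SignType.sign (θ.g x))
      (SignType.sign (θ.h x)) θ.m = d θ := by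
    intro θ x hx
    obtain ⟨δ₀, rfl, -, h2⟩ := hF θ x hx
    have h3 := (h2.2.2.1 x₁ hx₁).2.1
    rw [((hform θ).2.2.2.1 x₁ hx₁).2.1, mul_assoc, mul_assoc] at h3
    exact (mul_right_cancel₀ (mul_ne_zero (hφ.2.1 x₁ hx₁) (θ.g_ne_zero x₁ hx₁)) h3).symm
  -- The new f, g, h are proportional to δ₀ times the old ones, so a rescaling compensated by the
  -- factor leaves the image unchanged.
  have hcoeff : ∀ θ (r : ℝ) (hr : r ≠ 0), d (θ.scale hr) * r = d θ → r = 1 := by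
    intro θ r hr h
    have h1 : T.coeff (θ.scale hr) = T.coeff θ := by
      have hv : ∀ x' ∈ I₂, (T.coeff (θ.scale hr)).f x' = (T.coeff θ).f x' ∧
          (T.coeff (θ.scale hr)).g x' = (T.coeff θ).g x' ∧
          (T.coeff (θ.scale hr)).h x' = (T.coeff θ).h x' := by
        intro x' hx'
        obtain ⟨x, hx, rfl⟩ := hφ.2.2.ge hx'
        obtain ⟨a₁, a₂, a₃⟩ := (hform θ).2.2.2.1 x hx
        obtain ⟨b₁, b₂, b₃⟩ := (hform (θ.scale hr)).2.2.2.1 x hx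
        rw [a₁, a₂, a₃, b₁, b₂, b₃, ← h]
        simp only [Coeff.scale, zero_mul]
        exact ⟨by ring, by ring, by ring⟩
      ext x'
      · by_cases hx' : x' ∈ I₂
        · exact (hv x' hx').1
        · rw [Coeff.f_off _ _ hx', Coeff.f_off _ _ hx']
      · by_cases hx' : x' ∈ I₂
        · exact (hv x' hx').2.1
        · rw [Coeff.g_off _ _ hx', Coeff.g_off _ _ hx']
      · by_cases hx' : x' ∈ I₂
        · exact (hv x' hx').2.2
        · rw [Coeff.h_off _ _ hx', Coeff.h_off _ _ hx']
      · rw [(hform θ).2.2.2.2, (hform (θ.scale hr)).2.2.2.2]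
        rfl
    have h2 : r * θ.g x₁ = θ.g x₁ := congrArg (fun θ : Coeff I₁ => θ.g x₁) (T.coeff.injective h1)
    exact (mul_eq_right₀ (θ.g_ne_zero x₁ hx₁)).1 h2
  have hsign : ∀ θ θ' : Coeff I₁, ∀ x' ∈ I₂,
      SignType.sign ((T.coeff θ).f x') = SignType.sign ((T.coeff θ').f x') →
      SignType.sign ((T.coeff θ).g x') = SignType.sign ((T.coeff θ').g x') →
      SignType.sign ((T.coeff θ).h x') = SignType.sign ((T.coeff θ').h x') →
      (T.coeff θ).m = (T.coeff θ').m → d θ = d θ' := by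
    intro θ θ' x' hx' s₁ s₂ s₃ hm
    obtain ⟨x, hx, rfl⟩ := hφ.2.2.ge hx'
    have hdφ := hφ.2.1 x hx
    obtain ⟨a₁, a₂, a₃⟩ := (hform θ).2.2.2.1 x hx
    obtain ⟨b₁, b₂, b₃⟩ := (hform θ').2.2.2.1 x hx
    rw [(hform θ).2.2.2.2, (hform θ').2.2.2.2, div_left_inj' hδ₃] at hm
    rw [a₁, b₁, mul_div_assoc, mul_div_assoc] at s₁
    rw [a₂, b₂] at s₂
    rw [a₃, b₃, hm, mul_div_assoc, mul_div_assoc, mul_assoc (d θ), mul_assoc (d θ'), zero_mul,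
      zero_mul] at s₃
    have hr : d θ / d θ' ≠ 0 := div_ne_zero (hd0 θ) (hd0 θ')
    have e : d (θ.scale hr) = d θ' := by
      refine (hdx _ x hx).symm.trans (Eq.trans ?_ (hdx θ' x hx))
      simp only [Coeff.scale]
      rw [sign_div_mul_eq (hd0 θ') (hd0 θ) (div_ne_zero hδ₁ hdφ) (θ.f_ne_zero x hx)
          (θ'.f_ne_zero x hx) s₁,
        sign_div_mul_eq (hd0 θ') (hd0 θ) hdφ (θ.g_ne_zero x hx) (θ'.g_ne_zero x hx) s₂,
        sign_div_mul_eq (hd0 θ') (hd0 θ) (mul_ne_zero (div_ne_zero hδ₃ hdφ) (Real.exp_ne_zero _))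
          (θ.h_ne_zero x hx) (θ'.h_ne_zero x hx) s₃, hm]
    have h1 := hcoeff θ _ hr (by rw [e, mul_div_cancel₀ _ (hd0 θ')])
    exact (div_eq_one_iff_eq (hd0 θ')).1 h1
  classical
  -- As before, κ is evaluated on constant representatives with the given signs, now pulled back by
  -- the inverse of `T.coeff`.
  refine isUsual_of_hasForm (κ := fun σ₁ σ₂ σ₃ m =>
    if h : (σ₁ : ℝ) ≠ 0 ∧ (σ₂ : ℝ) ≠ 0 ∧ (σ₃ : ℝ) ≠ 0 ∧ m ≠ 0 then
      1 / d (T.coeff.symm (expCoeff I₂ (φ x₁) 0 0 0 h.1 h.2.1 h.2.2.1 h.2.2.2)) else 0)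
    (δ₁ := 1 / δ₁) (δ₂ := -δ₂ / δ₁) (δ₃ := 1 / δ₃) (δ₅ := -δ₅ / δ₃) hI₂ (hφ.inv hI₁ hI₂.1)
    fun θ' x' hx' => ⟨1 / d (T.coeff.symm θ'), ?_, ?_, ?_⟩
  · rw [dif_pos ⟨sign_cast_ne_zero (θ'.f_ne_zero x' hx'), sign_cast_ne_zero (θ'.g_ne_zero x' hx'),
      sign_cast_ne_zero (θ'.h_ne_zero x' hx'), θ'.m_ne_zero⟩]
    have hs : ∀ a : ℝ, SignType.sign (((SignType.sign a : SignType) : ℝ)) = SignType.sign a := by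
      intro a
      rcases lt_trichotomy a 0 with h | rfl | h
      · simp [sign_neg h]
      · simp
      · simp [sign_pos h]
    congr 1
    apply hsign _ _ x' hx' <;>
      simp [expCoeff, Set.indicator_of_mem hx', hs]
  · exact mul_ne_zero (mul_ne_zero (one_div_ne_zero (hd0 _)) (one_div_ne_zero hδ₁))
      (one_div_ne_zero hδ₃)
  · refine ((hform (T.coeff.symm θ')).2.inverse (S := T.inverse hI₁ hI₂ hT) hI₁ hI₂.1 (hd0 _) hδ₁
      hδ₃ hφ (T.coeff.apply_symm_apply θ') rfl fun _ _ => rfl).congr hI₂.1 (fun _ _ => rfl)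
      (fun x hx => θ'.hasDerivAt_intInvG hI₂ hx' hx) fun x hx => ?_
    simp

theorem IsEquivalence.exists_inverse (hI₁ : IsOpenInterval I₁) (hI₂ : IsOpenInterval I₂)
    (hT : T.IsEquivalence) :
    ∃ S : Transformation Set.univ I₂ Set.univ I₁, S.IsEquivalence ∧
      S.coeff = T.coeff.symm ∧
      (∀ θ, ∀ z ∈ box Set.univ I₁ Set.univ, S.point (T.coeff θ) (T.point θ z) = z) ∧
      (∀ θ, ∀ z ∈ box Set.univ I₂ Set.univ, T.point (T.coeff.symm θ) (S.point θ z) = z) ∧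
      (T.IsUsual → S.IsUsual) := by
  refine ⟨T.inverse hI₁ hI₂ hT, hT.inverse hI₁ hI₂, rfl, fun θ z hz => ?_, fun θ' z hz => ?_,
    IsUsual.inverse hI₁ hI₂ hT⟩
  · simp only [Transformation.inverse, Equiv.symm_apply_apply]
    exact hT.injOn_point hI₁ hI₂ θ (Function.invFunOn_mem ⟨z, hz, rfl⟩) hz
      (Function.invFunOn_eq ⟨z, hz, rfl⟩)
  · exact Function.invFunOn_eq ((hT.image_point hI₁ hI₂ _).ge hz)

end Transformation
end ReactionDiffusion

theorem theorem1 :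
    -- the transformations of the generalized extended equivalence group have the stated form,
    -- and every transformation of this form belongs to the group
    (∀ J I K I' : Set ℝ, IsOpenInterval J → IsOpenInterval I → IsOpenInterval K →
      IsOpenInterval I' → ∀ T : Transformation J I K I',
        T.IsEquivalence ↔
          ∀ θ, ∃ (δ₀ δ₁ δ₂ δ₃ δ₄ δ₅ : ℝ) (φ G : ℝ → ℝ), δ₀ * δ₁ * δ₃ ≠ 0 ∧
            IsChangeOfVariable I I' φ ∧ T.HasForm θ δ₀ δ₁ δ₂ δ₃ δ₄ δ₅ φ G) ∧
    -- all values of the constants and all functions `φ` occur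
    (∀ J I K I' : Set ℝ, IsOpenInterval J → IsOpenInterval I → IsOpenInterval K →
      IsOpenInterval I' →
        ∀ (δ₀ δ₁ δ₂ δ₃ δ₄ δ₅ : ℝ) (φ : ℝ → ℝ), ∀ x₀ ∈ I, δ₀ * δ₁ * δ₃ ≠ 0 →
          IsChangeOfVariable I I' φ →
            ∃ T : Transformation J I K I', T.IsEquivalence ∧
              ∀ θ, T.HasForm θ δ₀ δ₁ δ₂ δ₃ δ₄ δ₅ φ (θ.intInvG x₀)) ∧
    -- the usual equivalence group is given by `δ₄ = 0`
    (∀ J I K I' : Set ℝ, IsOpenInterval J → IsOpenInterval I → IsOpenInterval K →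
      IsOpenInterval I' → ∀ T : Transformation J I K I',
        (T.IsEquivalence ∧ T.IsUsual) ↔
          ∃ (κ : SignType → SignType → SignType → ℝ → ℝ) (δ₁ δ₂ δ₃ δ₅ : ℝ) (φ : ℝ → ℝ),
            IsChangeOfVariable I I' φ ∧
            ∀ θ, ∀ x₀ ∈ I, ∃ δ₀ : ℝ,
              δ₀ = κ (SignType.sign (θ.f x₀)) (SignType.sign (θ.g x₀))
                (SignType.sign (θ.h x₀)) θ.m ∧
              δ₀ * δ₁ * δ₃ ≠ 0 ∧ T.HasForm θ δ₀ δ₁ δ₂ δ₃ 0 δ₅ φ (θ.intInvG x₀)) ∧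
    -- both kinds of equivalence transformations are closed under composition
    (∀ I₁ I₂ I₃ : Set ℝ, IsOpenInterval I₁ → IsOpenInterval I₂ → IsOpenInterval I₃ →
      ∀ (T₁ : Transformation Set.univ I₁ Set.univ I₂) (T₂ : Transformation Set.univ I₂ Set.univ I₃),
        T₁.IsEquivalence → T₂.IsEquivalence →
          ∃ T : Transformation Set.univ I₁ Set.univ I₃, T.IsEquivalence ∧
            T.coeff = T₁.coeff.trans T₂.coeff ∧
            (∀ θ, ∀ z ∈ box Set.univ I₁ Set.univ,
              T.point θ z = T₂.point (T₁.coeff θ) (T₁.point θ z)) ∧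
            (T₁.IsUsual → T₂.IsUsual → T.IsUsual)) ∧
    -- and under inversion
    (∀ I₁ I₂ : Set ℝ, IsOpenInterval I₁ → IsOpenInterval I₂ →
      ∀ T : Transformation Set.univ I₁ Set.univ I₂, T.IsEquivalence →
        ∃ S : Transformation Set.univ I₂ Set.univ I₁, S.IsEquivalence ∧
          S.coeff = T.coeff.symm ∧
          (∀ θ, ∀ z ∈ box Set.univ I₁ Set.univ, S.point (T.coeff θ) (T.point θ z) = z) ∧
          (∀ θ, ∀ z ∈ box Set.univ I₂ Set.univ, T.point (T.coeff.symm θ) (S.point θ z) = z) ∧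
          (T.IsUsual → S.IsUsual)) := by
  refine ⟨fun J I K I' hJ hI hK hI' T => T.isEquivalence_iff hJ hI hK hI', ?_,
    fun J I K I' hJ hI hK hI' T => T.isEquivalence_and_isUsual_iff hJ hI hK hI',
    fun I₁ I₂ I₃ hI₁ hI₂ hI₃ T₁ T₂ h₁ h₂ => h₁.exists_comp hI₁ hI₂ hI₃ h₂,
    fun I₁ I₂ hI₁ hI₂ T hT => hT.exists_inverse hI₁ hI₂⟩
  intro J I K I' hJ hI hK hI' δ₀ δ₁ δ₂ δ₃ δ₄ δ₅ φ x₀ hx₀ hδ hφ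
  have hF := hasForm_formTransformation hI δ₀ δ₁ δ₃ δ₄ δ₅ hφ hx₀ hJ hK δ₂ hδ
  exact ⟨_, (Transformation.isEquivalence_iff hJ hI hK hI' _).2 fun θ =>
    ⟨_, _, _, _, _, _, _, _, hδ, hφ, hF θ⟩, hF⟩
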